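/- Let $R>0$, $G_2\in\mathbb R$. Parametrize the null segment $\mathcal N_L$ by the area density $\rho\in[0,R]$, with the symmetry axis at $\rho=0$ and the surface $S_0$ at $\rho=R$. A Beltrami field is a smooth $\mu:[0,R]\to\{|z|<1\}$; its conformal metric is $e=\frac1{1-|\mu|^2}\begin{pmatrix}|1+\mu|^2&2\,\mathrm{Im}\,\mu\\2\,\mathrm{Im}\,\mu&|1-\mu|^2\end{pmatrix}$. Fix any gauge, i.e. a map $\mu\mapsto\mathcal V=\mathcal V[\mu]$ to real $2\times2$ matrix fields on $[0,R]$ with $\mathcal V\mathcal V^t=e$, $\det\mathcal V=1$, such that for every Beltrami field $\mu$ and every smooth $\zeta:[0,R]\to\mathbb C$ the matrix $\mathcal V[\mu+t\zeta](\rho)$ is smooth in $(t,\rho)$ for $t$ near $0$ and $\rho\in[0,R]$. Let $P$, $Q$ be the symmetric and antisymmetric parts of $J=\mathcal V^{-1}\partial_\rho\mathcal V$. For $0<l<R$, let $T(a,b)=T(a,b;l)=\mathcal P\exp\int_a^b\big[Q+(1-\rho/l)^{-1/2}P\big]d\rho$ be the path ordered exponential (ordered from left to right), $\hat{\mathcal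 V}(x;l)=\mathcal V(0)T(0,x;l)$ and $\mathcal U(l)=\hat{\mathcal V}(l;l)$. The Poisson bracket of functionals of $\mu,\bar\mu$ with continuous functional derivatives (taken with respect to variations that are smooth on $[0,R]$) is defined by $\{\mu,\mu\}=\{\bar\mu,\bar\mu\}=0$ and $$\{\mu(x),\bar\mu(y)\}=4\pi G_2\,H(x,y)\,\frac{1-|\mu(x)|^2}{\sqrt x}\,\frac{1-|\mu(y)|^2}{\sqrt y}\,\exp\int_x^y\frac{\bar\mu\,d\mu-\mu\,d\bar\mu}{1-|\mu|^2},$$ with $H(x,y)=1$ for $x\ge y$ and $H(x,y)=0$ otherwise. Let $\mathfrak k$ be the space of real symmetric trace-free $2\times2$ matrices, let superscripts $1,2$ mark the two factors of a tensor product, let $[\cdot]_{\mathfrak{kk}}$ denote the $\mathfrak k\otimes\mathfrak k$ component, and let $\Omega_{\mathfrak g}$, with components $\Omega_{\mathfrak g\,i}{}^j{}_k{}^l=\frac14[\delta_i^l\delta_k^j-\frac12\delta_i^j\delta_k^l]$, be the inverse of the Killing form of $\mathfrak{sl}(2)$. Put $$M(l_1,l_2)=\big[\overset1T(l_1,0)\,\overset2T(l_2,0)\,\Omega_{\mathfrak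 g}\,\overset1T(0,l_1)\,\overset2T(0,l_2)\big]_{\mathfrak{kk}},$$ where the holonomy in space $i$ has deformation parameter $l_i$. Then at every Beltrami field $\mu$, as distributions in $(l_1,l_2)\in(0,R)^2$, including the diagonal $l_1=l_2$, $$\big[\overset1{\mathcal U}{}^{-1}\overset2{\mathcal U}{}^{-1}\{\overset1{\mathcal U}(l_1),\overset2{\mathcal U}(l_2)\}\big]_{\mathfrak{kk}}=16\pi G_2\;\mathrm{p.v.}\Big(\frac1{l_1-l_2}\Big)\,M(l_1,l_2).$$ In detail: (1) For each $C^1$ function $f$ compactly supported in $(0,R)^2$ and each component of $M$, the limit $\lim_{\epsilon\to0^+}\int_{|l_1-l_2|>\epsilon}\frac{f(l_1,l_2)M(l_1,l_2)}{l_1-l_2}\,d^2l$ exists, and for $f$ supported in a fixed compact subset of $(0,R)^2$ it is bounded by a constant (depending on that subset, on $\mu$ and on the gauge) times the $C^1$ norm of $f$; that is, the right side is a distribution of order at most one. (2) For all $C^1$ functions $\varphi_1,\varphi_2:(0,R)\to\mathfrak k$ of compact support, the functionals $\Phi_i[\nu]=\int_0^R\mathrm{tr}\big[\varphi_i(l)\,\mathcal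 U[\mu](l)^{-1}\,\mathcal U[\nu](l)\big]dl$ have continuous functional derivatives at $\nu=\mu$, their Poisson bracket at $\mu$ (the logarithmic bracket smeared with $\varphi_1\otimes\varphi_2$) is given by an absolutely convergent integral, and $$\{\Phi_1,\Phi_2\}(\mu)=16\pi G_2\lim_{\epsilon\to0^+}\int_{|l_1-l_2|>\epsilon}\frac{\mathrm{tr}_{12}\big[\overset1\varphi_1(l_1)\,\overset2\varphi_2(l_2)\,M(l_1,l_2)\big]}{l_1-l_2}\,d^2l .$$ -/

import Mathlib

open Set Filter MeasureTheory Topology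
open scoped Matrix Kronecker ContDiff ComplexConjugate

noncomputable section

namespace CylGrav

/-- Real `2 × 2` matrices. -/
abbrev Mat2 := Matrix (Fin 2) (Fin 2) ℝ

/-- The tensor product of two copies of the algebra of `2 × 2` matrices. The pair of row
(column) indices is the pair of row (column) indices in space 1 and in space 2. -/
abbrev Mat22 := Matrix (Fin 2 × Fin 2) (Fin 2 × Fin 2) ℝ

/-! ### Path ordered exponentials -/

/-- The term of order `s` of the path ordered exponential of `A` from `a` to `b`,
`∫_a^b dz₁ ∫_{z₁}^b dz₂ ⋯ ∫_{z_{s-1}}^b dz_s A(z₁) ⋯ A(z_s)`, integrated entry by entry. -/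
def pathOrderedTerm (A : ℝ → Mat2) : ℕ → ℝ → ℝ → Mat2
  | 0, _, _ => 1
  | s + 1, a, b => Matrix.of fun i j => ∫ z in a..b, (A z * pathOrderedTerm A s z b) i j

/-- The path ordered exponential of `A` from `a` to `b`, ordered from left to right. -/
def pathOrderedExp (A : ℝ → Mat2) (a b : ℝ) : Mat2 :=
  ∑' s : ℕ, pathOrderedTerm A s a b

/-! ### The fields on the null segment

The null segment `𝓝_L` is parametrized by the area density `ρ ∈ [0, R]`, with the symmetry
axis at `ρ = 0` and the surface `S₀` at `ρ = R`. Only the values on `[0, R]` of the fields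
below matter. -/

/-- A Beltrami coefficient that is smooth on the whole segment, including the axis. -/
structure IsBeltrami (R : ℝ) (μ : ℝ → ℂ) : Prop where
  smooth : ContDiffOn ℝ ∞ μ (Icc 0 R)
  norm_lt_one : ∀ x ∈ Icc 0 R, ‖μ x‖ < 1

/-- The conformal 2-metric with Beltrami coefficient `m`: the symmetric matrix `e` such that
`e_ab dθ^a dθ^b = |dz + m dz̄|² / (1 - |m|²)`, where `z = θ¹ + i θ²`. -/
def confMetric (m : ℂ) : Mat2 :=
  (1 - ‖m‖ ^ 2)⁻¹ • !![‖1 + m‖ ^ 2, 2 * m.im; 2 * m.im, ‖1 - m‖ ^ 2]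

/-- A choice of gauge: to each Beltrami coefficient `μ` a real zweibein field `𝒱 μ` of
determinant one for the conformal metric of `μ`. The zweibein may be a nonlocal functional
of `μ`, but it depends smoothly on the position and on the parameter of any straight
one-parameter family of Beltrami coefficients. -/
structure IsZweibein (R : ℝ) (𝒱 : (ℝ → ℂ) → ℝ → Mat2) : Prop where
  metric : ∀ μ, IsBeltrami R μ → ∀ x ∈ Icc 0 R, 𝒱 μ x * (𝒱 μ x)ᵀ = confMetric (μ x)
  det_eq_one : ∀ μ, IsBeltrami R μ → ∀ x ∈ Icc 0 R, (𝒱 μ x).det = 1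
  smooth : ∀ μ, IsBeltrami R μ → ∀ ζ : ℝ → ℂ, ContDiffOn ℝ ∞ ζ (Icc 0 R) →
    ∃ δ > 0, ∀ i j, ContDiffOn ℝ ∞
      (fun p : ℝ × ℝ => 𝒱 (fun y => μ y + p.1 • ζ y) p.2 i j) (Ioo (-δ) δ ×ˢ Icc 0 R)

/-- The connection `J = V⁻¹ dV`, as a component with respect to `ρ`. -/
def connJ (R : ℝ) (V : ℝ → Mat2) (x : ℝ) : Mat2 :=
  (V x)⁻¹ * Matrix.of fun i j => derivWithin (fun y => V y i j) (Icc 0 R) x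

/-- The symmetric part of the connection. -/
def connP (R : ℝ) (V : ℝ → Mat2) (x : ℝ) : Mat2 :=
  (1 / 2 : ℝ) • (connJ R V x + (connJ R V x)ᵀ)

/-- The antisymmetric part of the connection. -/
def connQ (R : ℝ) (V : ℝ → Mat2) (x : ℝ) : Mat2 :=
  (1 / 2 : ℝ) • (connJ R V x - (connJ R V x)ᵀ)

/-- The deformed connection `Q + u P`, `u = 1 / √(1 - ρ / l)`, at the field point `ρ = x`,
for deformation parameter `l`. It is used for `0 < l` and `x ≤ l` only, where `u` is real;
the point `x = l` is negligible in all integrals. -/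
def connHat (R : ℝ) (V : ℝ → Mat2) (l x : ℝ) : Mat2 :=
  connQ R V x + (1 / Real.sqrt (1 - x / l)) • connP R V x

/-- The holonomy `T(a, b)` from `a` to `b` of the deformed connection with deformation
parameter `l`. -/
def holonomy (R : ℝ) (V : ℝ → Mat2) (l a b : ℝ) : Mat2 :=
  pathOrderedExp (connHat R V l) a b

/-- The deformed zweibein at field point `x`, for deformation parameter `l`. -/
def Vhat (R : ℝ) (V : ℝ → Mat2) (x l : ℝ) : Mat2 :=
  V 0 * holonomy R V l 0 x

/-- The deformed zweibein evaluated at the deformation point. -/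
def U (R : ℝ) (V : ℝ → Mat2) (l : ℝ) : Mat2 :=
  Vhat R V l l

/-! ### Functional derivatives and the Poisson bracket -/

/-- The functional `F` of the Beltrami coefficient has the continuous functional derivatives
`a = δF/δμ` and `b = δF/δμ̄` at `μ`: for all variations `δμ = ζ` that are smooth on the
closed segment, `δF = ∫ (a δμ + b δμ̄) dρ`. (This determines `a` and `b` on `[0, R]`.) -/
structure HasFunctionalDeriv (R : ℝ) (F : (ℝ → ℂ) → ℂ) (μ a b : ℝ → ℂ) : Prop where
  continuousOn_left : ContinuousOn a (Icc 0 R)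
  continuousOn_right : ContinuousOn b (Icc 0 R)
  hasDerivAt : ∀ ζ : ℝ → ℂ, ContDiffOn ℝ ∞ ζ (Icc 0 R) →
    HasDerivAt (fun t : ℝ => F (fun y => μ y + t • ζ y))
      (∫ x in (0 : ℝ)..R, (a x * ζ x + b x * conj (ζ x))) 0

/-- The phase `exp ∫_x^y (μ̄ dμ - μ dμ̄) / (1 - μ μ̄)`. -/
def phaseFactor (R : ℝ) (μ : ℝ → ℂ) (x y : ℝ) : ℂ :=
  Complex.exp (∫ z in x..y,
    (conj (μ z) * derivWithin μ (Icc 0 R) z - μ z * conj (derivWithin μ (Icc 0 R) z)) /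
      (1 - μ z * conj (μ z)))

/-- The bracket `{μ(x), μ̄(y)}` of the fundamental fields. The step function is `1` if the
first point lies on `S₀`, that is at `ρ = R`, or between `S₀` and the second point. -/
def muBracket (R G₂ : ℝ) (μ : ℝ → ℂ) (x y : ℝ) : ℂ :=
  4 * Real.pi * G₂ * (if y ≤ x then 1 else 0) *
    ((1 - μ x * conj (μ x)) / Real.sqrt x) * ((1 - μ y * conj (μ y)) / Real.sqrt y) *
    phaseFactor R μ x y

/-- The Poisson bracket `{F₁, F₂}` at `μ` exists and is equal to `c`. It is the bracket
defined by `{μ, μ} = {μ̄, μ̄} = 0` and `{μ(x), μ̄(y)} = muBracket x y`, hence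
`{μ̄(x), μ(y)} = - muBracket y x`; the density `ρ` is a fixed function. -/
def HasPoissonBracket (R G₂ : ℝ) (F₁ F₂ : (ℝ → ℂ) → ℂ) (μ : ℝ → ℂ) (c : ℂ) : Prop :=
  ∃ a₁ b₁ a₂ b₂ : ℝ → ℂ,
    HasFunctionalDeriv R F₁ μ a₁ b₁ ∧ HasFunctionalDeriv R F₂ μ a₂ b₂ ∧
    IntegrableOn (fun p : ℝ × ℝ => a₁ p.1 * muBracket R G₂ μ p.1 p.2 * b₂ p.2
      - b₁ p.1 * muBracket R G₂ μ p.2 p.1 * a₂ p.2) (Icc 0 R ×ˢ Icc 0 R) ∧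
    c = ∫ p in Icc (0 : ℝ) R ×ˢ Icc (0 : ℝ) R,
      (a₁ p.1 * muBracket R G₂ μ p.1 p.2 * b₂ p.2
        - b₁ p.1 * muBracket R G₂ μ p.2 p.1 * a₂ p.2)

/-- A `C¹` test function of the deformation parameter, compactly supported in `(0, R)`, with
values in the space `𝔨` of symmetric trace free matrices. -/
structure IsTestFunction (R : ℝ) (φ : ℝ → Mat2) : Prop where
  contDiff : ∀ i j, ContDiff ℝ 1 fun l => φ l i j
  hasCompactSupport : HasCompactSupport φ
  tsupport_subset : tsupport φ ⊆ Ioo 0 R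
  symmetric : ∀ l, (φ l)ᵀ = φ l
  trace_eq_zero : ∀ l, (φ l).trace = 0

/-- The functional `ν ↦ ∫ tr[φ(l) U[μ](l)⁻¹ U[ν](l)] dl`. Its variation at `ν = μ` is the
smeared logarithmic variation `∫ tr[φ U⁻¹ δU] dl`, so that the Poisson bracket at `μ` of two
such functionals is the smeared logarithmic bracket
`∬ tr₁₂[φ₁(l₁) ⊗ φ₂(l₂) U₁⁻¹ U₂⁻¹ {U₁(l₁), U₂(l₂)}] dl₁ dl₂`. -/
def smearedU (R : ℝ) (𝒱 : (ℝ → ℂ) → ℝ → Mat2) (μ : ℝ → ℂ) (φ : ℝ → Mat2)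
    (ν : ℝ → ℂ) : ℂ :=
  ((∫ l in (0 : ℝ)..R, (φ l * (U R (𝒱 μ) l)⁻¹ * U R (𝒱 ν) l).trace : ℝ) : ℂ)

/-! ### The right side of the bracket -/

/-- The inverse `Ω_𝔤` of the Killing form `(X, Y) ↦ 4 tr(XY)` of `𝔰𝔩(2)`:
`Ω_i^j_k^l = ¼ [δ_i^l δ_k^j - ½ δ_i^j δ_k^l]`. -/
def Omega : Mat22 := Matrix.of fun p q =>
  (1 / 4 : ℝ) * ((if p.1 = q.2 ∧ p.2 = q.1 then 1 else 0) - (1 / 2) * (if p = q then 1 else 0))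

/-- The `𝔨 ⊗ 𝔨` component of an element of `𝔤 ⊗ 𝔤`: the part that is symmetric under the
transposition in each of the two spaces. -/
def kkPart (M : Mat22) : Mat22 := Matrix.of fun p q =>
  (1 / 4 : ℝ) * (M p q + M (q.1, p.2) (p.1, q.2) + M (p.1, q.2) (q.1, p.2) + M q p)

/-- `[T₁(x₁, 0) T₂(x₂, 0) Ω_𝔤 T₁(0, x₁) T₂(0, x₂)]_{𝔨𝔨}`, where `x_i` is the point with
`ρ(x_i) = l_i` and `T_i` is the holonomy for deformation parameter `l_i`. -/
def core (R : ℝ) (V : ℝ → Mat2) (l₁ l₂ : ℝ) : Mat22 :=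
  kkPart ((holonomy R V l₁ l₁ 0 ⊗ₖ (1 : Mat2)) * ((1 : Mat2) ⊗ₖ holonomy R V l₂ l₂ 0) * Omega *
    (holonomy R V l₁ 0 l₁ ⊗ₖ (1 : Mat2)) * ((1 : Mat2) ⊗ₖ holonomy R V l₂ 0 l₂))

/-- The Cauchy principal value integral `∬ f(l₁, l₂) p.v.(1 / (l₁ - l₂)) dl₁ dl₂` exists and
is equal to `c`. -/
def HasPV (f : ℝ × ℝ → ℝ) (c : ℝ) : Prop :=
  (∀ ε > 0, IntegrableOn (fun p : ℝ × ℝ => f p / (p.1 - p.2)) {p | ε < |p.1 - p.2|}) ∧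
  Tendsto (fun ε : ℝ => ∫ p in {p : ℝ × ℝ | ε < |p.1 - p.2|}, f p / (p.1 - p.2))
    (𝓝[>] 0) (𝓝 c)

end CylGrav

end

/-!
The smeared logarithmic bracket is computed in closed form and recognised as a principal value.

**The regularised holonomies.** With `z = l - r²` the deformed connection `Q + u P` becomes
`2 r Q + 2 √l P` at `z`, in which the inverse square root singularity at `z = l` is gone. Hence
`T(l - r², l)` is a solution `S l r` of a linear equation with continuously differentiable
coefficients (`pathOrderedExp_eq`, `holonomy_eq`), which is unimodular and differentiable in all
parameters (`exists_param_ode`).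

**The variation of the holonomies.** A test function `φ` gives the section `X l r = S φ S⁻¹`, which
splits into an antisymmetric component `η` and a symmetric component `w`. In the frame that is
rotated along with `Q`, they satisfy `∂η/∂r = 4 √l Im(p̄ w)`, `∂w/∂r = 4 i √l p η`, where `p` is the
field `P` at `l - r²` (`IsRadialPair`, `isRadialPair_adjointSection`). A variation of the Beltrami
field changes the symmetric part of `V⁻¹ δV` by `v = gaugeFactor · δμ`, whatever the gauge
(`gaugePhase_mul_wComp_variation`). The antisymmetric part, which does depend on the gauge, drops
out of the variation of the smeared holonomy, which is `∬ (4 / √l) Re[w̄ (z v' + v / 2)] dr dl`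
(`integral_variation`). Exchanging the integrations produces the Abel transform
`F(z) = 2 ∫ w(z + r², r) / √(z + r²) dr`, and an integration by parts the functional derivative
`-conj(z F' + F / 2) · gaugeFactor` with respect to `μ` (`IsBackground.hasFunctionalDeriv`).

**The bracket.** The phase in the bracket of the fundamental fields is the ratio of the phases of the
gauge factors at the two points (`gaugeFactor_mul_muBracket`). In the rotating frame the bracket
is therefore `4π G₂ H(x, y) / √(x y)`. As `(z F' + F / 2) / √z` is the derivative of `√z F`, which
vanishes at both ends, the bracket is `-4π G₂ ∫ 2 Re[F̄₁ (z F₂' + F₂ / 2)] dz`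
(`IsBackground.hasPoissonBracket`).

**The principal value.** Written as a double integral over `l₁` and `l₂`, the integrand of this
integral times `l₁ - l₂` is the `z`-derivative of the form `-2 η₁ η₂ + 2 ϱ Re(w̄₁ w₂)` of the two
sections at the point `z`, with the weight `ϱ = √(l₂ (l₁ - z)) / √(l₁ (l₂ - z))`
(`hasDerivAt_pointForm`). At the axis the form is the trace of `X₁ X₂` (`axisForm`), that is, four
times the smeared right side (`trace_kronecker_core_eq_axisForm`). The Abel kernels are not
integrable enough at `z = min(l₁, l₂)` for this exchange of integrations. So they are cut off
at `r = σ`; after symmetrization the contribution of the cutoff is bounded by a constant times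
`|l₁ - l₂|` before the division by `l₁ - l₂`, and tends to zero with `σ` (`abs_weightedForm_sub_le`,
`neg_integral_abel_bracket`). What remains is the integral of
`(N(l₁, l₂) - N(l₂, l₁)) / (l₁ - l₂)` over half the square, which is the principal value of
`N / (l₁ - l₂)`, as `N(l₁, l₂) - N(l₂, l₁)` is at most a constant times `|l₁ - l₂|`
(`hasPV_of_antisymm`).
-/

noncomputable section

namespace CylGrav

/-! ### Linear differential equations with parameters -/

section LinearODE

set_option linter.unusedSectionVars false

variable {𝔸 : Type*} [NormedRing 𝔸] [NormedAlgebra ℝ 𝔸]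
variable {Y : Type*}

/-- The terms of the Dyson series of the linear equation `S' = A S` with `S 0 = 1`. -/
def dysonTerm (A : Y → ℝ → 𝔸) : ℕ → Y → ℝ → 𝔸
  | 0, _, _ => 1
  | n + 1, y, r => ∫ s in (0 : ℝ)..r, A y s * dysonTerm A n y s

lemma norm_dysonTerm_le {A : Y → ℝ → 𝔸} {y : Y} {N C : ℝ}
    (hC : ∀ s, |s| ≤ N → ‖A y s‖ ≤ C) (n : ℕ) :
    ∀ r, |r| ≤ N → ‖dysonTerm A n y r‖ ≤ ‖(1 : 𝔸)‖ * ((C * |r|) ^ n / n.factorial) := by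
  induction n with
  | zero => intro r _; simp [dysonTerm]
  | succ n ih =>
    intro r hr
    have hC0 : 0 ≤ C := (norm_nonneg _).trans (hC r hr)
    have hmem : ∀ s ∈ uIoc 0 r, |s| ≤ |r| := by
      intro s hs
      have := abs_sub_left_of_mem_uIcc (uIoc_subset_uIcc hs)
      simpa using this
    calc ‖dysonTerm A (n + 1) y r‖
        ≤ ∫ s in uIoc 0 r, ‖A y s * dysonTerm A n y s‖ :=
          intervalIntegral.norm_integral_le_integral_norm_uIoc
      _ ≤ ∫ s in uIoc 0 r, (‖(1 : 𝔸)‖ * C ^ (n + 1) / n.factorial) * |s - 0| ^ n := by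
          refine integral_mono_of_nonneg (ae_of_all _ fun _ => norm_nonneg _) ?_ ?_
          · exact (by fun_prop : Continuous fun s : ℝ =>
              (‖(1 : 𝔸)‖ * C ^ (n + 1) / n.factorial) * |s - 0| ^ n).integrableOn_uIoc
          · filter_upwards [ae_restrict_mem measurableSet_uIoc] with s hs
            have h1 := (hmem s hs).trans hr
            calc ‖A y s * dysonTerm A n y s‖ ≤ ‖A y s‖ * ‖dysonTerm A n y s‖ := norm_mul_le _ _
              _ ≤ C * (‖(1 : 𝔸)‖ * ((C * |s|) ^ n / n.factorial)) :=
                mul_le_mul (hC s h1) (ih s h1) (norm_nonneg _) hC0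
              _ = _ := by rw [sub_zero]; ring
      _ = ‖(1 : 𝔸)‖ * ((C * |r|) ^ (n + 1) / (n + 1).factorial) := by
          rw [integral_const_mul, integral_pow_abs_sub_uIoc, Nat.factorial_succ]
          push_cast
          have : (n.factorial : ℝ) ≠ 0 := by positivity
          have : (n : ℝ) + 1 ≠ 0 := by positivity
          rw [sub_zero, mul_pow]
          field_simp

variable [TopologicalSpace Y]

lemma continuous_dysonTerm {A : Y → ℝ → 𝔸} (hA : Continuous fun p : Y × ℝ => A p.1 p.2) (n : ℕ) :
    Continuous fun p : Y × ℝ => dysonTerm A n p.1 p.2 := by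
  induction n with
  | zero => exact continuous_const
  | succ n ih =>
    exact intervalIntegral.continuous_parametric_primitive_of_continuous
      (f := fun y s => A y s * dysonTerm A n y s) (hA.mul ih)

/-- The sum of the Dyson series: the solution of `S' = A S` with `S 0 = 1`. -/
def dysonSum (A : Y → ℝ → 𝔸) (y : Y) (r : ℝ) : 𝔸 := ∑' n, dysonTerm A n y r

lemma dysonSum_zero (A : Y → ℝ → 𝔸) (y : Y) : dysonSum A y 0 = 1 := by
  rw [dysonSum, tsum_eq_single 0]
  · rfl
  · intro n hn
    obtain ⟨m, rfl⟩ := Nat.exists_eq_succ_of_ne_zero hn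
    simp [dysonTerm]

lemma exists_nhds_norm_le {A : Y → ℝ → 𝔸} (hA : Continuous fun p : Y × ℝ => A p.1 p.2) (y₀ : Y)
    (N : ℝ) : ∃ u ∈ 𝓝 y₀, ∃ C, ∀ y ∈ u, ∀ s, |s| ≤ N → ‖A y s‖ ≤ C := by
  obtain ⟨C, hC⟩ := (isCompact_Icc (a := -N) (b := N)).exists_bound_of_continuousOn
    (f := A y₀) (hA.comp (Continuous.prodMk_right y₀)).continuousOn
  have hopen : IsOpen {p : Y × ℝ | ‖A p.1 p.2‖ < C + 1} := isOpen_lt hA.norm continuous_const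
  obtain ⟨u, v, hu, -, hyu, hv, huv⟩ := generalized_tube_lemma (isCompact_singleton (x := y₀))
    (isCompact_Icc (a := -N) (b := N)) hopen (by
      rintro ⟨y, s⟩ ⟨hy, hs⟩
      rw [mem_singleton_iff] at hy
      dsimp only at hy hs
      subst hy
      exact (hC s hs).trans_lt (lt_add_one C))
  exact ⟨u, hu.mem_nhds (hyu rfl), C + 1, fun y hy s hs =>
    le_of_lt (huv (a := (y, s)) ⟨hy, hv (abs_le.mp hs)⟩)⟩

lemma norm_dysonTerm_le' {A : Y → ℝ → 𝔸} {y : Y} {N C : ℝ} (hC : ∀ s, |s| ≤ N → ‖A y s‖ ≤ C)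
    (n : ℕ) (r : ℝ) (hr : |r| ≤ N) :
    ‖dysonTerm A n y r‖ ≤ ‖(1 : 𝔸)‖ * ((C * N) ^ n / n.factorial) := by
  have hC0 : 0 ≤ C := (norm_nonneg _).trans (hC r hr)
  refine (norm_dysonTerm_le hC n r hr).trans ?_
  gcongr

lemma summable_dyson_bound (𝔸 : Type*) [NormedRing 𝔸] (x : ℝ) :
    Summable fun n : ℕ => ‖(1 : 𝔸)‖ * (x ^ n / n.factorial) :=
  (Real.summable_pow_div_factorial x).mul_left _

variable [CompleteSpace 𝔸]

lemma continuous_dysonSum {A : Y → ℝ → 𝔸} (hA : Continuous fun p : Y × ℝ => A p.1 p.2) :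
    Continuous fun p : Y × ℝ => dysonSum A p.1 p.2 := by
  rw [continuous_iff_continuousAt]
  rintro ⟨y₀, r₀⟩
  obtain ⟨u, hu, C, hC⟩ := exists_nhds_norm_le hA y₀ (|r₀| + 1)
  have hmem : u ×ˢ Icc (-(|r₀| + 1)) (|r₀| + 1) ∈ 𝓝 (y₀, r₀) :=
    prod_mem_nhds hu (Icc_mem_nhds (by linarith [neg_abs_le r₀]) (by linarith [le_abs_self r₀]))
  refine ContinuousOn.continuousAt (continuousOn_tsum
    (fun n => (continuous_dysonTerm hA n).continuousOn)
    (summable_dyson_bound 𝔸 (C * (|r₀| + 1))) ?_) hmem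
  rintro n ⟨y, r⟩ ⟨hy, hr⟩
  exact norm_dysonTerm_le' (hC y hy) n r (abs_le.mpr hr)

lemma hasDerivAt_dysonSum {A : Y → ℝ → 𝔸} (hA : Continuous fun p : Y × ℝ => A p.1 p.2) (y : Y)
    (r : ℝ) : HasDerivAt (dysonSum A y) (A y r * dysonSum A y r) r := by
  have hderiv : ∀ n y r, HasDerivAt (dysonTerm A (n + 1) y) (A y r * dysonTerm A n y r) r := by
    intro n y r
    have hc : Continuous fun s => A y s * dysonTerm A n y s :=
      (hA.mul (continuous_dysonTerm hA n)).comp (Continuous.prodMk_right y)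
    exact intervalIntegral.integral_hasDerivAt_right (hc.intervalIntegrable _ _)
      (hc.stronglyMeasurableAtFilter _ _) hc.continuousAt
  obtain ⟨u, hu, C, hC⟩ := exists_nhds_norm_le hA y (|r| + 1)
  have hCy := hC y (mem_of_mem_nhds hu)
  have hsum : ∀ s, |s| ≤ |r| + 1 → Summable fun n => dysonTerm A n y s := fun s hs =>
    Summable.of_norm_bounded (summable_dyson_bound 𝔸 (C * (|r| + 1))) fun n =>
      norm_dysonTerm_le' hCy n s hs
  have hr1 : |r| ≤ |r| + 1 := by linarith
  have hIoo : ∀ s ∈ Ioo (-(|r| + 1)) (|r| + 1), |s| ≤ |r| + 1 := fun s hs =>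
    abs_le.mpr ⟨hs.1.le, hs.2.le⟩
  have hrI : r ∈ Ioo (-(|r| + 1)) (|r| + 1) :=
    ⟨by linarith [neg_abs_le r], by linarith [le_abs_self r]⟩
  have h1 : HasDerivAt (fun s => ∑' n, dysonTerm A (n + 1) y s)
      (∑' n, A y r * dysonTerm A n y r) r := by
    refine hasDerivAt_tsum_of_isPreconnected
      ((summable_dyson_bound 𝔸 (C * (|r| + 1))).mul_left C) isOpen_Ioo
      isPreconnected_Ioo (fun n s _ => hderiv n y s) ?_ hrI
      ((summable_nat_add_iff 1).mpr (hsum r hr1)) hrI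
    intro n s hs
    have h2 := hIoo s hs
    exact (norm_mul_le _ _).trans (mul_le_mul (hCy s h2)
      (norm_dysonTerm_le' hCy n s h2) (norm_nonneg _)
      ((norm_nonneg _).trans (hCy s h2)))
  rw [(hsum r hr1).tsum_mul_left] at h1
  have h2 : HasDerivAt (fun s => (1 : 𝔸) + ∑' n, dysonTerm A (n + 1) y s)
      (A y r * ∑' n, dysonTerm A n y r) r := h1.const_add 1
  refine h2.congr_of_eventuallyEq ?_
  filter_upwards [isOpen_Ioo.mem_nhds hrI] with s hs
  rw [dysonSum, (hsum s (hIoo s hs)).tsum_eq_zero_add]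
  rfl

/-- Differentiable dependence on a real parameter `p`. The two solutions are compared by
`S_{p'} - S_p = S_p ∫ S_p⁻¹ (A_{p'} - A_p) S_{p'}`, in which the difference quotient of `A` is an
average of `∂A/∂p`, continuous in all its arguments. -/
theorem hasDerivAt_param_linearODE {A A' S T : Y → ℝ → ℝ → 𝔸}
    (hA' : Continuous fun x : Y × ℝ × ℝ => A' x.1 x.2.1 x.2.2)
    (hAp : ∀ y p r, HasDerivAt (fun p => A y p r) (A' y p r) p)
    (hS : Continuous fun x : Y × ℝ × ℝ => S x.1 x.2.1 x.2.2)
    (hT : Continuous fun x : Y × ℝ × ℝ => T x.1 x.2.1 x.2.2)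
    (hS0 : ∀ y p, S y p 0 = 1) (hTS : ∀ y p r, T y p r * S y p r = 1)
    (hST : ∀ y p r, S y p r * T y p r = 1)
    (hSr : ∀ y p r, HasDerivAt (S y p) (A y p r * S y p r) r)
    (hTr : ∀ y p r, HasDerivAt (T y p) (-(T y p r * A y p r)) r) :
    (Continuous fun x : Y × ℝ × ℝ => S x.1 x.2.1 x.2.2 *
      ∫ s in (0 : ℝ)..x.2.2, T x.1 x.2.1 s * A' x.1 x.2.1 s * S x.1 x.2.1 s) ∧
    ∀ y p r, HasDerivAt (fun p => S y p r)
      (S y p r * ∫ s in (0 : ℝ)..r, T y p s * A' y p s * S y p s) p := by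
  constructor
  · refine hS.mul ?_
    have h := intervalIntegral.continuous_parametric_primitive_of_continuous (μ := volume) (a₀ := 0)
      (f := fun (x : Y × ℝ) s => T x.1 x.2 s * A' x.1 x.2 s * S x.1 x.2 s) (by
        have hm : Continuous fun z : (Y × ℝ) × ℝ => ((z.1.1, z.1.2, z.2) : Y × ℝ × ℝ) := by
          fun_prop
        exact ((hT.comp hm).mul (hA'.comp hm)).mul (hS.comp hm))
    have hm : Continuous fun x : Y × ℝ × ℝ => (((x.1, x.2.1), x.2.2) : (Y × ℝ) × ℝ) := by fun_prop
    exact h.comp hm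
  · intro y p r
    -- the difference quotient of `A` between `p` and `p'`, as an average of the derivative
    set q : ℝ → ℝ → 𝔸 := fun p' s => ∫ τ in (0 : ℝ)..1, A' y (p + τ * (p' - p)) s with hq
    have hA'y : Continuous fun x : ℝ × ℝ => A' y x.1 x.2 :=
      hA'.comp (by fun_prop : Continuous fun x : ℝ × ℝ => ((y, x.1, x.2) : Y × ℝ × ℝ))
    have hSy : Continuous fun x : ℝ × ℝ => S y x.1 x.2 :=
      hS.comp (by fun_prop : Continuous fun x : ℝ × ℝ => ((y, x.1, x.2) : Y × ℝ × ℝ))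
    have hTy : Continuous fun x : ℝ × ℝ => T y x.1 x.2 :=
      hT.comp (by fun_prop : Continuous fun x : ℝ × ℝ => ((y, x.1, x.2) : Y × ℝ × ℝ))
    have hqc : Continuous fun x : ℝ × ℝ => q x.1 x.2 := by
      refine intervalIntegral.continuous_parametric_intervalIntegral_of_continuous'
        (f := fun (x : ℝ × ℝ) τ => A' y (p + τ * (x.1 - p)) x.2) ?_ 0 1
      exact hA'y.comp (by fun_prop : Continuous fun z : (ℝ × ℝ) × ℝ =>
        ((p + z.2 * (z.1.1 - p), z.1.2) : ℝ × ℝ))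
    have hqA : ∀ p' s, A y p' s - A y p s = (p' - p) • q p' s := by
      intro p' s
      have hd : ∀ τ ∈ uIcc (0 : ℝ) 1, HasDerivAt (fun τ : ℝ => A y (p + τ * (p' - p)) s)
          ((p' - p) • A' y (p + τ * (p' - p)) s) τ := by
        intro τ _
        have h1 : HasDerivAt (fun τ : ℝ => p + τ * (p' - p)) (p' - p) τ := by
          simpa using ((hasDerivAt_id τ).mul_const (p' - p)).const_add p
        exact HasDerivAt.scomp τ (hAp y (p + τ * (p' - p)) s) h1
      have hc : Continuous fun τ : ℝ => (p' - p) • A' y (p + τ * (p' - p)) s :=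
        (hA'y.comp (by fun_prop : Continuous fun τ : ℝ =>
          ((p + τ * (p' - p), s) : ℝ × ℝ))).const_smul _
      have := intervalIntegral.integral_eq_sub_of_hasDerivAt hd (hc.intervalIntegrable _ _)
      rw [intervalIntegral.integral_smul] at this
      rw [hq]; dsimp only
      rw [this]; simp
    set g : ℝ → 𝔸 := fun p' => S y p r * ∫ s in (0 : ℝ)..r, T y p s * q p' s * S y p' s with hg
    have hgc : Continuous g := by
      refine continuous_const.mul
        (intervalIntegral.continuous_parametric_intervalIntegral_of_continuous'
          (f := fun p' s => T y p s * q p' s * S y p' s) ?_ 0 r)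
      exact ((hTy.comp (by fun_prop : Continuous fun z : ℝ × ℝ => ((p, z.2) : ℝ × ℝ))).mul
        hqc).mul hSy
    have hdiff : ∀ p', S y p' r - S y p r = (p' - p) • g p' := by
      intro p'
      have hd : ∀ s ∈ uIcc 0 r, HasDerivAt (fun s => T y p s * S y p' s)
          ((p' - p) • (T y p s * q p' s * S y p' s)) s := by
        intro s _
        refine ((hTr y p s).mul (hSr y p' s)).congr_deriv ?_
        rw [← smul_mul_assoc, ← mul_smul_comm, ← hqA]
        noncomm_ring
      have hc : Continuous fun s => (p' - p) • (T y p s * q p' s * S y p' s) :=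
        (((hTy.comp (Continuous.prodMk_right p)).mul (hqc.comp (Continuous.prodMk_right p'))).mul
          (hSy.comp (Continuous.prodMk_right p'))).const_smul _
      have h1 := intervalIntegral.integral_eq_sub_of_hasDerivAt hd (hc.intervalIntegrable _ _)
      rw [intervalIntegral.integral_smul] at h1
      have h2 : T y p 0 = 1 := by have := hTS y p 0; rwa [hS0, mul_one] at this
      rw [hg]; dsimp only
      rw [← mul_smul_comm, h1, mul_sub, ← mul_assoc, hST, one_mul, h2, hS0, one_mul, mul_one]
    have hgp : g p = S y p r * ∫ s in (0 : ℝ)..r, T y p s * A' y p s * S y p s := by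
      simp [hg, hq]
    rw [← hgp, hasDerivAt_iff_tendsto_slope]
    refine (hgc.continuousAt.tendsto.mono_left nhdsWithin_le_nhds).congr' ?_
    filter_upwards [self_mem_nhdsWithin] with p' hp'
    rw [slope_def_module, hdiff, inv_smul_smul₀ (sub_ne_zero.mpr hp')]

end LinearODE

/-! ### Path ordered exponentials in a regularising coordinate -/

attribute [local instance] Matrix.linftyOpNormedRing Matrix.linftyOpNormedAlgebra

/-- The topology of the operator norm, which is the topology of entrywise convergence. Declared
so that the instance found for it unfolds to the norm. -/
abbrev matTopology : TopologicalSpace Mat2 := PseudoMetricSpace.toUniformSpace.toTopologicalSpace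

attribute [local instance] matTopology

/-- Reading off an entry, as a continuous linear map. -/
def entryCLM (i j : Fin 2) : Mat2 →L[ℝ] ℝ :=
  LinearMap.toContinuousLinearMap (Matrix.entryLinearMap ℝ ℝ i j)

lemma sum_smul_single (M : Mat2) : (∑ i, ∑ j, M i j • Matrix.single i j (1 : ℝ)) = M := by
  conv_rhs => rw [Matrix.matrix_eq_sum_single M]
  simp [Matrix.smul_single]

lemma continuous_mat2_iff {X : Type*} [TopologicalSpace X] {f : X → Mat2} :
    Continuous f ↔ ∀ i j, Continuous fun x => f x i j := by
  constructor
  · intro h i j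
    exact (entryCLM i j).continuous.comp h
  · intro h
    have h1 : Continuous fun x => ∑ i, ∑ j, f x i j • Matrix.single i j (1 : ℝ) :=
      continuous_finsetSum _ fun i _ => continuous_finsetSum _ fun j _ =>
        (h i j).smul continuous_const
    simpa only [sum_smul_single] using h1

lemma hasDerivAt_mat2_iff {f : ℝ → Mat2} {f' : Mat2} {x : ℝ} :
    HasDerivAt f f' x ↔ ∀ i j, HasDerivAt (fun x => f x i j) (f' i j) x := by
  constructor
  · intro h i j
    exact (entryCLM i j).hasFDerivAt.comp_hasDerivAt x h
  · intro h
    have h1 : HasDerivAt (fun x => ∑ i, ∑ j, f x i j • Matrix.single i j (1 : ℝ))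
        (∑ i, ∑ j, f' i j • Matrix.single i j (1 : ℝ)) x := by
      refine HasDerivAt.fun_sum fun i _ => HasDerivAt.fun_sum fun j _ => (h i j).smul_const _
    simpa only [sum_smul_single] using h1

lemma intervalIntegral_mat2_apply {f : ℝ → Mat2} {a b : ℝ}
    (hf : IntervalIntegrable f volume a b) (i j : Fin 2) :
    (∫ x in a..b, f x) i j = ∫ x in a..b, f x i j :=
  ((entryCLM i j).intervalIntegral_comp_comm hf).symm

/-- A solution of `S' = A S` with trace free `A` keeps its determinant. -/
lemma det_eq_one_of_ode {A S : ℝ → Mat2} (hA : ∀ r, (A r).trace = 0) (h0 : S 0 = 1)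
    (hS : ∀ r, HasDerivAt S (A r * S r) r) (r : ℝ) : (S r).det = 1 := by
  have hd : ∀ r, HasDerivAt (fun r => (S r).det) 0 r := by
    intro r
    have h := fun i j => (hasDerivAt_mat2_iff.mp (hS r)) i j
    simp only [Matrix.det_fin_two]
    refine (((h 0 0).mul (h 1 1)).sub ((h 0 1).mul (h 1 0))).congr_deriv ?_
    have ht := hA r
    rw [Matrix.trace_fin_two] at ht
    simp only [Matrix.mul_apply, Fin.sum_univ_two]
    linear_combination (S r 0 0 * S r 1 1 - S r 0 1 * S r 1 0) * ht
  have hc := is_const_of_deriv_eq_zero (fun x => (hd x).differentiableAt)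
    (fun x => (hd x).deriv) r 0
  simpa [h0] using hc

lemma hasDerivAt_adjugate_of_ode {A S : ℝ → Mat2} (hA : ∀ r, (A r).trace = 0)
    (hS : ∀ r, HasDerivAt S (A r * S r) r) (r : ℝ) :
    HasDerivAt (fun r => (S r).adjugate) (-((S r).adjugate * A r)) r := by
  have h := fun i j => (hasDerivAt_mat2_iff.mp (hS r)) i j
  have ht := hA r
  rw [Matrix.trace_fin_two] at ht
  rw [hasDerivAt_mat2_iff]
  intro i j
  simp only [Matrix.adjugate_fin_two]
  fin_cases i <;> fin_cases j <;>
    simp only [Fin.zero_eta, Fin.mk_one, Fin.isValue, Matrix.of_apply, Matrix.cons_val',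
      Matrix.cons_val_zero, Matrix.cons_val_one, Matrix.cons_val_fin_one, Matrix.neg_apply,
      Matrix.mul_apply, Fin.sum_univ_two]
  · refine (h 1 1).congr_deriv ?_
    simp only [Matrix.mul_apply, Fin.sum_univ_two]
    linear_combination (S r 1 1) * ht
  · refine (h 0 1).neg.congr_deriv ?_
    simp only [Matrix.mul_apply, Fin.sum_univ_two]
    linear_combination (-S r 0 1) * ht
  · refine (h 1 0).neg.congr_deriv ?_
    simp only [Matrix.mul_apply, Fin.sum_univ_two]
    linear_combination (-S r 1 0) * ht
  · refine (h 0 0).congr_deriv ?_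
    simp only [Matrix.mul_apply, Fin.sum_univ_two]
    linear_combination (S r 0 0) * ht

lemma continuous_adjugate {X : Type*} [TopologicalSpace X] {f : X → Mat2} (hf : Continuous f) :
    Continuous fun x => (f x).adjugate := by
  rw [continuous_mat2_iff] at hf ⊢
  intro i j
  simp only [Matrix.adjugate_fin_two]
  fin_cases i <;> fin_cases j
  · exact hf 1 1
  · exact (hf 0 1).neg
  · exact (hf 1 0).neg
  · exact hf 0 0

lemma adjugate_mul_of_det {M : Mat2} (h : M.det = 1) : M.adjugate * M = 1 := by
  rw [Matrix.adjugate_mul, h, one_smul]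

lemma mul_adjugate_of_det {M : Mat2} (h : M.det = 1) : M * M.adjugate = 1 := by
  rw [Matrix.mul_adjugate, h, one_smul]

lemma inv_eq_adjugate_of_det {M : Mat2} (h : M.det = 1) : M⁻¹ = M.adjugate :=
  Matrix.inv_eq_right_inv (mul_adjugate_of_det h)

/-- The substitution `z = l - r²` turns the terms of the path ordered exponential into the terms
of a Dyson series. The coefficient `B` of the latter is `2 r A(l - r²)`, in which the factor `2 r`
cancels an inverse square root singularity of `A` at `l`. -/
lemma pathOrderedTerm_eq_dysonTerm {A B : ℝ → Mat2} {l r₀ r₁ : ℝ} (hB : Continuous B)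
    (h₀ : 0 ≤ r₀) (hAB : ∀ r, 0 < r → r < r₁ → (2 * r) • A (l - r ^ 2) = B r) (h₀₁ : r₀ ≤ r₁)
    (n : ℕ) : ∀ r, 0 ≤ r → r ≤ r₁ → pathOrderedTerm A n (l - r ^ 2) (l - r₀ ^ 2) =
      dysonTerm (fun (_ : Unit) s => B (s + r₀)) n () (r - r₀) := by
  have hBc : Continuous fun p : Unit × ℝ => B (p.2 + r₀) := by fun_prop
  induction n with
  | zero => intro r _ _; rfl
  | succ n ih =>
    intro r hr hr₁
    have hDc : Continuous fun s : ℝ => dysonTerm (fun (_ : Unit) s => B (s + r₀)) n () s :=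
      (continuous_dysonTerm (A := fun (_ : Unit) s => B (s + r₀)) hBc n).comp
        (Continuous.prodMk_right ())
    have hc : Continuous fun s => B (s + r₀) *
        dysonTerm (fun (_ : Unit) s => B (s + r₀)) n () s := by fun_prop
    ext i j
    have hsub := intervalIntegral.integral_comp_mul_deriv_of_deriv_nonpos
      (f := fun s : ℝ => l - s ^ 2) (f' := fun s => -(2 * s)) (a := r) (b := r₀)
      (g := fun z => (A z * pathOrderedTerm A n z (l - r₀ ^ 2)) i j) (by fun_prop)
      (fun s _ => by simpa using ((hasDerivAt_pow 2 s).const_sub l))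
      (fun s hs => by
        have : 0 < s := lt_of_le_of_lt (le_min hr h₀) hs.1
        linarith)
    have hL : pathOrderedTerm A (n + 1) (l - r ^ 2) (l - r₀ ^ 2) i j =
        ∫ z in (l - r ^ 2)..(l - r₀ ^ 2), (A z * pathOrderedTerm A n z (l - r₀ ^ 2)) i j := rfl
    have hR : dysonTerm (fun (_ : Unit) s => B (s + r₀)) (n + 1) () (r - r₀) =
        ∫ s in (0 : ℝ)..(r - r₀), B (s + r₀) *
          dysonTerm (fun (_ : Unit) s => B (s + r₀)) n () s := rfl
    rw [hL, ← hsub, hR, intervalIntegral_mat2_apply (hc.intervalIntegrable _ _),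
      intervalIntegral.integral_symm, ← intervalIntegral.integral_neg]
    have hshift := intervalIntegral.integral_comp_sub_right (a := r₀) (b := r)
      (f := fun s => (B (s + r₀) * dysonTerm (fun (_ : Unit) s => B (s + r₀)) n () s) i j) r₀
    rw [sub_self] at hshift
    rw [← hshift]
    refine intervalIntegral.integral_congr_ae ?_
    have hne : ∀ᵐ s : ℝ, s ≠ r₁ := by simp [ae_iff]
    filter_upwards [hne] with s hs₁ hs
    have hs0 : 0 < s := lt_of_le_of_lt (le_min h₀ hr) hs.1
    have hs1 : s ≤ r₁ := hs.2.trans (max_le h₀₁ hr₁)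
    have h1 := ih s hs0.le hs1
    simp only [Function.comp_apply]
    rw [h1, sub_add_cancel, ← hAB s hs0 (lt_of_le_of_ne hs1 hs₁), smul_mul_assoc, Matrix.smul_apply,
      smul_eq_mul]
    ring

/-- A path ordered exponential with an inverse square root singularity at `l`, in terms of the
solution of the regularised equation. -/
theorem pathOrderedExp_eq {A B S : ℝ → Mat2} {l r₀ r₁ r : ℝ} (hB : Continuous B)
    (htr : ∀ r, (B r).trace = 0) (h₀ : 0 ≤ r₀) (h₀₁ : r₀ ≤ r₁) (hr : 0 ≤ r) (hr₁ : r ≤ r₁)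
    (hAB : ∀ r, 0 < r → r < r₁ → (2 * r) • A (l - r ^ 2) = B r)
    (hS0 : S 0 = 1) (hS : ∀ r, HasDerivAt S (B r * S r) r) :
    pathOrderedExp A (l - r ^ 2) (l - r₀ ^ 2) = S r * (S r₀).adjugate := by
  have hBc : Continuous fun p : Unit × ℝ => B (p.2 + r₀) := by fun_prop
  have hdet := det_eq_one_of_ode htr hS0 hS
  have h1 : pathOrderedExp A (l - r ^ 2) (l - r₀ ^ 2) =
      dysonSum (fun (_ : Unit) s => B (s + r₀)) () (r - r₀) := by
    unfold pathOrderedExp dysonSum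
    exact tsum_congr fun n => pathOrderedTerm_eq_dysonTerm hB h₀ hAB h₀₁ n r hr hr₁
  have hD : ∀ s, HasDerivAt (fun s => dysonSum (fun (_ : Unit) s => B (s + r₀)) () (s - r₀))
      (B s * dysonSum (fun (_ : Unit) s => B (s + r₀)) () (s - r₀)) s := by
    intro s
    have h := (hasDerivAt_dysonSum (A := fun (_ : Unit) s => B (s + r₀)) hBc () (s - r₀))
    have h2 := HasDerivAt.scomp s h ((hasDerivAt_id s).sub_const r₀)
    rw [one_smul, sub_add_cancel] at h2
    exact h2
  -- both sides solve the same equation, so that `S⁻¹` times the left side is constant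
  have hconst : ∀ s, HasDerivAt (fun s => (S s).adjugate *
      dysonSum (fun (_ : Unit) s => B (s + r₀)) () (s - r₀)) 0 s := by
    intro s
    refine ((hasDerivAt_adjugate_of_ode htr hS s).mul (hD s)).congr_deriv ?_
    noncomm_ring
  have h2 := is_const_of_deriv_eq_zero (fun x => (hconst x).differentiableAt)
    (fun x => (hconst x).deriv) r r₀
  simp only [sub_self, dysonSum_zero, mul_one] at h2
  rw [h1, ← h2, ← mul_assoc, mul_adjugate_of_det (hdet r), one_mul]

/-- Global linear equations for unimodular matrices, depending on a continuous parameter `y` and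
a differentiable parameter `p`. -/
theorem exists_param_ode {Y : Type*} [TopologicalSpace Y] {A A' : Y → ℝ → ℝ → Mat2}
    (hA : Continuous fun x : Y × ℝ × ℝ => A x.1 x.2.1 x.2.2)
    (hA' : Continuous fun x : Y × ℝ × ℝ => A' x.1 x.2.1 x.2.2)
    (hAp : ∀ y p r, HasDerivAt (fun p => A y p r) (A' y p r) p)
    (htr : ∀ y p r, (A y p r).trace = 0) :
    ∃ S S' : Y → ℝ → ℝ → Mat2, (Continuous fun x : Y × ℝ × ℝ => S x.1 x.2.1 x.2.2) ∧
      (Continuous fun x : Y × ℝ × ℝ => S' x.1 x.2.1 x.2.2) ∧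
      (∀ y p, S y p 0 = 1) ∧ (∀ y p r, (S y p r).det = 1) ∧
      (∀ y p r, HasDerivAt (S y p) (A y p r * S y p r) r) ∧
      (∀ y p r, HasDerivAt (fun p => S y p r) (S' y p r) p) ∧
      ∀ y p r, S' y p r =
        S y p r * ∫ s in (0 : ℝ)..r, (S y p s).adjugate * A' y p s * S y p s := by
  have hm : Continuous fun q : (Y × ℝ) × ℝ => ((q.1.1, q.1.2, q.2) : Y × ℝ × ℝ) := by fun_prop
  have hm' : Continuous fun q : Y × ℝ × ℝ => (((q.1, q.2.1), q.2.2) : (Y × ℝ) × ℝ) := by fun_prop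
  set A₀ : Y × ℝ → ℝ → Mat2 := fun q r => A q.1 q.2 r with hA₀
  have hA₀c : Continuous fun q : (Y × ℝ) × ℝ => A₀ q.1 q.2 := hA.comp hm
  have hSr : ∀ y p r, HasDerivAt (dysonSum A₀ (y, p)) (A y p r * dysonSum A₀ (y, p) r) r :=
    fun y p r => hasDerivAt_dysonSum hA₀c (y, p) r
  have hdet : ∀ y p r, (dysonSum A₀ (y, p) r).det = 1 := fun y p =>
    det_eq_one_of_ode (htr y p) (dysonSum_zero A₀ (y, p)) (hSr y p)
  have hSc : Continuous fun x : Y × ℝ × ℝ => dysonSum A₀ (x.1, x.2.1) x.2.2 :=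
    (continuous_dysonSum hA₀c).comp hm'
  have hTc : Continuous fun x : Y × ℝ × ℝ => (dysonSum A₀ (x.1, x.2.1) x.2.2).adjugate :=
    continuous_adjugate hSc
  obtain ⟨h1, h2⟩ := hasDerivAt_param_linearODE
    (S := fun y p r => dysonSum A₀ (y, p) r) (T := fun y p r => (dysonSum A₀ (y, p) r).adjugate)
    hA' hAp hSc hTc
    (fun y p => dysonSum_zero A₀ (y, p)) (fun y p r => adjugate_mul_of_det (hdet y p r))
    (fun y p r => mul_adjugate_of_det (hdet y p r)) hSr
    (fun y p r => hasDerivAt_adjugate_of_ode (htr y p) (hSr y p) r)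
  exact ⟨_, _, hSc, h1, fun y p => dysonSum_zero A₀ (y, p), hdet, hSr, h2, fun _ _ _ => rfl⟩

/-! ### Calculus with partial derivatives -/

section Calculus

variable {E : Type*} [NormedAddCommGroup E] [NormedSpace ℝ E]

/-- Differentiation under the integral sign over a compact interval. -/
lemma hasDerivAt_integral_param [CompleteSpace E] {f f' : ℝ → ℝ → E}
    (hf : Continuous fun x : ℝ × ℝ => f x.1 x.2) (hf' : Continuous fun x : ℝ × ℝ => f' x.1 x.2)
    (h : ∀ x r, HasDerivAt (fun x => f x r) (f' x r) x) (a b x₀ : ℝ) :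
    HasDerivAt (fun x => ∫ r in a..b, f x r) (∫ r in a..b, f' x₀ r) x₀ := by
  obtain ⟨C, hC⟩ := ((isCompact_closedBall x₀ 1).prod (isCompact_uIcc (a := a) (b := b))
    ).exists_bound_of_continuousOn hf'.continuousOn
  have h1 : ∀ x, Continuous (f x) := fun x => hf.comp (Continuous.prodMk_right x)
  have h2 : ∀ x, Continuous (f' x) := fun x => hf'.comp (Continuous.prodMk_right x)
  refine (intervalIntegral.hasDerivAt_integral_of_dominated_loc_of_deriv_le (F := f) (F' := f')
    (bound := fun _ => C) (Metric.ball_mem_nhds x₀ one_pos)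
    (Eventually.of_forall fun x => (h1 x).aestronglyMeasurable)
    ((h1 x₀).intervalIntegrable _ _) (h2 x₀).aestronglyMeasurable ?_ (by simp)
    (ae_of_all _ fun r _ x _ => h x r)).2
  exact ae_of_all _ fun r hr x hx =>
    hC (x, r) ⟨Metric.ball_subset_closedBall hx, uIoc_subset_uIcc hr⟩

/-- The chain rule along a curve for a function with continuous partial derivatives. -/
lemma hasDerivAt_comp_partial {f fx fy : ℝ → ℝ → E}
    (hx : Continuous fun q : ℝ × ℝ => fx q.1 q.2) (hy : Continuous fun q : ℝ × ℝ => fy q.1 q.2)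
    (hfx : ∀ x y, HasDerivAt (fun x => f x y) (fx x y) x)
    (hfy : ∀ x y, HasDerivAt (f x) (fy x y) y) {u v : ℝ → ℝ} {u' v' t : ℝ}
    (hu : HasDerivAt u u' t) (hv : HasDerivAt v v' t) :
    HasDerivAt (fun t => f (u t) (v t)) (u' • fx (u t) (v t) + v' • fy (u t) (v t)) t := by
  have hcx : Continuous fun q : ℝ × ℝ => ContinuousLinearMap.toSpanSingleton ℝ (fx q.1 q.2) :=
    (ContinuousLinearMap.toSpanSingletonCLE (𝕜 := ℝ) (E := E)).continuous.comp hx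
  have hcy : Continuous fun q : ℝ × ℝ => ContinuousLinearMap.toSpanSingleton ℝ (fy q.1 q.2) :=
    (ContinuousLinearMap.toSpanSingletonCLE (𝕜 := ℝ) (E := E)).continuous.comp hy
  have h := (hasStrictFDerivAt_uncurry_coprod (𝕜 := ℝ) (f := f) (u := (u t, v t))
    (f₁ := fun x y => ContinuousLinearMap.toSpanSingleton ℝ (fx x y))
    (f₂ := fun x y => ContinuousLinearMap.toSpanSingleton ℝ (fy x y))
    (Eventually.of_forall fun q => (hfx q.1 q.2).hasFDerivAt)
    (Eventually.of_forall fun q => (hfy q.1 q.2).hasFDerivAt)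
    hcx.continuousAt hcy.continuousAt).hasFDerivAt
  have h2 := h.comp_hasDerivAt t (hu.prodMk hv)
  refine HasDerivAt.congr_deriv (f := fun t => f (u t) (v t)) h2 ?_
  simp [Function.HasUncurry.uncurry]

/-- A continuously differentiable function on a compact interval extends to the line. -/
lemma exists_C1_extension [CompleteSpace E] {a b : ℝ} (hab : a ≤ b) {f f' : ℝ → E}
    (hf' : ContinuousOn f' (Icc a b)) (h : ∀ x ∈ Icc a b, HasDerivWithinAt f (f' x) (Icc a b) x) :
    ∃ g g' : ℝ → E, Continuous g' ∧ (∀ x, HasDerivAt g (g' x) x) ∧ EqOn g f (Icc a b) ∧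
      EqOn g' f' (Icc a b) := by
  have hc : Continuous (IccExtend hab ((Icc a b).domRestrict f')) :=
    continuous_IccExtend_iff.mpr hf'.domRestrict
  refine ⟨fun x => f a + ∫ y in a..x, IccExtend hab ((Icc a b).domRestrict f') y,
    IccExtend hab ((Icc a b).domRestrict f'), hc, ?_, ?_, ?_⟩
  · intro x
    exact (intervalIntegral.integral_hasDerivAt_right (hc.intervalIntegrable _ _)
      (hc.stronglyMeasurableAtFilter _ _) hc.continuousAt).const_add _
  · intro x hx
    have hEq : EqOn (IccExtend hab ((Icc a b).domRestrict f')) f' (Icc a b) := fun y hy => by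
      rw [IccExtend_of_mem hab _ hy]; rfl
    have hfc : ContinuousOn f (Icc a x) := fun y hy =>
      ((h y ⟨hy.1, hy.2.trans hx.2⟩).continuousWithinAt).mono (Icc_subset_Icc_right hx.2)
    have := intervalIntegral.integral_eq_sub_of_hasDerivAt_of_le hx.1 hfc
      (f' := IccExtend hab ((Icc a b).domRestrict f')) (fun y hy => by
        have hy' : y ∈ Icc a b := ⟨hy.1.le, hy.2.le.trans hx.2⟩
        rw [hEq hy']
        exact (h y hy').hasDerivAt (Icc_mem_nhds hy.1 (hy.2.trans_le hx.2)))
      (hc.intervalIntegrable _ _)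
    simp only [this, add_sub_cancel]
  · intro y hy
    rw [IccExtend_of_mem hab _ hy]; rfl

end Calculus

/-! ### Principal values -/

lemma tsupport_bound_integrable {g : ℝ × ℝ → ℝ} (hg : Continuous g) {a b : ℝ}
    (hsupp : ∀ p, p ∉ Icc a b ×ˢ Icc a b → g p = 0) : Integrable g := by
  refine hg.integrable_of_hasCompactSupport ?_
  exact HasCompactSupport.intro (isCompact_Icc.prod isCompact_Icc) hsupp

/-- The principal value of a function whose antisymmetric part vanishes to first order on the
diagonal: the symmetric part does not contribute. -/
theorem hasPV_of_antisymm {g : ℝ × ℝ → ℝ} (hg : Continuous g) {a b L : ℝ}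
    (hsupp : ∀ p, p ∉ Icc a b ×ˢ Icc a b → g p = 0)
    (hL : ∀ p, |g p - g p.swap| ≤ L * |p.1 - p.2|) :
    HasPV g (1 / 2 * ∫ p in Icc a b ×ˢ Icc a b, (g p - g p.swap) / (p.1 - p.2)) := by
  have hgi := tsupport_bound_integrable hg hsupp
  have hmS : ∀ ε : ℝ, MeasurableSet {p : ℝ × ℝ | ε < |p.1 - p.2|} := fun ε =>
    (isOpen_lt continuous_const (by fun_prop)).measurableSet
  have hint : ∀ ε > 0, IntegrableOn (fun p : ℝ × ℝ => g p / (p.1 - p.2))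
      {p | ε < |p.1 - p.2|} := by
    intro ε hε
    refine Integrable.mono' (hgi.norm.const_mul ε⁻¹).integrableOn ?_ ?_
    · exact (hg.measurable.div (by fun_prop)).aestronglyMeasurable
    · filter_upwards [ae_restrict_mem (hmS ε)] with p hp
      rw [norm_div, div_eq_inv_mul]
      gcongr
      exact le_of_lt hp
  refine ⟨hint, ?_⟩
  have hswap : ∀ ε > 0, ∫ p in {p : ℝ × ℝ | ε < |p.1 - p.2|}, g p / (p.1 - p.2) =
      1 / 2 * ∫ p in Icc a b ×ˢ Icc a b, {p : ℝ × ℝ | ε < |p.1 - p.2|}.indicator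
        (fun p => (g p - g p.swap) / (p.1 - p.2)) p := by
    intro ε hε
    have h1 : Integrable ({p : ℝ × ℝ | ε < |p.1 - p.2|}.indicator
        (fun p => g p / (p.1 - p.2))) := (hint ε hε).integrable_indicator (hmS ε)
    have h2 := integral_prod_swap (μ := (volume : Measure ℝ)) (ν := (volume : Measure ℝ))
      ({p : ℝ × ℝ | ε < |p.1 - p.2|}.indicator (fun p => g p / (p.1 - p.2)))
    have h3 : Integrable (fun p : ℝ × ℝ => {p : ℝ × ℝ | ε < |p.1 - p.2|}.indicator
        (fun p => g p / (p.1 - p.2)) p.swap) := h1.swap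
    rw [setIntegral_eq_integral_of_forall_compl_eq_zero (s := Icc a b ×ˢ Icc a b)]
    · rw [← integral_indicator (hmS ε)]
      have h4 : ∀ p : ℝ × ℝ, {p : ℝ × ℝ | ε < |p.1 - p.2|}.indicator
          (fun p => (g p - g p.swap) / (p.1 - p.2)) p =
          {p : ℝ × ℝ | ε < |p.1 - p.2|}.indicator (fun p => g p / (p.1 - p.2)) p +
          {p : ℝ × ℝ | ε < |p.1 - p.2|}.indicator (fun p => g p / (p.1 - p.2)) p.swap := by
        intro p
        by_cases hp : ε < |p.1 - p.2|
        · have hp' : ε < |p.2 - p.1| := by rwa [abs_sub_comm]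
          rw [indicator_of_mem (by exact hp), indicator_of_mem (by exact hp),
            indicator_of_mem (by exact hp')]
          simp only [Prod.fst_swap, Prod.snd_swap]
          rw [← neg_sub p.1 p.2, div_neg]
          ring
        · have hp' : ¬ ε < |p.2 - p.1| := by rwa [abs_sub_comm]
          rw [indicator_of_notMem (by exact hp), indicator_of_notMem (by exact hp),
            indicator_of_notMem (by exact hp')]
          simp
      simp only [h4]
      have h5 : ∫ p : ℝ × ℝ, {p : ℝ × ℝ | ε < |p.1 - p.2|}.indicator
          (fun p => g p / (p.1 - p.2)) p.swap = ∫ p : ℝ × ℝ, {p : ℝ × ℝ | ε < |p.1 - p.2|}.indicator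
          (fun p => g p / (p.1 - p.2)) p := h2
      rw [integral_add h1 h3, h5]
      ring
    · intro p hp
      have hp' : p.swap ∉ Icc a b ×ˢ Icc a b := by
        intro h; exact hp ⟨h.2, h.1⟩
      by_cases hpm : p ∈ {p : ℝ × ℝ | ε < |p.1 - p.2|}
      · rw [indicator_of_mem hpm, hsupp p hp, hsupp _ hp']; simp
      · rw [indicator_of_notMem hpm]
  have hlim : Tendsto (fun ε : ℝ => 1 / 2 * ∫ p in Icc a b ×ˢ Icc a b,
      {p : ℝ × ℝ | ε < |p.1 - p.2|}.indicator (fun p => (g p - g p.swap) / (p.1 - p.2)) p)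
      (𝓝[>] 0) (𝓝 (1 / 2 * ∫ p in Icc a b ×ˢ Icc a b, (g p - g p.swap) / (p.1 - p.2))) := by
    refine Tendsto.const_mul _ (tendsto_integral_filter_of_dominated_convergence (fun _ => L)
      ?_ ?_ ?_ ?_)
    · refine Eventually.of_forall fun ε => AEStronglyMeasurable.indicator ?_ (hmS ε)
      exact (Measurable.div (by fun_prop) (by fun_prop)).aestronglyMeasurable
    · refine Eventually.of_forall fun ε => ae_of_all _ fun p => ?_
      refine (norm_indicator_le_norm_self _ _).trans ?_
      rw [Real.norm_eq_abs, abs_div]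
      rcases eq_or_ne p.1 p.2 with h | h
      · have := hL (p.1 + 1, p.1)
        have hL0 : 0 ≤ L := by simpa using (abs_nonneg _).trans this
        rw [h, sub_self, abs_zero, div_zero]
        exact hL0
      · rw [div_le_iff₀ (abs_pos.mpr (sub_ne_zero.mpr h))]
        exact hL p
    · exact integrableOn_const (isCompact_Icc.prod isCompact_Icc).measure_lt_top.ne
    · refine ae_of_all _ fun p => ?_
      rcases eq_or_ne p.1 p.2 with h | h
      · refine tendsto_const_nhds.congr' (Eventually.of_forall fun ε => ?_)
        beta_reduce
        by_cases hpm : p ∈ {p : ℝ × ℝ | ε < |p.1 - p.2|}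
        · rw [indicator_of_mem hpm]
        · rw [indicator_of_notMem hpm, h]; simp
      · refine tendsto_const_nhds.congr' ?_
        have h0 : (0 : ℝ) < |p.1 - p.2| := abs_pos.mpr (sub_ne_zero.mpr h)
        filter_upwards [Ioo_mem_nhdsGT h0] with ε hε
        rw [indicator_of_mem (by exact hε.2)]
  refine hlim.congr' ?_
  filter_upwards [self_mem_nhdsWithin] with ε hε
  exact (hswap ε hε).symm

/-! ### Abel transforms with a cutoff -/

/-- The Abel transform `∫ F(l, √(l - z)) (l - z)^{-1/2} dl` over `z + σ² ≤ l ≤ z + M²`, written in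
the coordinate `r = √(l - z)`. -/
def abelCut (F : ℝ → ℝ → ℂ) (σ M z : ℝ) : ℂ := 2 * ∫ r in σ..M, F (z + r ^ 2) r

/-- A function of the deformation parameter `l` and of `r = √(l - z)`, with continuous partial
derivatives, supported in `a ≤ l ≤ b`. -/
structure IsProfile (a b : ℝ) (F Fl Fr : ℝ → ℝ → ℂ) : Prop where
  continuous : Continuous fun x : ℝ × ℝ => F x.1 x.2
  continuous_l : Continuous fun x : ℝ × ℝ => Fl x.1 x.2
  continuous_r : Continuous fun x : ℝ × ℝ => Fr x.1 x.2
  hasDerivAt_l : ∀ l r, HasDerivAt (fun l => F l r) (Fl l r) l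
  hasDerivAt_r : ∀ l r, HasDerivAt (F l) (Fr l r) r
  eq_zero : ∀ l ∉ Icc a b, ∀ r, F l r = 0

namespace IsProfile

variable {a b : ℝ} {F Fl Fr : ℝ → ℝ → ℂ}

lemma r_eq_zero (h : IsProfile a b F Fl Fr) {l : ℝ} (hl : l ∉ Icc a b) (r : ℝ) : Fr l r = 0 := by
  have h1 : F l = fun _ => 0 := funext fun r => h.eq_zero l hl r
  have h2 := h.hasDerivAt_r l r
  rw [h1] at h2
  exact h2.unique (hasDerivAt_const r 0)

lemma eq_zero_of_ge (h : IsProfile a b F Fl Fr) {l : ℝ} (hl : b ≤ l) (r : ℝ) : F l r = 0 := by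
  have h1 : Continuous fun l => F l r := h.continuous.comp (Continuous.prodMk_left r)
  have h2 : Tendsto (fun l => F l r) (𝓝[>] b) (𝓝 (F b r)) :=
    h1.continuousAt.tendsto.mono_left nhdsWithin_le_nhds
  rcases hl.eq_or_lt with rfl | hlt
  · refine tendsto_nhds_unique h2 (tendsto_const_nhds.congr' ?_)
    filter_upwards [self_mem_nhdsWithin] with x hx
    exact (h.eq_zero x (fun hx' => absurd hx'.2 (not_le.mpr hx)) r).symm
  · exact h.eq_zero l (fun hx' => absurd hx'.2 (not_le.mpr hlt)) r

lemma continuous_integrand (h : IsProfile a b F Fl Fr) :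
    Continuous fun x : ℝ × ℝ => F (x.1 + x.2 ^ 2) x.2 :=
  h.continuous.comp (by fun_prop : Continuous fun x : ℝ × ℝ => (x.1 + x.2 ^ 2, x.2))

lemma continuous_integrand_l (h : IsProfile a b F Fl Fr) :
    Continuous fun x : ℝ × ℝ => Fl (x.1 + x.2 ^ 2) x.2 :=
  h.continuous_l.comp (by fun_prop : Continuous fun x : ℝ × ℝ => (x.1 + x.2 ^ 2, x.2))

lemma hasDerivAt_abelCut (h : IsProfile a b F Fl Fr) (σ M z : ℝ) :
    HasDerivAt (abelCut F σ M) (abelCut Fl σ M z) z := by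
  refine HasDerivAt.const_mul 2 (hasDerivAt_integral_param
    (f := fun z r => F (z + r ^ 2) r) (f' := fun z r => Fl (z + r ^ 2) r) h.continuous_integrand
    h.continuous_integrand_l (fun z r => ?_) σ M z)
  have := HasDerivAt.scomp z (h.hasDerivAt_l (z + r ^ 2) r) ((hasDerivAt_id z).add_const (r ^ 2))
  simpa [Function.comp_def] using this

lemma abelCut_eq_zero (h : IsProfile a b F Fl Fr) {σ M z : ℝ} (hz : b ≤ z) :
    abelCut F σ M z = 0 := by
  have : ∀ r, F (z + r ^ 2) r = 0 := fun r => h.eq_zero_of_ge (by nlinarith [sq_nonneg r]) r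
  simp [abelCut, this]

/-- Integration by parts along `l = z + r²`. It moves the derivative with respect to `l` at fixed
`r` to the derivative with respect to `z` at fixed `l`, at the price of a boundary term. -/
lemma abelCut_l_eq (h : IsProfile a b F Fl Fr) {σ M z : ℝ} (hσ : 0 < σ) (hσM : σ ≤ M)
    (hM : b ≤ z + M ^ 2) :
    abelCut Fl σ M z = -(F (z + σ ^ 2) σ / σ) + ∫ r in σ..M,
      (F (z + r ^ 2) r / (max σ r) ^ 2 - Fr (z + r ^ 2) r / (max σ r : ℝ)) := by
  have hpos : ∀ r ∈ uIcc σ M, 0 < r ∧ max σ r = r := by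
    intro r hr
    rw [uIcc_of_le hσM] at hr
    exact ⟨hσ.trans_le hr.1, max_eq_right hr.1⟩
  have hm : ∀ r : ℝ, 0 < max σ r := fun r => lt_max_of_lt_left hσ
  have hm' : ∀ r : ℝ, ((max σ r : ℝ) : ℂ) ≠ 0 := fun r => Complex.ofReal_ne_zero.mpr (hm r).ne'
  have hcm : Continuous fun r : ℝ => ((max σ r : ℝ) : ℂ) := by fun_prop
  have c1 : Continuous fun r : ℝ => F (z + r ^ 2) r :=
    h.continuous_integrand.comp (Continuous.prodMk_right z)
  have c2 : Continuous fun r : ℝ => Fl (z + r ^ 2) r :=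
    h.continuous_integrand_l.comp (Continuous.prodMk_right z)
  have c3 : Continuous fun r : ℝ => Fr (z + r ^ 2) r :=
    h.continuous_r.comp (by fun_prop : Continuous fun r : ℝ => (z + r ^ 2, r))
  have c4 : Continuous fun r : ℝ => F (z + r ^ 2) r / (max σ r : ℝ) ^ 2 -
      Fr (z + r ^ 2) r / (max σ r : ℝ) :=
    (c1.div (hcm.pow 2) fun r => pow_ne_zero 2 (hm' r)).sub (c3.div hcm hm')
  have hd : ∀ r ∈ uIcc σ M, HasDerivAt (fun r : ℝ => F (z + r ^ 2) r / (r : ℂ))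
      (2 * Fl (z + r ^ 2) r - (F (z + r ^ 2) r / (max σ r : ℝ) ^ 2 -
        Fr (z + r ^ 2) r / (max σ r : ℝ))) r := by
    intro r hr
    obtain ⟨hr0, hr1⟩ := hpos r hr
    have hr0' : (r : ℂ) ≠ 0 := Complex.ofReal_ne_zero.mpr hr0.ne'
    have hu : HasDerivAt (fun r : ℝ => z + r ^ 2) (2 * r) r := by
      simpa using (hasDerivAt_pow 2 r).const_add z
    have h1 := hasDerivAt_comp_partial h.continuous_l h.continuous_r h.hasDerivAt_l h.hasDerivAt_r
      hu (hasDerivAt_id r)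
    have h2 : HasDerivAt (fun r : ℝ => (r : ℂ)) 1 r := by
      simpa using (hasDerivAt_id r).ofReal_comp
    refine (h1.div h2 hr0').congr_deriv ?_
    rw [hr1]
    simp only [id, one_smul, Complex.real_smul, Complex.ofReal_mul, Complex.ofReal_ofNat]
    field_simp
    ring
  have hint := intervalIntegral.integral_eq_sub_of_hasDerivAt hd
    (((c2.const_mul 2).sub c4).intervalIntegrable _ _)
  rw [intervalIntegral.integral_sub ((c2.const_mul 2).intervalIntegrable _ _)
    (c4.intervalIntegrable _ _), intervalIntegral.integral_const_mul, h.eq_zero_of_ge hM] at hint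
  rw [abelCut]
  linear_combination hint

end IsProfile

/-- The radial coordinate `√(l - z)`, modified for `l < z + σ²` so as to be bounded below. -/
def cutRadius (σ z l : ℝ) : ℝ := max σ (Real.sqrt (l - z))

lemma cutRadius_pos {σ : ℝ} (hσ : 0 < σ) (z l : ℝ) : 0 < cutRadius σ z l := lt_max_of_lt_left hσ

lemma le_cutRadius (σ z l : ℝ) : σ ≤ cutRadius σ z l := le_max_left _ _

lemma cutRadius_of_le {σ z l : ℝ} (h : z + σ ^ 2 ≤ l) :
    cutRadius σ z l = Real.sqrt (l - z) :=
  max_eq_right (Real.le_sqrt_of_sq_le (by linarith))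

lemma continuous_cutRadius (σ : ℝ) : Continuous fun x : ℝ × ℝ => cutRadius σ x.1 x.2 := by
  unfold cutRadius; fun_prop

/-- The substitution `l = z + r²`. -/
lemma integral_radius_eq {f : ℝ → ℝ → ℂ} {a b σ M z : ℝ}
    (hf : Continuous fun x : ℝ × ℝ => f x.1 x.2) (hsupp : ∀ l ∉ Icc a b, ∀ r, f l r = 0)
    (hσ : 0 < σ) (hσM : σ ≤ M) (hM : b ≤ z + M ^ 2) :
    ∫ r in σ..M, f (z + r ^ 2) r = ∫ l in Icc a b, (Ici (z + σ ^ 2)).indicator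
      (fun l => f l (cutRadius σ z l) / (2 * (cutRadius σ z l : ℂ))) l := by
  set g : ℝ → ℂ := fun l => f l (cutRadius σ z l) / (2 * (cutRadius σ z l : ℂ)) with hg
  have hcr : Continuous fun l => cutRadius σ z l :=
    (continuous_cutRadius σ).comp (Continuous.prodMk_right z)
  have hgc : Continuous g := by
    refine (hf.comp (continuous_id.prodMk hcr)).div (by fun_prop) fun l => ?_
    exact mul_ne_zero two_ne_zero (Complex.ofReal_ne_zero.mpr (cutRadius_pos hσ z l).ne')
  have hsub := intervalIntegral.integral_deriv_smul_comp (f := fun r : ℝ => z + r ^ 2)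
    (f' := fun r => 2 * r) (a := σ) (b := M) (g := g)
    (fun r _ => by simpa using (hasDerivAt_pow 2 r).const_add z) (by fun_prop) hgc
  have h1 : ∫ r in σ..M, f (z + r ^ 2) r = ∫ r in σ..M, (2 * r) • (g ∘ fun r => z + r ^ 2) r := by
    refine intervalIntegral.integral_congr fun r hr => ?_
    rw [uIcc_of_le hσM] at hr
    have hr0 : 0 < r := hσ.trans_le hr.1
    have h2 : cutRadius σ z (z + r ^ 2) = r := by
      rw [cutRadius, add_sub_cancel_left, Real.sqrt_sq hr0.le, max_eq_right hr.1]
    have hr0' : (r : ℂ) ≠ 0 := Complex.ofReal_ne_zero.mpr hr0.ne'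
    simp only [Function.comp_apply, hg, h2, Complex.real_smul, Complex.ofReal_mul,
      Complex.ofReal_ofNat]
    field_simp
  have hle : z + σ ^ 2 ≤ z + M ^ 2 := by gcongr
  rw [h1, hsub, intervalIntegral.integral_of_le hle, ← integral_indicator measurableSet_Ioc,
    ← integral_indicator measurableSet_Icc]
  refine integral_congr_ae ?_
  have hne : ∀ᵐ l : ℝ, l ≠ z + σ ^ 2 := by simp [ae_iff]
  filter_upwards [hne] with l hl
  by_cases hab : l ∈ Icc a b
  · rw [indicator_of_mem hab]
    by_cases hl2 : z + σ ^ 2 ≤ l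
    · rw [indicator_of_mem (show l ∈ Ioc (z + σ ^ 2) (z + M ^ 2) from
        ⟨lt_of_le_of_ne hl2 (Ne.symm hl), hab.2.trans hM⟩),
        indicator_of_mem (show l ∈ Ici (z + σ ^ 2) from hl2)]
    · rw [indicator_of_notMem (show l ∉ Ioc (z + σ ^ 2) (z + M ^ 2) from fun h => hl2 h.1.le),
        indicator_of_notMem (show l ∉ Ici (z + σ ^ 2) from hl2)]
  · have hg0 : g l = 0 := by simp [hg, hsupp l hab]
    rw [indicator_of_notMem hab]
    by_cases hl2 : l ∈ Ioc (z + σ ^ 2) (z + M ^ 2)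
    · rw [indicator_of_mem hl2, hg0]
    · rw [indicator_of_notMem hl2]

/-! ### The radial system -/

/-- The components `η` (along `𝔥`) and `w` (along `𝔨`, as a complex number) of a covariantly
constant section of the adjoint bundle for the deformed connection, as functions of the
deformation parameter `l` and of `r = √(l - z)`. The section lies in `𝔨` at `r = 0`. The weight
`κ` is `√l` on the support. -/
structure IsRadialPair (a b : ℝ) (κ : ℝ → ℝ) (p : ℝ → ℂ) (η ηl : ℝ → ℝ → ℝ)
    (w wl : ℝ → ℝ → ℂ) : Prop where
  cont_eta : Continuous fun x : ℝ × ℝ => η x.1 x.2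
  cont_eta_l : Continuous fun x : ℝ × ℝ => ηl x.1 x.2
  cont_omega : Continuous fun x : ℝ × ℝ => w x.1 x.2
  cont_omega_l : Continuous fun x : ℝ × ℝ => wl x.1 x.2
  deriv_eta_l : ∀ l r, HasDerivAt (fun l => η l r) (ηl l r) l
  deriv_omega_l : ∀ l r, HasDerivAt (fun l => w l r) (wl l r) l
  deriv_eta_r : ∀ l r, HasDerivAt (η l) (4 * κ l * (conj (p (l - r ^ 2)) * w l r).im) r
  deriv_omega_r : ∀ l r,
    HasDerivAt (w l) (4 * κ l * Complex.I * p (l - r ^ 2) * η l r) r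
  eta_zero : ∀ l, η l 0 = 0
  eta_supp : ∀ l ∉ Icc a b, ∀ r, η l r = 0
  omega_supp : ∀ l ∉ Icc a b, ∀ r, w l r = 0

namespace IsRadialPair

variable {a b : ℝ} {κ : ℝ → ℝ} {p : ℝ → ℂ} {η ηl : ℝ → ℝ → ℝ} {w wl : ℝ → ℝ → ℂ}

/-- As `η` vanishes at `r = 0`, it is bounded by a multiple of `r`. Hence the `r`-derivative of
`w` is too, and `w` is Lipschitz in `r²`, that is, in the point `z = l - r²`. -/
lemma bounds (hκ : Continuous κ) (hp : Continuous p) (h : IsRadialPair a b κ p η ηl w wl)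
    (ρ : ℝ) (hρ : 0 ≤ ρ) : ∃ C, 0 ≤ C ∧
      (∀ l ∈ Icc a b, ∀ r ∈ Icc 0 ρ, ‖w l r‖ ≤ C) ∧
      (∀ l ∈ Icc a b, ∀ r ∈ Icc 0 ρ, |η l r| ≤ C * r) ∧
      (∀ l ∈ Icc a b, ∀ l' ∈ Icc a b, ∀ r ∈ Icc 0 ρ, ∀ r' ∈ Icc 0 ρ, r ≤ r' →
        |η l' r' - η l r| ≤ C * (|l' - l| + (r' - r))) ∧
      (∀ l ∈ Icc a b, ∀ l' ∈ Icc a b, ∀ r ∈ Icc 0 ρ, ∀ r' ∈ Icc 0 ρ, r ≤ r' →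
        ‖w l' r' - w l r‖ ≤ C * (|l' - l| + (r' ^ 2 - r ^ 2))) := by
  have hK : IsCompact (Icc a b ×ˢ Icc (0 : ℝ) ρ) := isCompact_Icc.prod isCompact_Icc
  have cκ : Continuous fun x : ℝ × ℝ => κ x.1 := hκ.comp continuous_fst
  have cp : Continuous fun x : ℝ × ℝ => p (x.1 - x.2 ^ 2) := hp.comp (by fun_prop)
  have cηr : Continuous fun x : ℝ × ℝ =>
      4 * κ x.1 * (conj (p (x.1 - x.2 ^ 2)) * w x.1 x.2).im :=
    (continuous_const.mul cκ).mul (Complex.continuous_im.comp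
      ((Complex.continuous_conj.comp cp).mul h.cont_omega))
  have cwr : Continuous fun x : ℝ × ℝ => 4 * (κ x.1 : ℂ) * Complex.I * p (x.1 - x.2 ^ 2) :=
    (((continuous_const.mul (Complex.continuous_ofReal.comp cκ)).mul continuous_const).mul cp)
  obtain ⟨C₁, hC₁⟩ := hK.exists_bound_of_continuousOn h.cont_omega.continuousOn
  obtain ⟨C₂, hC₂⟩ := hK.exists_bound_of_continuousOn cηr.continuousOn
  obtain ⟨C₃, hC₃⟩ := hK.exists_bound_of_continuousOn cwr.continuousOn
  obtain ⟨C₄, hC₄⟩ := hK.exists_bound_of_continuousOn h.cont_eta_l.continuousOn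
  obtain ⟨C₅, hC₅⟩ := hK.exists_bound_of_continuousOn h.cont_omega_l.continuousOn
  set C₂' := max C₂ 0
  set C₃' := max C₃ 0
  have hηr : ∀ l ∈ Icc a b, ∀ r ∈ Icc 0 ρ, ∀ r' ∈ Icc 0 ρ, r ≤ r' →
      |η l r' - η l r| ≤ C₂' * (r' - r) := by
    intro l hl r hr r' hr' hrr
    have := Convex.norm_image_sub_le_of_norm_hasDerivWithin_le (f := η l) (s := Icc 0 ρ) (C := C₂')
      (fun s _ => (h.deriv_eta_r l s).hasDerivWithinAt)
      (fun s hs => (hC₂ (l, s) ⟨hl, hs⟩).trans (le_max_left _ _)) (convex_Icc 0 ρ) hr hr'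
    rwa [Real.norm_eq_abs, Real.norm_eq_abs, abs_of_nonneg (sub_nonneg.mpr hrr)] at this
  have hη0 : ∀ l ∈ Icc a b, ∀ r ∈ Icc 0 ρ, |η l r| ≤ C₂' * r := by
    intro l hl r hr
    have := hηr l hl 0 ⟨le_rfl, hρ⟩ r hr hr.1
    rwa [h.eta_zero, sub_zero, sub_zero] at this
  have hwr : ∀ l ∈ Icc a b, ∀ r ∈ Icc 0 ρ, ∀ r' ∈ Icc 0 ρ, r ≤ r' →
      ‖w l r' - w l r‖ ≤ C₃' * C₂' * (r' ^ 2 - r ^ 2) := by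
    intro l hl r hr r' hr' hrr
    have hc : Continuous fun s : ℝ => 4 * (κ l : ℂ) * Complex.I * p (l - s ^ 2) * η l s :=
      (cwr.comp (Continuous.prodMk_right l)).mul
        (Complex.continuous_ofReal.comp (h.cont_eta.comp (Continuous.prodMk_right l)))
    rw [← intervalIntegral.integral_eq_sub_of_hasDerivAt (fun s _ => h.deriv_omega_r l s)
      (hc.intervalIntegrable _ _)]
    have h1 : ‖∫ s in r..r', 4 * (κ l : ℂ) * Complex.I * p (l - s ^ 2) * η l s‖ ≤
        ∫ s in r..r', C₃' * C₂' * (2 * s) := by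
      refine intervalIntegral.norm_integral_le_of_norm_le hrr (ae_of_all _ fun s hs => ?_)
        ((by fun_prop : Continuous fun s : ℝ => C₃' * C₂' * (2 * s)).intervalIntegrable _ _)
      have hs' : s ∈ Icc 0 ρ := ⟨hr.1.trans hs.1.le, hs.2.trans hr'.2⟩
      rw [norm_mul, Complex.norm_real]
      have h2 := (hC₃ (l, s) ⟨hl, hs'⟩).trans (le_max_left C₃ 0)
      have h3 : ‖η l s‖ ≤ C₂' * s := hη0 l hl s hs'
      have h4 : 0 ≤ C₃' := le_max_right _ _
      have h5 : 0 ≤ C₂' := le_max_right _ _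
      calc _ ≤ C₃' * (C₂' * s) := mul_le_mul h2 h3 (norm_nonneg _) h4
        _ ≤ _ := by nlinarith [mul_nonneg (mul_nonneg h4 h5) hs'.1]
    refine h1.trans_eq ?_
    rw [intervalIntegral.integral_const_mul, intervalIntegral.integral_const_mul, integral_id]
    ring
  have hηl : ∀ l ∈ Icc a b, ∀ l' ∈ Icc a b, ∀ r ∈ Icc 0 ρ, |η l' r - η l r| ≤ C₄ * |l' - l| :=
    fun l hl l' hl' r hr => Convex.norm_image_sub_le_of_norm_hasDerivWithin_le
      (f := fun l => η l r) (s := Icc a b) (C := C₄)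
      (fun s _ => (h.deriv_eta_l s r).hasDerivWithinAt) (fun s hs => hC₄ (s, r) ⟨hs, hr⟩)
      (convex_Icc a b) hl hl'
  have hwl : ∀ l ∈ Icc a b, ∀ l' ∈ Icc a b, ∀ r ∈ Icc 0 ρ, ‖w l' r - w l r‖ ≤ C₅ * |l' - l| :=
    fun l hl l' hl' r hr => Convex.norm_image_sub_le_of_norm_hasDerivWithin_le
      (f := fun l => w l r) (s := Icc a b) (C := C₅)
      (fun s _ => (h.deriv_omega_l s r).hasDerivWithinAt) (fun s hs => hC₅ (s, r) ⟨hs, hr⟩)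
      (convex_Icc a b) hl hl'
  have h4 : 0 ≤ C₃' := le_max_right _ _
  have h5 : 0 ≤ C₂' := le_max_right _ _
  have h6 : 0 ≤ C₃' * C₂' := mul_nonneg h4 h5
  set C := |C₁| + C₂' + C₃' * C₂' + |C₄| + |C₅| with hC
  have a1 := abs_nonneg C₁
  have a4 := abs_nonneg C₄
  have a5 := abs_nonneg C₅
  have hC0 : 0 ≤ C := by positivity
  refine ⟨C, hC0, ?_, ?_, ?_, ?_⟩
  · intro l hl r hr
    have := hC₁ (l, r) ⟨hl, hr⟩
    dsimp only at this
    linarith [le_abs_self C₁]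
  · intro l hl r hr
    refine (hη0 l hl r hr).trans (mul_le_mul_of_nonneg_right ?_ hr.1)
    linarith
  · intro l hl l' hl' r hr r' hr' hrr
    have e1 := hηl l hl l' hl' r hr
    have e2 := hηr l' hl' r hr r' hr' hrr
    have e3 : |η l' r' - η l r| ≤ |η l' r' - η l' r| + |η l' r - η l r| := by
      have := abs_add_le (η l' r' - η l' r) (η l' r - η l r)
      rwa [sub_add_sub_cancel] at this
    have e4 : C₄ * |l' - l| ≤ C * |l' - l| :=
      mul_le_mul_of_nonneg_right (by linarith [le_abs_self C₄]) (abs_nonneg _)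
    have e5 : C₂' * (r' - r) ≤ C * (r' - r) :=
      mul_le_mul_of_nonneg_right (by linarith) (by linarith)
    linarith
  · intro l hl l' hl' r hr r' hr' hrr
    have e1 := hwl l hl l' hl' r hr
    have e2 := hwr l' hl' r hr r' hr' hrr
    have e3 : ‖w l' r' - w l r‖ ≤ ‖w l' r' - w l' r‖ + ‖w l' r - w l r‖ := by
      have := norm_add_le (w l' r' - w l' r) (w l' r - w l r)
      rwa [sub_add_sub_cancel] at this
    have e4 : C₅ * |l' - l| ≤ C * |l' - l| :=
      mul_le_mul_of_nonneg_right (by linarith [le_abs_self C₅]) (abs_nonneg _)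
    have e5 : C₃' * C₂' * (r' ^ 2 - r ^ 2) ≤ C * (r' ^ 2 - r ^ 2) :=
      mul_le_mul_of_nonneg_right (by linarith) (by nlinarith [hr.1])
    linarith

end IsRadialPair

/-- The invariant form `tr(X₁ X₂)` of two sections, at the point `l - σ²` and for deformation
parameters `l ≤ l'`, with the `𝔨` part weighted by the quotient of the deformation factors
`(1 - z / l')^{-1/2}` and `(1 - z / l)^{-1/2}`. -/
def weightedForm (η₁ η₂ : ℝ → ℝ → ℝ) (w₁ w₂ : ℝ → ℝ → ℂ) (σ l l' : ℝ) : ℝ :=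
  -2 * η₁ l σ * η₂ l' (Real.sqrt (l' - l + σ ^ 2)) +
    Real.sqrt l' * σ / (Real.sqrt l * Real.sqrt (l' - l + σ ^ 2)) *
      (2 * (conj (w₁ l σ) * w₂ l' (Real.sqrt (l' - l + σ ^ 2))).re)

/-- The antisymmetric part of the weighted form vanishes to first order on the diagonal,
uniformly in the cutoff `σ`: exchanging the sections amounts to exchanging the points
`(l, σ)` and `(l', r)` of the components, where `r² - σ² = l' - l`. -/
lemma abs_weightedForm_sub_le {a b : ℝ} (ha : 0 < a) {κ : ℝ → ℝ} (hκ : Continuous κ) {p : ℝ → ℂ}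
    (hp : Continuous p) {η₁ ηl₁ η₂ ηl₂ : ℝ → ℝ → ℝ} {w₁ wl₁ w₂ wl₂ : ℝ → ℝ → ℂ}
    (h₁ : IsRadialPair a b κ p η₁ ηl₁ w₁ wl₁) (h₂ : IsRadialPair a b κ p η₂ ηl₂ w₂ wl₂) (ρ : ℝ) :
    ∃ L, ∀ l ∈ Icc a b, ∀ l' ∈ Icc a b, l ≤ l' → ∀ σ, 0 < σ → σ ≤ ρ →
      |weightedForm η₁ η₂ w₁ w₂ σ l l' - weightedForm η₂ η₁ w₂ w₁ σ l l'| ≤ L * (l' - l) := by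
  set ρ' := Real.sqrt (b - a + ρ ^ 2) with hρ'
  obtain ⟨C, hC, -, e0, e1, w1⟩ := h₁.bounds hκ hp (max ρ ρ')
    (le_max_of_le_right (Real.sqrt_nonneg _))
  obtain ⟨D, hD, -, f0, f1, v1⟩ := h₂.bounds hκ hp (max ρ ρ')
    (le_max_of_le_right (Real.sqrt_nonneg _))
  obtain ⟨C', hC', w0, -⟩ := h₁.bounds hκ hp (max ρ ρ') (le_max_of_le_right (Real.sqrt_nonneg _))
  obtain ⟨D', hD', v0, -⟩ := h₂.bounds hκ hp (max ρ ρ') (le_max_of_le_right (Real.sqrt_nonneg _))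
  set q := Real.sqrt b / Real.sqrt a with hq
  refine ⟨2 * (2 * (C * D) * (|ρ| + 1)) + q * (2 * (C' * (D * 2) + D' * (C * 2))), ?_⟩
  intro l hl l' hl' hll σ hσ hσρ
  set r := Real.sqrt (l' - l + σ ^ 2) with hr
  have hr2 : r ^ 2 = l' - l + σ ^ 2 := Real.sq_sqrt (by nlinarith)
  have hσr : σ ≤ r := Real.le_sqrt_of_sq_le (by linarith)
  have hr0 : 0 < r := hσ.trans_le hσr
  have hrρ : r ≤ ρ' := Real.sqrt_le_sqrt (by nlinarith [hl.1, hl'.2])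
  have mσ : σ ∈ Icc 0 (max ρ ρ') := ⟨hσ.le, hσρ.trans (le_max_left _ _)⟩
  have mr : r ∈ Icc 0 (max ρ ρ') := ⟨hr0.le, hrρ.trans (le_max_right _ _)⟩
  have hs : |l' - l| = l' - l := abs_of_nonneg (by linarith)
  have hs0 : 0 ≤ l' - l := by linarith
  -- In `η₁ η₂` the difference of the radii only enters multiplied by `σ`, since `|η₁ l σ| ≤ C σ`.
  have hdr : σ * (r - σ) ≤ l' - l := by nlinarith
  have hdr0 : 0 ≤ r - σ := by linarith
  have hσρ' : σ ≤ |ρ| := hσρ.trans (le_abs_self ρ)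
  have k1 := e0 l hl σ mσ
  have k2 := f0 l hl σ mσ
  have k3 := e1 l hl l' hl' σ mσ r mr hσr
  have k4 := f1 l hl l' hl' σ mσ r mr hσr
  have k5 := w0 l hl σ mσ
  have k6 := v0 l hl σ mσ
  have k7 := w1 l hl l' hl' σ mσ r mr hσr
  have k8 := v1 l hl l' hl' σ mσ r mr hσr
  rw [hs] at k3 k4 k7 k8
  have k9 : l' - l + (r ^ 2 - σ ^ 2) = 2 * (l' - l) := by rw [hr2]; ring
  rw [k9] at k7 k8
  have t1 : |η₁ l σ * (η₂ l' r - η₂ l σ) - η₂ l σ * (η₁ l' r - η₁ l σ)| ≤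
      2 * (C * D) * (|ρ| + 1) * (l' - l) := by
    have b1 : |η₁ l σ * (η₂ l' r - η₂ l σ)| ≤ C * σ * (D * (l' - l + (r - σ))) := by
      rw [abs_mul]; exact mul_le_mul k1 k4 (abs_nonneg _) (by positivity)
    have b2 : |η₂ l σ * (η₁ l' r - η₁ l σ)| ≤ D * σ * (C * (l' - l + (r - σ))) := by
      rw [abs_mul]; exact mul_le_mul k2 k3 (abs_nonneg _) (by positivity)
    have b3 : σ * (l' - l + (r - σ)) ≤ (|ρ| + 1) * (l' - l) := by
      nlinarith [mul_le_mul_of_nonneg_right hσρ' hs0]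
    have b4 : C * D * (σ * (l' - l + (r - σ))) ≤ C * D * ((|ρ| + 1) * (l' - l)) :=
      mul_le_mul_of_nonneg_left b3 (by positivity)
    calc _ ≤ |η₁ l σ * (η₂ l' r - η₂ l σ)| + |η₂ l σ * (η₁ l' r - η₁ l σ)| := abs_sub _ _
      _ ≤ _ := by linarith
  have t2 : |(conj (w₁ l σ) * (w₂ l' r - w₂ l σ) - conj (w₂ l σ) * (w₁ l' r - w₁ l σ)).re| ≤
      (C' * (D * 2) + D' * (C * 2)) * (l' - l) := by
    refine (Complex.abs_re_le_norm _).trans ((norm_sub_le _ _).trans ?_)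
    rw [norm_mul, norm_mul, Complex.norm_conj, Complex.norm_conj]
    have b1 := mul_le_mul k5 k8 (norm_nonneg _) hC'
    have b2 := mul_le_mul k6 k7 (norm_nonneg _) hD'
    linarith
  -- The weight is `√(l' / l)` times `σ / r ≤ 1`, so it stays bounded.
  have hsa : 0 < Real.sqrt a := Real.sqrt_pos.mpr ha
  have hq0 : 0 ≤ Real.sqrt l' * σ / (Real.sqrt l * r) := by positivity
  have hq1 : Real.sqrt l' * σ / (Real.sqrt l * r) ≤ q := by
    rw [mul_div_mul_comm, hq]
    have b1 : Real.sqrt l' / Real.sqrt l ≤ Real.sqrt b / Real.sqrt a :=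
      div_le_div₀ (Real.sqrt_nonneg _) (Real.sqrt_le_sqrt hl'.2) hsa (Real.sqrt_le_sqrt hl.1)
    have b2 : σ / r ≤ 1 := (div_le_one hr0).mpr hσr
    calc _ ≤ Real.sqrt b / Real.sqrt a * 1 :=
          mul_le_mul b1 b2 (by positivity) (by positivity)
      _ = _ := mul_one _
  have hid : weightedForm η₁ η₂ w₁ w₂ σ l l' - weightedForm η₂ η₁ w₂ w₁ σ l l' =
      -2 * (η₁ l σ * (η₂ l' r - η₂ l σ) - η₂ l σ * (η₁ l' r - η₁ l σ)) +
      Real.sqrt l' * σ / (Real.sqrt l * r) * (2 * (conj (w₁ l σ) * (w₂ l' r - w₂ l σ) -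
        conj (w₂ l σ) * (w₁ l' r - w₁ l σ)).re) := by
    simp only [weightedForm, ← hr, Complex.sub_re, Complex.mul_re, Complex.conj_re,
      Complex.conj_im, Complex.sub_im]
    ring
  rw [hid]
  refine (abs_add_le _ _).trans ?_
  rw [abs_mul, abs_mul, abs_mul 2, abs_of_nonneg hq0]
  have b1 := mul_le_mul hq1 (mul_le_mul_of_nonneg_left t2 (zero_le_two (α := ℝ)))
    (by positivity) (by positivity : (0 : ℝ) ≤ q)
  have n2 : |(-2 : ℝ)| = 2 := by norm_num
  have n2' : |(2 : ℝ)| = 2 := by norm_num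
  rw [n2, n2']
  linarith

/-! ### The bracket with a cutoff -/

lemma hasDerivAt_sqrt_sub {l z : ℝ} (h : z < l) :
    HasDerivAt (fun z => Real.sqrt (l - z)) (-(1 / (2 * Real.sqrt (l - z)))) z := by
  have h1 := (((hasDerivAt_id z).const_sub l).sqrt (by simp; linarith))
  refine h1.congr_deriv ?_
  simp only [id]
  ring

/-- The algebra behind the bracket: the derivative of the weighted form is, up to the factor
`l₁ - l₂ = r₁² - r₂²`, the integrand of the bracket. -/
lemma weightedForm_deriv_algebra {s₁ s₂ r₁ r₂ z : ℝ} (hs₁ : s₁ ≠ 0) (hs₂ : s₂ ≠ 0) (hr₁ : r₁ ≠ 0)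
    (hr₂ : r₂ ≠ 0) (h₁ : s₁ ^ 2 = z + r₁ ^ 2) (h₂ : s₂ ^ 2 = z + r₂ ^ 2) (p w₁ w₂ : ℂ)
    (e₁ e₂ : ℝ) :
    -2 * ((-(1 / (2 * r₁)) * (4 * s₁ * (conj p * w₁).im)) * e₂ +
        e₁ * (-(1 / (2 * r₂)) * (4 * s₂ * (conj p * w₂).im))) +
      ((s₂ * -(1 / (2 * r₁)) * (s₁ * r₂) - s₂ * r₁ * (s₁ * -(1 / (2 * r₂)))) / (s₁ * r₂) ^ 2 *
          (2 * (conj w₁ * w₂).re) +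
        s₂ * r₁ / (s₁ * r₂) * (2 *
          (conj (((-(1 / (2 * r₁)) : ℝ) : ℂ) * (4 * s₁ * Complex.I * p * e₁)) * w₂ +
            conj w₁ * (((-(1 / (2 * r₂)) : ℝ) : ℂ) * (4 * s₂ * Complex.I * p * e₂))).re)) =
    (r₁ ^ 2 - r₂ ^ 2) * (2 * (conj (w₁ / s₁ / r₁) *
      (((s₂ ^ 2 : ℝ) * (w₂ / s₂) / (r₂ : ℂ) ^ 2 -
        z * ((4 * s₂ * Complex.I * p * e₂) / s₂) / r₂) / (2 * (r₂ : ℂ)))).re) := by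
  have hs₁' : (s₁ : ℂ) ≠ 0 := Complex.ofReal_ne_zero.mpr hs₁
  have hs₂' : (s₂ : ℂ) ≠ 0 := Complex.ofReal_ne_zero.mpr hs₂
  have hr₁' : (r₁ : ℂ) ≠ 0 := Complex.ofReal_ne_zero.mpr hr₁
  have hr₂' : (r₂ : ℂ) ≠ 0 := Complex.ofReal_ne_zero.mpr hr₂
  obtain ⟨p0, p1⟩ := p
  obtain ⟨x1, y1⟩ := w₁
  obtain ⟨x2, y2⟩ := w₂
  have hR : conj ((⟨x1, y1⟩ : ℂ) / s₁ / r₁) *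
      (((s₂ ^ 2 : ℝ) * ((⟨x2, y2⟩ : ℂ) / s₂) / (r₂ : ℂ) ^ 2 -
        z * ((4 * s₂ * Complex.I * ⟨p0, p1⟩ * e₂) / s₂) / r₂) / (2 * (r₂ : ℂ))) =
      ((1 / (s₁ * r₁ * (2 * r₂)) : ℝ) : ℂ) * (conj (⟨x1, y1⟩ : ℂ) *
        (((s₂ / r₂ ^ 2 : ℝ) : ℂ) * ⟨x2, y2⟩ -
          ((4 * z * e₂ / r₂ : ℝ) : ℂ) * (Complex.I * ⟨p0, p1⟩))) := by
    push_cast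
    simp only [map_div₀, Complex.conj_ofReal]
    field_simp
  rw [hR]
  simp only [Complex.mul_re, Complex.mul_im, Complex.add_re, Complex.sub_re, Complex.sub_im,
    Complex.conj_re, Complex.conj_im, Complex.ofReal_re, Complex.ofReal_im, Complex.I_re,
    Complex.I_im, Complex.re_ofNat, Complex.im_ofNat]
  have hz : z = s₁ ^ 2 - r₁ ^ 2 := by linarith
  have h3 : s₂ ^ 2 = s₁ ^ 2 - r₁ ^ 2 + r₂ ^ 2 := by linarith
  rw [hz]
  field_simp
  linear_combination (-4 * r₁ ^ 2 * r₂ * e₂ * (p0 * y1 - p1 * x1)) * h3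

lemma re_conj_integral_mul {X : Type*} [MeasurableSpace X] {μ : Measure X} {f : X → ℂ}
    (hf : Integrable f μ) (d : ℂ) :
    2 * (conj (∫ x, f x ∂μ) * d).re = ∫ x, 2 * (conj (f x) * d).re ∂μ := by
  have h1 : conj (∫ x, f x ∂μ) = ∫ x, conj (f x) ∂μ := integral_conj.symm
  have h2 : Integrable (fun x => conj (f x) * d) μ :=
    ((Complex.conjCLE.toContinuousLinearMap.integrable_comp hf).mul_const d)
  rw [h1, ← integral_mul_const, integral_const_mul]
  congr 1
  exact (Complex.reCLM.integral_comp_comm h2).symm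

lemma re_conj_integral_mul_integral {μ ν : Measure ℝ} [SFinite μ] [SFinite ν] {f g : ℝ → ℂ}
    (hf : Integrable f μ) (hg : Integrable g ν) :
    2 * (conj (∫ x, f x ∂μ) * ∫ y, g y ∂ν).re =
      ∫ q, 2 * (conj (f q.1) * g q.2).re ∂(μ.prod ν) := by
  have h1 : conj (∫ x, f x ∂μ) = ∫ x, conj (f x) ∂μ := integral_conj.symm
  have h2 : Integrable (fun q : ℝ × ℝ => conj (f q.1) * g q.2) (μ.prod ν) :=
    (Complex.conjCLE.toContinuousLinearMap.integrable_comp hf).mul_prod hg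
  rw [h1, ← integral_prod_mul, integral_const_mul]
  congr 1
  exact (Complex.reCLM.integral_comp_comm h2).symm

section CutBracket

variable {a b : ℝ} {F₁ Fl₁ Fr₁ F₂ Fl₂ Fr₂ : ℝ → ℝ → ℂ}

/-- The integrand of the first factor of the bracket. -/
def cutDensity (F : ℝ → ℝ → ℂ) (σ z l : ℝ) : ℂ := F l (cutRadius σ z l) / (cutRadius σ z l : ℂ)

/-- The integrand of the second factor of the bracket, without boundary term. -/
def cutDerivDensity (F Fr : ℝ → ℝ → ℂ) (σ z l : ℝ) : ℂ :=
  (l * F l (cutRadius σ z l) / (cutRadius σ z l : ℂ) ^ 2 -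
    z * Fr l (cutRadius σ z l) / (cutRadius σ z l : ℂ)) / (2 * (cutRadius σ z l : ℂ))

lemma continuous_cutDensity (h : IsProfile a b F₁ Fl₁ Fr₁) {σ : ℝ} (hσ : 0 < σ) :
    Continuous fun x : ℝ × ℝ => cutDensity F₁ σ x.1 x.2 := by
  have hc := continuous_cutRadius σ
  exact (h.continuous.comp (continuous_snd.prodMk hc)).div (Complex.continuous_ofReal.comp hc)
    fun x => Complex.ofReal_ne_zero.mpr (cutRadius_pos hσ _ _).ne'

lemma continuous_cutDerivDensity (h : IsProfile a b F₂ Fl₂ Fr₂) {σ : ℝ} (hσ : 0 < σ) :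
    Continuous fun x : ℝ × ℝ => cutDerivDensity F₂ Fr₂ σ x.1 x.2 := by
  have hc := continuous_cutRadius σ
  have hc' : Continuous fun x : ℝ × ℝ => (cutRadius σ x.1 x.2 : ℂ) :=
    Complex.continuous_ofReal.comp hc
  have hne : ∀ x : ℝ × ℝ, (cutRadius σ x.1 x.2 : ℂ) ≠ 0 := fun x =>
    Complex.ofReal_ne_zero.mpr (cutRadius_pos hσ _ _).ne'
  have c1 : Continuous fun x : ℝ × ℝ => F₂ x.2 (cutRadius σ x.1 x.2) :=
    h.continuous.comp (continuous_snd.prodMk hc)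
  have c2 : Continuous fun x : ℝ × ℝ => Fr₂ x.2 (cutRadius σ x.1 x.2) :=
    h.continuous_r.comp (continuous_snd.prodMk hc)
  exact ((((Complex.continuous_ofReal.comp continuous_snd).mul c1).div (hc'.pow 2)
    fun x => pow_ne_zero 2 (hne x)).sub
    (((Complex.continuous_ofReal.comp continuous_fst).mul c2).div hc' hne)).div
    (continuous_const.mul hc') fun x => mul_ne_zero two_ne_zero (hne x)

lemma integrable_cutDensity (h : IsProfile a b F₁ Fl₁ Fr₁) {σ : ℝ} (hσ : 0 < σ) (z c : ℝ) :
    Integrable ((Ici c).indicator (cutDensity F₁ σ z)) (volume.restrict (Icc a b)) :=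
  (((continuous_cutDensity h hσ).comp (Continuous.prodMk_right z)).integrableOn_Icc).indicator
    measurableSet_Ici

lemma integrable_cutDerivDensity (h : IsProfile a b F₂ Fl₂ Fr₂) {σ : ℝ} (hσ : 0 < σ) (z c : ℝ) :
    Integrable ((Ici c).indicator (cutDerivDensity F₂ Fr₂ σ z)) (volume.restrict (Icc a b)) :=
  (((continuous_cutDerivDensity h hσ).comp (Continuous.prodMk_right z)).integrableOn_Icc).indicator
    measurableSet_Ici

lemma abelCut_eq_integral (h : IsProfile a b F₁ Fl₁ Fr₁) {σ M z : ℝ} (hσ : 0 < σ) (hσM : σ ≤ M)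
    (hM : b ≤ z + M ^ 2) : abelCut F₁ σ M z =
      ∫ l in Icc a b, (Ici (z + σ ^ 2)).indicator (cutDensity F₁ σ z) l := by
  rw [abelCut, integral_radius_eq h.continuous h.eq_zero hσ hσM hM, ← integral_const_mul]
  refine integral_congr_ae (ae_of_all _ fun l => ?_)
  by_cases hl : l ∈ Ici (z + σ ^ 2)
  · have := (cutRadius_pos hσ z l).ne'
    have h0 : (cutRadius σ z l : ℂ) ≠ 0 := Complex.ofReal_ne_zero.mpr this
    simp only [indicator_of_mem hl, cutDensity]
    field_simp
  · simp only [indicator_of_notMem hl, mul_zero]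

/-- The second factor of the bracket as an integral over `l`. The derivative with respect to `z`
is taken under the integral sign at fixed `l`; the moving end point `l = z + σ²` contributes the
boundary term, which diverges as `σ → 0`. -/
lemma abelCut_deriv_eq_integral (h : IsProfile a b F₂ Fl₂ Fr₂) {σ M z : ℝ} (hσ : 0 < σ)
    (hσM : σ ≤ M) (hM : b ≤ z + M ^ 2) :
    z * abelCut Fl₂ σ M z + 1 / 2 * abelCut F₂ σ M z =
      -(z * (F₂ (z + σ ^ 2) σ / σ)) +
        ∫ l in Icc a b, (Ici (z + σ ^ 2)).indicator (cutDerivDensity F₂ Fr₂ σ z) l := by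
  have hm : ∀ r : ℝ, 0 < max σ r := fun r => lt_max_of_lt_left hσ
  have hm' : ∀ r : ℝ, ((max σ r : ℝ) : ℂ) ≠ 0 := fun r => Complex.ofReal_ne_zero.mpr (hm r).ne'
  have hcm : Continuous fun r : ℝ => ((max σ r : ℝ) : ℂ) := by fun_prop
  have hcm2 : Continuous fun x : ℝ × ℝ => ((max σ x.2 : ℝ) : ℂ) := hcm.comp continuous_snd
  set f : ℝ → ℝ → ℂ := fun l r => l * F₂ l r / (max σ r : ℝ) ^ 2 - z * Fr₂ l r / (max σ r : ℝ)
    with hf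
  have hfc : Continuous fun x : ℝ × ℝ => f x.1 x.2 :=
    (((Complex.continuous_ofReal.comp continuous_fst).mul h.continuous).div (hcm2.pow 2)
      fun x => pow_ne_zero 2 (hm' x.2)).sub
      ((continuous_const.mul h.continuous_r).div hcm2 fun x => hm' x.2)
  have hf0 : ∀ l ∉ Icc a b, ∀ r, f l r = 0 := fun l hl r => by
    simp [hf, h.eq_zero l hl, h.r_eq_zero hl]
  have c1 : Continuous fun r : ℝ => F₂ (z + r ^ 2) r :=
    h.continuous_integrand.comp (Continuous.prodMk_right z)
  have c3 : Continuous fun r : ℝ => Fr₂ (z + r ^ 2) r :=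
    h.continuous_r.comp (by fun_prop : Continuous fun r : ℝ => (z + r ^ 2, r))
  have c4 : Continuous fun r : ℝ => F₂ (z + r ^ 2) r / (max σ r : ℝ) ^ 2 -
      Fr₂ (z + r ^ 2) r / (max σ r : ℝ) :=
    (c1.div (hcm.pow 2) fun r => pow_ne_zero 2 (hm' r)).sub (c3.div hcm hm')
  have h1 : z * (∫ r in σ..M, (F₂ (z + r ^ 2) r / (max σ r : ℝ) ^ 2 -
      Fr₂ (z + r ^ 2) r / (max σ r : ℝ))) + ∫ r in σ..M, F₂ (z + r ^ 2) r =
      ∫ r in σ..M, f (z + r ^ 2) r := by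
    rw [← intervalIntegral.integral_const_mul, ← intervalIntegral.integral_add
      ((c4.const_mul _).intervalIntegrable _ _) (c1.intervalIntegrable _ _)]
    refine intervalIntegral.integral_congr fun r hr => ?_
    rw [uIcc_of_le hσM] at hr
    have hr0 : (r : ℂ) ≠ 0 := Complex.ofReal_ne_zero.mpr (hσ.trans_le hr.1).ne'
    simp only [hf, max_eq_right hr.1]
    push_cast
    field_simp
    ring
  have h2 : ∫ r in σ..M, f (z + r ^ 2) r =
      ∫ l in Icc a b, (Ici (z + σ ^ 2)).indicator (cutDerivDensity F₂ Fr₂ σ z) l := by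
    rw [integral_radius_eq hfc hf0 hσ hσM hM]
    refine integral_congr_ae (ae_of_all _ fun l => ?_)
    have h3 : max σ (cutRadius σ z l) = cutRadius σ z l := max_eq_right (le_cutRadius σ z l)
    by_cases hl : l ∈ Ici (z + σ ^ 2)
    · simp only [indicator_of_mem hl, cutDerivDensity, hf, h3]
    · simp only [indicator_of_notMem hl]
  rw [← h2, ← h1, h.abelCut_l_eq hσ hσM hM, abelCut]
  ring

/-- The integrand of the cut bracket, as a function of the point `z` and of the two deformation
parameters. -/
def cutKernel (F₁ F₂ Fr₂ : ℝ → ℝ → ℂ) (σ z : ℝ) (q : ℝ × ℝ) : ℝ :=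
  {q : ℝ × ℝ | z + σ ^ 2 ≤ q.1 ∧ z + σ ^ 2 ≤ q.2}.indicator
    (fun q => 2 * (conj (cutDensity F₁ σ z q.1) * cutDerivDensity F₂ Fr₂ σ z q.2).re) q

/-- The boundary term of the cut bracket. -/
def cutBoundary (F₁ F₂ : ℝ → ℝ → ℂ) (σ : ℝ) (q : ℝ × ℝ) : ℝ :=
  {q : ℝ × ℝ | q.2 ≤ q.1}.indicator (fun q => 2 * (conj (cutDensity F₁ σ (q.2 - σ ^ 2) q.1) *
    (((q.2 - σ ^ 2) / σ : ℝ) * F₂ q.2 σ)).re) q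

lemma integrable_cutKernel (h₁ : IsProfile a b F₁ Fl₁ Fr₁) (h₂ : IsProfile a b F₂ Fl₂ Fr₂) {σ : ℝ}
    (hσ : 0 < σ) (R : ℝ) :
    Integrable (fun x : ℝ × (ℝ × ℝ) => cutKernel F₁ F₂ Fr₂ σ x.1 x.2)
      ((volume.restrict (Ioc 0 R)).prod (volume.restrict (Icc a b ×ˢ Icc a b))) := by
  have m1 : MeasurableSet {x : ℝ × (ℝ × ℝ) | x.1 + σ ^ 2 ≤ x.2.1} :=
    measurableSet_le (by fun_prop) (by fun_prop)
  have m2 : MeasurableSet {x : ℝ × (ℝ × ℝ) | x.1 + σ ^ 2 ≤ x.2.2} :=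
    measurableSet_le (by fun_prop) (by fun_prop)
  have hc : Continuous fun x : ℝ × (ℝ × ℝ) =>
      2 * (conj (cutDensity F₁ σ x.1 x.2.1) * cutDerivDensity F₂ Fr₂ σ x.1 x.2.2).re := by
    have c1 : Continuous fun x : ℝ × (ℝ × ℝ) => cutDensity F₁ σ x.1 x.2.1 :=
      Continuous.comp (g := fun x : ℝ × ℝ => cutDensity F₁ σ x.1 x.2)
        (f := fun x : ℝ × (ℝ × ℝ) => (x.1, x.2.1)) (continuous_cutDensity h₁ hσ) (by fun_prop)
    have c2 : Continuous fun x : ℝ × (ℝ × ℝ) => cutDerivDensity F₂ Fr₂ σ x.1 x.2.2 :=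
      Continuous.comp (g := fun x : ℝ × ℝ => cutDerivDensity F₂ Fr₂ σ x.1 x.2)
        (f := fun x : ℝ × (ℝ × ℝ) => (x.1, x.2.2)) (continuous_cutDerivDensity h₂ hσ) (by fun_prop)
    exact continuous_const.mul (Complex.continuous_re.comp
      ((Complex.continuous_conj.comp c1).mul c2))
  have hK : IsCompact (Icc (0 : ℝ) R ×ˢ (Icc a b ×ˢ Icc a b)) :=
    isCompact_Icc.prod (isCompact_Icc.prod isCompact_Icc)
  set f : ℝ × (ℝ × ℝ) → ℝ := fun x =>
    2 * (conj (cutDensity F₁ σ x.1 x.2.1) * cutDerivDensity F₂ Fr₂ σ x.1 x.2.2).re with hf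
  have h0 : IntegrableOn f (Icc (0 : ℝ) R ×ˢ (Icc a b ×ˢ Icc a b)) :=
    hc.continuousOn.integrableOn_compact hK
  have h : IntegrableOn f (Ioc (0 : ℝ) R ×ˢ (Icc a b ×ˢ Icc a b)) :=
    h0.mono_set (prod_mono Ioc_subset_Icc_self Subset.rfl)
  rw [Measure.prod_restrict, ← Measure.volume_eq_prod]
  refine (Integrable.indicator h (m1.inter m2)).congr (ae_of_all _ fun x => ?_)
  simp only [cutKernel, indicator, mem_inter_iff, mem_ofPred_eq, hf]

lemma integrable_cutBoundary (h₁ : IsProfile a b F₁ Fl₁ Fr₁) (h₂ : IsProfile a b F₂ Fl₂ Fr₂)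
    {σ : ℝ} (hσ : 0 < σ) :
    Integrable (cutBoundary F₁ F₂ σ) (volume.restrict (Icc a b ×ˢ Icc a b)) := by
  have hm : MeasurableSet {q : ℝ × ℝ | q.2 ≤ q.1} :=
    (isClosed_le (by fun_prop) (by fun_prop)).measurableSet
  have hc : Continuous fun q : ℝ × ℝ => 2 * (conj (cutDensity F₁ σ (q.2 - σ ^ 2) q.1) *
      (((q.2 - σ ^ 2) / σ : ℝ) * F₂ q.2 σ)).re := by
    refine continuous_const.mul (Complex.continuous_re.comp
      ((Complex.continuous_conj.comp ?_).mul (Continuous.mul (by fun_prop) ?_)))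
    · exact (continuous_cutDensity h₁ hσ).comp
        (by fun_prop : Continuous fun q : ℝ × ℝ => (q.2 - σ ^ 2, q.1))
    · exact h₂.continuous.comp (by fun_prop : Continuous fun q : ℝ × ℝ => (q.2, σ))
  exact (hc.continuousOn.integrableOn_compact (isCompact_Icc.prod isCompact_Icc)).indicator hm

/-- The bracket with cutoff, as a double integral over the deformation parameters. -/
lemma cutBracket_eq (h₁ : IsProfile a b F₁ Fl₁ Fr₁) (h₂ : IsProfile a b F₂ Fl₂ Fr₂) {σ R : ℝ}
    (hσ : 0 < σ) (hσa : σ ^ 2 ≤ a) (hab : a ≤ b) (hbR : b ≤ R) :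
    ∫ z in (0 : ℝ)..R, 2 * (conj (abelCut F₁ σ (Real.sqrt R) z) *
        (z * abelCut Fl₂ σ (Real.sqrt R) z + 1 / 2 * abelCut F₂ σ (Real.sqrt R) z)).re =
      (∫ q in Icc a b ×ˢ Icc a b, ∫ z in (0 : ℝ)..R, cutKernel F₁ F₂ Fr₂ σ z q) -
        ∫ q in Icc a b ×ˢ Icc a b, cutBoundary F₁ F₂ σ q := by
  have hσ2 : 0 < σ ^ 2 := by positivity
  have hR0 : 0 ≤ R := by linarith
  have hσM : σ ≤ Real.sqrt R := Real.le_sqrt_of_sq_le (by linarith)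
  have hM : ∀ z, 0 ≤ z → b ≤ z + Real.sqrt R ^ 2 := fun z hz => by
    rw [Real.sq_sqrt hR0]; linarith
  -- The boundary term at `z = l - σ²`, as a function of the end point `l` of the second integral.
  set H : ℝ → ℝ := fun l => 2 * (conj (abelCut F₁ σ (Real.sqrt R) (l - σ ^ 2)) *
    (((l - σ ^ 2) / σ : ℝ) * F₂ l σ)).re with hH
  have hHc : Continuous H := by
    have c1 : Continuous (abelCut F₁ σ (Real.sqrt R)) :=
      continuous_iff_continuousAt.mpr fun z => (h₁.hasDerivAt_abelCut _ _ z).continuousAt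
    have c2 : Continuous fun l => F₂ l σ := h₂.continuous.comp (Continuous.prodMk_left σ)
    exact continuous_const.mul (Complex.continuous_re.comp ((Complex.continuous_conj.comp
      (c1.comp (by fun_prop))).mul (Continuous.mul (by fun_prop) c2)))
  have hbox : (volume.restrict (Icc a b ×ˢ Icc a b) : Measure (ℝ × ℝ)) =
      (volume.restrict (Icc a b)).prod (volume.restrict (Icc a b)) := by
    rw [Measure.prod_restrict]; rfl
  have hpt : ∀ z ∈ Ioc 0 R, 2 * (conj (abelCut F₁ σ (Real.sqrt R) z) *
        (z * abelCut Fl₂ σ (Real.sqrt R) z + 1 / 2 * abelCut F₂ σ (Real.sqrt R) z)).re =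
      (∫ q in Icc a b ×ˢ Icc a b, cutKernel F₁ F₂ Fr₂ σ z q) - H (z + σ ^ 2) := by
    intro z hz
    have e1 : (∫ q in Icc a b ×ˢ Icc a b, cutKernel F₁ F₂ Fr₂ σ z q) =
        2 * (conj (∫ l in Icc a b, (Ici (z + σ ^ 2)).indicator (cutDensity F₁ σ z) l) *
          ∫ l in Icc a b, (Ici (z + σ ^ 2)).indicator (cutDerivDensity F₂ Fr₂ σ z) l).re := by
      rw [re_conj_integral_mul_integral (integrable_cutDensity h₁ hσ z _)
        (integrable_cutDerivDensity h₂ hσ z _), hbox]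
      refine integral_congr_ae (ae_of_all _ fun q => ?_)
      simp only [cutKernel, indicator, mem_ofPred_eq, mem_Ici]
      by_cases hq1 : z + σ ^ 2 ≤ q.1 <;> by_cases hq2 : z + σ ^ 2 ≤ q.2 <;> simp [hq1, hq2]
    rw [e1, ← abelCut_eq_integral h₁ hσ hσM (hM z hz.1.le),
      abelCut_deriv_eq_integral h₂ hσ hσM (hM z hz.1.le), hH]
    simp only [add_sub_cancel_right]
    rw [mul_add, Complex.add_re]
    have e2 : (((z / σ : ℝ) : ℂ) * F₂ (z + σ ^ 2) σ) = z * (F₂ (z + σ ^ 2) σ / σ) := by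
      push_cast; ring
    rw [e2, mul_neg, Complex.neg_re]
    ring
  have hint := integrable_cutKernel h₁ h₂ hσ R
  have hsum : ∫ z in (0 : ℝ)..R, H (z + σ ^ 2) =
      ∫ q in Icc a b ×ˢ Icc a b, cutBoundary F₁ F₂ σ q := by
    rw [intervalIntegral.integral_comp_add_right, zero_add,
      intervalIntegral.integral_of_le (by linarith)]
    have e1 : ∫ l in Ioc (σ ^ 2) (R + σ ^ 2), H l = ∫ l in Icc a b, H l := by
      rw [← integral_indicator measurableSet_Ioc, ← integral_indicator measurableSet_Icc]
      refine integral_congr_ae ?_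
      have hne : ∀ᵐ l : ℝ, l ≠ σ ^ 2 := by simp [ae_iff]
      filter_upwards [hne] with l hl
      by_cases hlab : l ∈ Icc a b
      · rw [indicator_of_mem hlab, indicator_of_mem (show l ∈ Ioc (σ ^ 2) (R + σ ^ 2) from
          ⟨lt_of_le_of_ne (hσa.trans hlab.1) (Ne.symm hl), by linarith [hlab.2]⟩)]
      · have : H l = 0 := by simp [hH, h₂.eq_zero l hlab]
        rw [indicator_of_notMem hlab]
        by_cases hl2 : l ∈ Ioc (σ ^ 2) (R + σ ^ 2)
        · rw [indicator_of_mem hl2, this]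
        · rw [indicator_of_notMem hl2]
    rw [e1]
    have hB := integrable_cutBoundary h₁ h₂ hσ
    rw [hbox] at hB ⊢
    rw [integral_prod_symm _ hB]
    refine setIntegral_congr_fun measurableSet_Icc fun l hl => ?_
    have hz : 0 ≤ l - σ ^ 2 := by linarith [hl.1]
    simp only [hH]
    rw [abelCut_eq_integral h₁ hσ hσM (hM _ hz), sub_add_cancel,
      re_conj_integral_mul (integrable_cutDensity h₁ hσ _ _)]
    refine integral_congr_ae (ae_of_all _ fun l' => ?_)
    simp only [cutBoundary, indicator, mem_ofPred_eq, mem_Ici]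
    by_cases hq1 : l ≤ l' <;> simp [hq1]
  rw [intervalIntegral.integral_of_le hR0, setIntegral_congr_fun measurableSet_Ioc hpt,
    integral_sub (f := fun z => ∫ q in Icc a b ×ˢ Icc a b, cutKernel F₁ F₂ Fr₂ σ z q)
      (g := fun z => H (z + σ ^ 2)) hint.integral_prod_left
      ((hHc.comp (by fun_prop)).integrableOn_Ioc),
    ← intervalIntegral.integral_of_le hR0, ← intervalIntegral.integral_of_le hR0, hsum]
  congr 1
  rw [intervalIntegral.integral_of_le hR0, integral_integral_swap hint]
  exact integral_congr_ae (ae_of_all _ fun q => (intervalIntegral.integral_of_le hR0).symm)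

lemma integrable_integral_cutKernel (h₁ : IsProfile a b F₁ Fl₁ Fr₁) (h₂ : IsProfile a b F₂ Fl₂ Fr₂)
    {σ R : ℝ} (hσ : 0 < σ) (hR0 : 0 ≤ R) :
    Integrable (fun q : ℝ × ℝ => ∫ z in (0 : ℝ)..R, cutKernel F₁ F₂ Fr₂ σ z q)
      (volume.restrict (Icc a b ×ˢ Icc a b)) := by
  simp only [intervalIntegral.integral_of_le hR0]
  exact (integrable_cutKernel h₁ h₂ hσ R).integral_prod_right

end CutBracket

/-! ### The bracket as a symmetrized integral -/

/-- The invariant form `tr(X₁ X₂)` of two sections on the axis, for deformation parameters `q.1`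
and `q.2`. -/
def axisForm (η₁ η₂ : ℝ → ℝ → ℝ) (w₁ w₂ : ℝ → ℝ → ℂ) (q : ℝ × ℝ) : ℝ :=
  -2 * η₁ q.1 (Real.sqrt q.1) * η₂ q.2 (Real.sqrt q.2) +
    2 * (conj (w₁ q.1 (Real.sqrt q.1)) * w₂ q.2 (Real.sqrt q.2)).re

/-- The invariant form at the point `z`, with the `𝔨` part weighted by the quotient of the
deformation factors. -/
def pointForm (η₁ η₂ : ℝ → ℝ → ℝ) (w₁ w₂ : ℝ → ℝ → ℂ) (q : ℝ × ℝ) (z : ℝ) : ℝ :=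
  -2 * (η₁ q.1 (Real.sqrt (q.1 - z)) * η₂ q.2 (Real.sqrt (q.2 - z))) +
    Real.sqrt q.2 * Real.sqrt (q.1 - z) / (Real.sqrt q.1 * Real.sqrt (q.2 - z)) *
      (2 * (conj (w₁ q.1 (Real.sqrt (q.1 - z))) * w₂ q.2 (Real.sqrt (q.2 - z))).re)

section Core

variable {a b : ℝ} {κ κ₁ κ₁' : ℝ → ℝ} {p : ℝ → ℂ} {η₁ ηl₁ η₂ ηl₂ : ℝ → ℝ → ℝ}
  {w₁ wl₁ w₂ wl₂ : ℝ → ℝ → ℂ}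

/-- The profile `w / √l` of the Abel transform that enters the functional derivative. -/
lemma IsRadialPair.isProfile {η ηl : ℝ → ℝ → ℝ} {w wl : ℝ → ℝ → ℂ} (hκ : Continuous κ)
    (hp : Continuous p) (hκ₁ : ∀ l, HasDerivAt κ₁ (κ₁' l) l) (hκ₁' : Continuous κ₁')
    (h : IsRadialPair a b κ p η ηl w wl) :
    IsProfile a b (fun l r => κ₁ l * w l r) (fun l r => κ₁' l * w l r + κ₁ l * wl l r)
      (fun l r => κ₁ l * (4 * κ l * Complex.I * p (l - r ^ 2) * η l r)) := by
  have c1 : Continuous κ₁ := continuous_iff_continuousAt.mpr fun l => (hκ₁ l).continuousAt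
  have c1' : Continuous fun x : ℝ × ℝ => (κ₁ x.1 : ℂ) :=
    Complex.continuous_ofReal.comp (c1.comp continuous_fst)
  have c2' : Continuous fun x : ℝ × ℝ => (κ₁' x.1 : ℂ) :=
    Complex.continuous_ofReal.comp (hκ₁'.comp continuous_fst)
  have c3' : Continuous fun x : ℝ × ℝ => (κ x.1 : ℂ) :=
    Complex.continuous_ofReal.comp (hκ.comp continuous_fst)
  refine ⟨c1'.mul h.cont_omega, (c2'.mul h.cont_omega).add (c1'.mul h.cont_omega_l),
    c1'.mul ((((continuous_const.mul c3').mul continuous_const).mul (hp.comp (by fun_prop))).mul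
      (Complex.continuous_ofReal.comp h.cont_eta)), fun l r => ?_, fun l r => ?_, fun l hl r => ?_⟩
  · exact ((hκ₁ l).ofReal_comp.mul (h.deriv_omega_l l r)).congr_deriv rfl
  · exact (h.deriv_omega_r l r).const_mul _
  · simp [h.omega_supp l hl r]

/-- Along `z` the sections are covariantly constant for two different connections. For equal
parameters their invariant form would be constant; in general its derivative is `l₁ - l₂` times
the integrand of the bracket. -/
lemma hasDerivAt_pointForm (h₁ : IsRadialPair a b κ p η₁ ηl₁ w₁ wl₁)
    (h₂ : IsRadialPair a b κ p η₂ ηl₂ w₂ wl₂) {q : ℝ × ℝ} {z : ℝ} (hz1 : z < q.1) (hz2 : z < q.2)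
    (hq1 : 0 < q.1) (hq2 : 0 < q.2) (hκ1 : κ q.1 = Real.sqrt q.1) (hκ2 : κ q.2 = Real.sqrt q.2) :
    HasDerivAt (pointForm η₁ η₂ w₁ w₂ q)
      ((q.1 - q.2) * (2 * (conj (w₁ q.1 (Real.sqrt (q.1 - z)) / Real.sqrt q.1 /
          Real.sqrt (q.1 - z)) *
        (((q.2 : ℝ) * (w₂ q.2 (Real.sqrt (q.2 - z)) / Real.sqrt q.2) /
            (Real.sqrt (q.2 - z) : ℂ) ^ 2 -
          z * ((4 * Real.sqrt q.2 * Complex.I * p z * η₂ q.2 (Real.sqrt (q.2 - z))) /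
            Real.sqrt q.2) / Real.sqrt (q.2 - z)) / (2 * (Real.sqrt (q.2 - z) : ℂ)))).re)) z := by
  have d1 := hasDerivAt_sqrt_sub hz1
  have d2 := hasDerivAt_sqrt_sub hz2
  have e1 := (h₁.deriv_eta_r q.1 (Real.sqrt (q.1 - z))).comp z d1
  have e2 := (h₂.deriv_eta_r q.2 (Real.sqrt (q.2 - z))).comp z d2
  have f1 := (h₁.deriv_omega_r q.1 (Real.sqrt (q.1 - z))).scomp z d1
  have f2 := (h₂.deriv_omega_r q.2 (Real.sqrt (q.2 - z))).scomp z d2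
  have r1 : 0 < Real.sqrt (q.1 - z) := Real.sqrt_pos.mpr (by linarith)
  have r2 : 0 < Real.sqrt (q.2 - z) := Real.sqrt_pos.mpr (by linarith)
  have s1 : 0 < Real.sqrt q.1 := Real.sqrt_pos.mpr hq1
  have s2 : 0 < Real.sqrt q.2 := Real.sqrt_pos.mpr hq2
  have q1 : Real.sqrt (q.1 - z) ^ 2 = q.1 - z := Real.sq_sqrt (by linarith)
  have q2 : Real.sqrt (q.2 - z) ^ 2 = q.2 - z := Real.sq_sqrt (by linarith)
  rw [q1, sub_sub_cancel, hκ1] at e1 f1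
  rw [q2, sub_sub_cancel, hκ2] at e2 f2
  rw [Complex.real_smul] at f1 f2
  set r₁ := Real.sqrt (q.1 - z)
  set r₂ := Real.sqrt (q.2 - z)
  have f1' := Complex.conjCLE.toContinuousLinearMap.hasFDerivAt.comp_hasDerivAt z f1
  have k : HasDerivAt (fun z => (conj (w₁ q.1 (Real.sqrt (q.1 - z))) *
      w₂ q.2 (Real.sqrt (q.2 - z))).re)
      ((conj (((-(1 / (2 * r₁)) : ℝ) : ℂ) *
        (4 * Real.sqrt q.1 * Complex.I * p z * η₁ q.1 r₁)) * w₂ q.2 r₂ + conj (w₁ q.1 r₁) *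
        (((-(1 / (2 * r₂)) : ℝ) : ℂ) *
          (4 * Real.sqrt q.2 * Complex.I * p z * η₂ q.2 r₂))).re) z :=
    Complex.reCLM.hasFDerivAt.comp_hasDerivAt z (f1'.mul f2)
  have t1 := (e1.mul e2).const_mul (-2 : ℝ)
  have t2 := ((d1.const_mul (Real.sqrt q.2)).div (d2.const_mul (Real.sqrt q.1))
    (mul_pos s1 r2).ne').mul (k.const_mul 2)
  refine (t1.add t2).congr_deriv ?_
  have key := weightedForm_deriv_algebra s1.ne' s2.ne' r1.ne' r2.ne' (z := z)
    (by rw [q1, Real.sq_sqrt hq1.le]; ring) (by rw [q2, Real.sq_sqrt hq2.le]; ring) (p z)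
    (w₁ q.1 r₁) (w₂ q.2 r₂) (η₁ q.1 r₁) (η₂ q.2 r₂)
  rw [q1, q2, Real.sq_sqrt hq2.le] at key
  rw [show q.1 - q.2 = q.1 - z - (q.2 - z) by ring, ← key]
  simp only [Function.comp_apply, Pi.div_apply]
  ring

lemma integral_cutKernel_eq_integral {F₁ F₂ Fr₂ : ℝ → ℝ → ℂ} {σ R : ℝ} {q : ℝ × ℝ}
    (h0 : 0 ≤ min q.1 q.2 - σ ^ 2) (hR : min q.1 q.2 - σ ^ 2 ≤ R) :
    ∫ z in (0 : ℝ)..R, cutKernel F₁ F₂ Fr₂ σ z q =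
      ∫ z in (0 : ℝ)..(min q.1 q.2 - σ ^ 2),
        2 * (conj (cutDensity F₁ σ z q.1) * cutDerivDensity F₂ Fr₂ σ z q.2).re := by
  set m := min q.1 q.2 with hm
  rw [intervalIntegral.integral_of_le (h0.trans hR), intervalIntegral.integral_of_le h0,
    ← integral_indicator measurableSet_Ioc, ← integral_indicator measurableSet_Ioc]
  congr 1
  funext z
  have hiff : z + σ ^ 2 ≤ q.1 ∧ z + σ ^ 2 ≤ q.2 ↔ z ≤ m - σ ^ 2 := by
    rw [← le_min_iff, ← hm, le_sub_iff_add_le]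
  by_cases hz : z ≤ m - σ ^ 2
  · by_cases hz0 : 0 < z
    · rw [indicator_of_mem (show z ∈ Ioc 0 R from ⟨hz0, by linarith⟩),
        indicator_of_mem (show z ∈ Ioc 0 (m - σ ^ 2) from ⟨hz0, hz⟩), cutKernel,
        indicator_of_mem (show q ∈ {q : ℝ × ℝ | z + σ ^ 2 ≤ q.1 ∧ z + σ ^ 2 ≤ q.2} from
          hiff.mpr hz)]
    · rw [indicator_of_notMem (show z ∉ Ioc 0 R from fun h => hz0 h.1),
        indicator_of_notMem (show z ∉ Ioc 0 (m - σ ^ 2) from fun h => hz0 h.1)]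
  · rw [indicator_of_notMem (show z ∉ Ioc 0 (m - σ ^ 2) from fun h => hz h.2)]
    refine indicator_apply_eq_zero.mpr fun _ => ?_
    rw [cutKernel, indicator_of_notMem
      (show q ∉ {q : ℝ × ℝ | z + σ ^ 2 ≤ q.1 ∧ z + σ ^ 2 ≤ q.2} from fun h => hz (hiff.mp h))]

lemma pointForm_zero {q : ℝ × ℝ} (hq1 : 0 < q.1) (hq2 : 0 < q.2) :
    pointForm η₁ η₂ w₁ w₂ q 0 = axisForm η₁ η₂ w₁ w₂ q := by
  have s1 : 0 < Real.sqrt q.1 := Real.sqrt_pos.mpr hq1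
  have s2 : 0 < Real.sqrt q.2 := Real.sqrt_pos.mpr hq2
  have : Real.sqrt q.2 * Real.sqrt q.1 / (Real.sqrt q.1 * Real.sqrt q.2) = 1 := by
    rw [mul_comm]; exact div_self (mul_pos s1 s2).ne'
  simp only [pointForm, axisForm, sub_zero, this]
  ring

lemma hasDerivAt_pointForm_cut (hκs : ∀ l ∈ Icc a b, κ l = Real.sqrt l) (ha : 0 < a)
    (hκ₁s : ∀ l ∈ Icc a b, κ₁ l = (Real.sqrt l)⁻¹)
    (h₁ : IsRadialPair a b κ p η₁ ηl₁ w₁ wl₁) (h₂ : IsRadialPair a b κ p η₂ ηl₂ w₂ wl₂)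
    {σ z : ℝ} (hσ : 0 < σ) {q : ℝ × ℝ} (hq1 : q.1 ∈ Icc a b) (hq2 : q.2 ∈ Icc a b)
    (hz1 : z + σ ^ 2 ≤ q.1) (hz2 : z + σ ^ 2 ≤ q.2) :
    HasDerivAt (pointForm η₁ η₂ w₁ w₂ q) ((q.1 - q.2) *
      (2 * (conj (cutDensity (fun l r => κ₁ l * w₁ l r) σ z q.1) *
        cutDerivDensity (fun l r => κ₁ l * w₂ l r)
          (fun l r => κ₁ l * (4 * κ l * Complex.I * p (l - r ^ 2) * η₂ l r)) σ z q.2).re)) z := by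
  have hσ2 : 0 < σ ^ 2 := by positivity
  refine (hasDerivAt_pointForm h₁ h₂ (by linarith) (by linarith) (ha.trans_le hq1.1)
    (ha.trans_le hq2.1) (hκs _ hq1) (hκs _ hq2)).congr_deriv ?_
  have hr2 : q.2 - Real.sqrt (q.2 - z) ^ 2 = z := by
    rw [Real.sq_sqrt (by linarith)]; ring
  rw [cutDensity, cutDerivDensity, cutRadius_of_le hz1, cutRadius_of_le hz2, hκ₁s _ hq1,
    hκ₁s _ hq2, hκs _ hq2, hr2, Complex.ofReal_inv, Complex.ofReal_inv]
  have c : ∀ x y : ℂ, x⁻¹ * y = y / x := fun x y => by rw [div_eq_mul_inv, mul_comm]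
  rw [c, c, c]

/-- Integrated from the axis to the cutoff, the kernel of the bracket is a difference of two
values of the invariant form, divided by `l₁ - l₂`. -/
lemma integral_cutKernel_eq (ha : 0 < a) (hκ : Continuous κ) (hp : Continuous p)
    (hκ₁ : ∀ l, HasDerivAt κ₁ (κ₁' l) l) (hκ₁' : Continuous κ₁')
    (hκs : ∀ l ∈ Icc a b, κ l = Real.sqrt l) (hκ₁s : ∀ l ∈ Icc a b, κ₁ l = (Real.sqrt l)⁻¹)
    (h₁ : IsRadialPair a b κ p η₁ ηl₁ w₁ wl₁) (h₂ : IsRadialPair a b κ p η₂ ηl₂ w₂ wl₂)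
    {σ R : ℝ} (hσ : 0 < σ) (hσa : σ ^ 2 ≤ a) (hbR : b ≤ R) {q : ℝ × ℝ}
    (hq : q ∈ Icc a b ×ˢ Icc a b) :
    (q.1 - q.2) * ∫ z in (0 : ℝ)..R, cutKernel (fun l r => κ₁ l * w₁ l r)
      (fun l r => κ₁ l * w₂ l r)
      (fun l r => κ₁ l * (4 * κ l * Complex.I * p (l - r ^ 2) * η₂ l r)) σ z q =
      pointForm η₁ η₂ w₁ w₂ q (min q.1 q.2 - σ ^ 2) - axisForm η₁ η₂ w₁ w₂ q := by
  obtain ⟨hq1, hq2⟩ := hq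
  have hσ2 : 0 < σ ^ 2 := by positivity
  have hma : a ≤ min q.1 q.2 := le_min hq1.1 hq2.1
  have hmR : min q.1 q.2 ≤ R := (min_le_left _ _).trans (hq1.2.trans hbR)
  have c1 := (continuous_cutDensity (h₁.isProfile hκ hp hκ₁ hκ₁') hσ).comp
    (Continuous.prodMk_left q.1)
  have c2 := (continuous_cutDerivDensity (h₂.isProfile hκ hp hκ₁ hκ₁') hσ).comp
    (Continuous.prodMk_left q.2)
  rw [integral_cutKernel_eq_integral (by linarith) (by linarith),
    ← intervalIntegral.integral_const_mul, ← pointForm_zero (ha.trans_le hq1.1) (ha.trans_le hq2.1)]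
  refine intervalIntegral.integral_eq_sub_of_hasDerivAt (fun z hz => ?_)
    (((continuous_const.mul (Complex.continuous_re.comp
      ((Complex.continuous_conj.comp c1).mul c2))).const_mul _).intervalIntegrable _ _)
  rw [uIcc_of_le (by linarith)] at hz
  exact hasDerivAt_pointForm_cut hκs ha hκ₁s h₁ h₂ hσ hq1 hq2
    (by linarith [hz.2, min_le_left q.1 q.2]) (by linarith [hz.2, min_le_right q.1 q.2])

/-- For `l₂ < l₁` the weight in the invariant form at the cutoff diverges as `σ → 0`. The boundary
term of the bracket replaces it by its inverse, which is bounded and tends to zero. -/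
lemma pointForm_sub_cutBoundary (ha : 0 < a) (hκ₁s : ∀ l ∈ Icc a b, κ₁ l = (Real.sqrt l)⁻¹)
    {σ : ℝ} (hσ : 0 < σ) {q : ℝ × ℝ} (hq : q ∈ Icc a b ×ˢ Icc a b) (hne : q.1 ≠ q.2) :
    pointForm η₁ η₂ w₁ w₂ q (min q.1 q.2 - σ ^ 2) - (q.1 - q.2) *
      cutBoundary (fun l r => κ₁ l * w₁ l r) (fun l r => κ₁ l * w₂ l r) σ q =
      if q.1 < q.2 then weightedForm η₁ η₂ w₁ w₂ σ q.1 q.2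
      else weightedForm η₂ η₁ w₂ w₁ σ q.2 q.1 := by
  obtain ⟨hq1, hq2⟩ := hq
  have hσ2 : 0 < σ ^ 2 := by positivity
  have s1 : 0 < Real.sqrt q.1 := Real.sqrt_pos.mpr (ha.trans_le hq1.1)
  have s2 : 0 < Real.sqrt q.2 := Real.sqrt_pos.mpr (ha.trans_le hq2.1)
  rcases lt_or_gt_of_ne hne with hlt | hgt
  · have hb : cutBoundary (fun l r => κ₁ l * w₁ l r) (fun l r => κ₁ l * w₂ l r) σ q = 0 :=
      indicator_of_notMem (s := {q : ℝ × ℝ | q.2 ≤ q.1}) (fun h => absurd h (not_le.mpr hlt)) _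
    rw [hb, if_pos hlt, min_eq_left hlt.le, pointForm, weightedForm, sub_sub_cancel,
      Real.sqrt_sq hσ.le, show q.2 - (q.1 - σ ^ 2) = q.2 - q.1 + σ ^ 2 by ring]
    ring
  · rw [cutBoundary, indicator_of_mem (show q ∈ {q : ℝ × ℝ | q.2 ≤ q.1} from hgt.le),
      if_neg (not_lt.mpr hgt.le), min_eq_right hgt.le, pointForm, weightedForm, sub_sub_cancel,
      Real.sqrt_sq hσ.le, cutDensity, cutRadius_of_le (by linarith),
      show q.1 - (q.2 - σ ^ 2) = q.1 - q.2 + σ ^ 2 by ring, hκ₁s _ hq1, hκ₁s _ hq2]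
    have r1 : 0 < Real.sqrt (q.1 - q.2 + σ ^ 2) := Real.sqrt_pos.mpr (by linarith)
    have e1 : q.1 - q.2 = Real.sqrt (q.1 - q.2 + σ ^ 2) ^ 2 - σ ^ 2 := by
      rw [Real.sq_sqrt (by linarith)]; ring
    have e2 : q.2 = Real.sqrt q.2 ^ 2 := (Real.sq_sqrt (ha.trans_le hq2.1).le).symm
    have e3 : Real.sqrt q.1 ^ 2 - Real.sqrt q.2 ^ 2 =
        Real.sqrt (q.1 - q.2 + σ ^ 2) ^ 2 - σ ^ 2 := by
      rw [← e1, Real.sq_sqrt (ha.trans_le hq1.1).le, ← e2]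
    set r := Real.sqrt (q.1 - q.2 + σ ^ 2)
    set x₁ := w₁ q.1 r
    set x₂ := w₂ q.2 σ
    have e4 : (conj ((((Real.sqrt q.1)⁻¹ : ℝ) : ℂ) * x₁ / r) *
        (((q.2 - σ ^ 2) / σ : ℝ) * ((((Real.sqrt q.2)⁻¹ : ℝ) : ℂ) * x₂))).re =
        (q.2 - σ ^ 2) / (Real.sqrt q.1 * r * σ * Real.sqrt q.2) * (conj x₁ * x₂).re := by
      rw [← Complex.re_ofReal_mul]
      congr 1
      push_cast
      simp only [map_div₀, map_mul, map_inv₀, Complex.conj_ofReal]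
      field_simp
    have e5 : (conj x₂ * x₁).re = (conj x₁ * x₂).re := by
      simp only [Complex.mul_re, Complex.conj_re, Complex.conj_im]; ring
    rw [e4, e5, e1]
    have e6 : q.2 - σ ^ 2 = Real.sqrt q.2 ^ 2 - σ ^ 2 := by rw [← e2]
    rw [e6]
    set t₁ := Real.sqrt q.1
    set t₂ := Real.sqrt q.2
    have e7 : t₂ * r / (t₁ * σ) - (r ^ 2 - σ ^ 2) * ((t₂ ^ 2 - σ ^ 2) / (t₁ * r * σ * t₂)) =
        t₁ * σ / (t₂ * r) := by
      have := hσ.ne'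
      have := r1.ne'
      have := s1.ne'
      have := s2.ne'
      field_simp
      linear_combination (-σ ^ 2) * e3
    linear_combination (2 * (conj x₁ * x₂).re) * e7

end Core

lemma setIntegral_box_symm {a b : ℝ} {f : ℝ × ℝ → ℝ}
    (hf : IntegrableOn f (Icc a b ×ˢ Icc a b)) :
    ∫ q in Icc a b ×ˢ Icc a b, f q =
      1 / 2 * ∫ q in Icc a b ×ˢ Icc a b, (f q + f q.swap) := by
  have hbox : (volume.restrict (Icc a b ×ˢ Icc a b) : Measure (ℝ × ℝ)) =
      (volume.restrict (Icc a b)).prod (volume.restrict (Icc a b)) := by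
    rw [Measure.prod_restrict]; rfl
  rw [IntegrableOn, hbox] at hf
  have hs : Integrable (fun q : ℝ × ℝ => f q.swap)
    ((volume.restrict (Icc a b)).prod (volume.restrict (Icc a b))) := hf.swap
  rw [hbox, integral_add hf hs, integral_prod_swap]
  ring

section Limit

variable {a b : ℝ} {κ κ₁ κ₁' : ℝ → ℝ} {p : ℝ → ℂ} {η₁ ηl₁ η₂ ηl₂ : ℝ → ℝ → ℝ}
  {w₁ wl₁ w₂ wl₂ : ℝ → ℝ → ℂ}

/-- The contribution of the cutoff to the symmetrized integrand. -/
def cutDefect (η₁ η₂ : ℝ → ℝ → ℝ) (w₁ w₂ : ℝ → ℝ → ℂ) (σ : ℝ) (q : ℝ × ℝ) : ℝ :=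
  weightedForm η₁ η₂ w₁ w₂ σ (min q.1 q.2) (max q.1 q.2) -
    weightedForm η₂ η₁ w₂ w₁ σ (min q.1 q.2) (max q.1 q.2)

lemma weightedForm_sqrt {l l' : ℝ} (hl : 0 < l) (hl' : 0 < l') :
    weightedForm η₁ η₂ w₁ w₂ (Real.sqrt l) l l' = axisForm η₁ η₂ w₁ w₂ (l, l') := by
  have s1 : 0 < Real.sqrt l := Real.sqrt_pos.mpr hl
  have s2 : 0 < Real.sqrt l' := Real.sqrt_pos.mpr hl'
  have : Real.sqrt l' * Real.sqrt l / (Real.sqrt l * Real.sqrt l') = 1 := by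
    rw [mul_comm]; exact div_self (mul_pos s1 s2).ne'
  rw [weightedForm, Real.sq_sqrt hl.le, sub_add_cancel, this, one_mul]
  rfl

lemma axisForm_swap (q : ℝ × ℝ) :
    axisForm η₁ η₂ w₁ w₂ q.swap = axisForm η₂ η₁ w₂ w₁ q := by
  simp only [axisForm, Prod.fst_swap, Prod.snd_swap, Complex.mul_re, Complex.conj_re,
    Complex.conj_im]
  ring

/-- The axis is the point `z = l - σ²` with `σ = √l`, where the weight is `1`, so that this is an
instance of the estimate of the weighted form. -/
lemma exists_axisForm_sub_swap_le (ha : 0 < a) (hκ : Continuous κ) (hp : Continuous p)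
    (h₁ : IsRadialPair a b κ p η₁ ηl₁ w₁ wl₁) (h₂ : IsRadialPair a b κ p η₂ ηl₂ w₂ wl₂) :
    ∃ L, ∀ q, |axisForm η₁ η₂ w₁ w₂ q - axisForm η₁ η₂ w₁ w₂ q.swap| ≤ L * |q.1 - q.2| := by
  obtain ⟨L, hL⟩ := abs_weightedForm_sub_le ha hκ hp h₁ h₂ (Real.sqrt b)
  refine ⟨max L 0, fun q => ?_⟩
  have h0 : 0 ≤ max L 0 * |q.1 - q.2| := mul_nonneg (le_max_right _ _) (abs_nonneg _)
  by_cases hq1 : q.1 ∈ Icc a b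
  · by_cases hq2 : q.2 ∈ Icc a b
    · have key : ∀ l ∈ Icc a b, ∀ l' ∈ Icc a b, l ≤ l' →
          |axisForm η₁ η₂ w₁ w₂ (l, l') - axisForm η₁ η₂ w₁ w₂ (l', l)| ≤ max L 0 * (l' - l) := by
        intro l hl l' hl' hll
        have l0 := ha.trans_le hl.1
        have l0' := ha.trans_le hl'.1
        have := hL l hl l' hl' hll (Real.sqrt l) (Real.sqrt_pos.mpr l0) (Real.sqrt_le_sqrt hl.2)
        have e : axisForm η₂ η₁ w₂ w₁ (l, l') = axisForm η₁ η₂ w₁ w₂ (l', l) :=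
          (axisForm_swap (l, l')).symm
        rw [weightedForm_sqrt l0 l0', weightedForm_sqrt l0 l0', e] at this
        exact this.trans (mul_le_mul_of_nonneg_right (le_max_left _ _) (by linarith))
      rcases le_total q.1 q.2 with hle | hle
      · have := key _ hq1 _ hq2 hle
        rwa [abs_sub_comm q.1, abs_of_nonneg (sub_nonneg.mpr hle)]
      · have := key _ hq2 _ hq1 hle
        rw [abs_sub_comm] at this
        rwa [abs_of_nonneg (sub_nonneg.mpr hle)]
    · simp only [axisForm, Prod.fst_swap, Prod.snd_swap, h₁.eta_supp _ hq2, h₂.eta_supp _ hq2,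
        h₁.omega_supp _ hq2, h₂.omega_supp _ hq2]
      simpa using h0
  · simp only [axisForm, Prod.fst_swap, Prod.snd_swap, h₁.eta_supp _ hq1, h₂.eta_supp _ hq1,
      h₁.omega_supp _ hq1, h₂.omega_supp _ hq1]
    simpa using h0

/-- For `σ → 0` the weighted form vanishes off the diagonal: the `𝔥` components vanish at `l = z`,
and so does the weight of the `𝔨` components. -/
lemma tendsto_weightedForm (h₁ : IsRadialPair a b κ p η₁ ηl₁ w₁ wl₁)
    (h₂ : IsRadialPair a b κ p η₂ ηl₂ w₂ wl₂) {l l' : ℝ} (hl : 0 < l) (hll : l < l') :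
    Tendsto (fun σ => weightedForm η₁ η₂ w₁ w₂ σ l l') (𝓝[>] 0) (𝓝 0) := by
  have hs : Continuous fun σ : ℝ => Real.sqrt (l' - l + σ ^ 2) := by fun_prop
  have hs0 : Real.sqrt (l' - l + 0 ^ 2) ≠ 0 := by
    rw [Real.sqrt_ne_zero (by nlinarith)]; nlinarith
  have hl0 : Real.sqrt l ≠ 0 := (Real.sqrt_pos.mpr hl).ne'
  have c1 : Continuous fun σ => η₁ l σ := h₁.cont_eta.comp (Continuous.prodMk_right l)
  have c2 : Continuous fun σ => w₁ l σ := h₁.cont_omega.comp (Continuous.prodMk_right l)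
  have c3 : Continuous fun σ : ℝ => η₂ l' (Real.sqrt (l' - l + σ ^ 2)) :=
    h₂.cont_eta.comp (continuous_const.prodMk hs)
  have c4 : Continuous fun σ : ℝ => w₂ l' (Real.sqrt (l' - l + σ ^ 2)) :=
    h₂.cont_omega.comp (continuous_const.prodMk hs)
  have hc : ContinuousAt (fun σ => weightedForm η₁ η₂ w₁ w₂ σ l l') 0 := by
    have k1 : ContinuousAt (fun σ => Real.sqrt l' * σ / (Real.sqrt l *
        Real.sqrt (l' - l + σ ^ 2))) 0 :=
      ContinuousAt.div (by fun_prop) (by fun_prop) (mul_ne_zero hl0 hs0)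
    exact ((continuous_const.mul c1).mul c3).continuousAt.add (k1.mul
      (continuous_const.mul (Complex.continuous_re.comp
        ((Complex.continuous_conj.comp c2).mul c4))).continuousAt)
  have h0 : weightedForm η₁ η₂ w₁ w₂ 0 l l' = 0 := by simp [weightedForm, h₁.eta_zero]
  have := hc.tendsto
  rw [h0] at this
  exact this.mono_left nhdsWithin_le_nhds

/-- The symmetrized integrand of the bracket with cutoff, `E` being the integrand itself: its limit
and the contribution of the cutoff. -/
lemma neg_integral_cutKernel_add_swap (ha : 0 < a) (hκ : Continuous κ) (hp : Continuous p)
    (hκ₁ : ∀ l, HasDerivAt κ₁ (κ₁' l) l) (hκ₁' : Continuous κ₁')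
    (hκs : ∀ l ∈ Icc a b, κ l = Real.sqrt l) (hκ₁s : ∀ l ∈ Icc a b, κ₁ l = (Real.sqrt l)⁻¹)
    (h₁ : IsRadialPair a b κ p η₁ ηl₁ w₁ wl₁) (h₂ : IsRadialPair a b κ p η₂ ηl₂ w₂ wl₂)
    {σ R : ℝ} (hσ : 0 < σ) (hσa : σ ^ 2 ≤ a) (hbR : b ≤ R) {q : ℝ × ℝ}
    (hq : q ∈ Icc a b ×ˢ Icc a b) (hne : q.1 ≠ q.2) {E : ℝ × ℝ → ℝ}
    (hE : E = fun q => cutBoundary (fun l r => κ₁ l * w₁ l r) (fun l r => κ₁ l * w₂ l r) σ q -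
      ∫ z in (0 : ℝ)..R, cutKernel (fun l r => κ₁ l * w₁ l r) (fun l r => κ₁ l * w₂ l r)
        (fun l r => κ₁ l * (4 * κ l * Complex.I * p (l - r ^ 2) * η₂ l r)) σ z q) :
    E q + E q.swap = (axisForm η₁ η₂ w₁ w₂ q - axisForm η₁ η₂ w₁ w₂ q.swap) / (q.1 - q.2) +
      cutDefect η₁ η₂ w₁ w₂ σ q / |q.1 - q.2| := by
  have key : ∀ q ∈ Icc a b ×ˢ Icc a b, q.1 ≠ q.2 → (q.1 - q.2) * E q =
      axisForm η₁ η₂ w₁ w₂ q - if q.1 < q.2 then weightedForm η₁ η₂ w₁ w₂ σ q.1 q.2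
        else weightedForm η₂ η₁ w₂ w₁ σ q.2 q.1 := by
    intro q hq hne
    rw [← pointForm_sub_cutBoundary ha hκ₁s hσ hq hne, hE]
    have := integral_cutKernel_eq ha hκ hp hκ₁ hκ₁' hκs hκ₁s h₁ h₂ hσ hσa hbR hq
    linear_combination -this
  have k1 := key q hq hne
  have k2 := key q.swap ⟨hq.2, hq.1⟩ hne.symm
  simp only [Prod.fst_swap, Prod.snd_swap] at k2
  have hd : q.1 - q.2 ≠ 0 := sub_ne_zero.mpr hne
  rcases lt_or_gt_of_ne hne with hlt | hgt
  · rw [if_pos hlt] at k1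
    rw [if_neg (not_lt.mpr hlt.le)] at k2
    rw [abs_of_neg (sub_neg.mpr hlt), cutDefect, min_eq_left hlt.le, max_eq_right hlt.le, div_neg,
      ← sub_eq_add_neg, ← sub_div, eq_div_iff hd]
    linear_combination k1 - k2
  · rw [if_neg (not_lt.mpr hgt.le)] at k1
    rw [if_pos hgt] at k2
    rw [abs_of_pos (sub_pos.mpr hgt), cutDefect, min_eq_right hgt.le, max_eq_left hgt.le,
      ← add_div, eq_div_iff hd]
    linear_combination k1 - k2

lemma continuous_abelCut_cutoff {F Fl Fr : ℝ → ℝ → ℂ} (h : IsProfile a b F Fl Fr) (M : ℝ) :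
    Continuous fun x : ℝ × ℝ => abelCut F x.1 M x.2 := by
  have e : ∀ x : ℝ × ℝ, abelCut F x.1 M x.2 = -2 * ∫ r in M..x.1, F (x.2 + r ^ 2) r := fun x => by
    rw [abelCut, intervalIntegral.integral_symm]; ring
  simp only [e]
  refine continuous_const.mul (intervalIntegral.continuous_parametric_intervalIntegral_of_continuous
    (f := fun (x : ℝ × ℝ) r => F (x.2 + r ^ 2) r) ?_ continuous_fst)
  exact h.continuous.comp (by fun_prop :
    Continuous fun y : (ℝ × ℝ) × ℝ => (y.1.2 + y.2 ^ 2, y.2))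

/-- The bracket of two Abel transforms is the symmetrized integral of the invariant form of the
sections against `1 / (l₁ - l₂)`. -/
theorem neg_integral_abel_bracket (ha : 0 < a) (hab : a ≤ b) (hκ : Continuous κ)
    (hp : Continuous p)
    (hκ₁ : ∀ l, HasDerivAt κ₁ (κ₁' l) l) (hκ₁' : Continuous κ₁')
    (hκs : ∀ l ∈ Icc a b, κ l = Real.sqrt l) (hκ₁s : ∀ l ∈ Icc a b, κ₁ l = (Real.sqrt l)⁻¹)
    (h₁ : IsRadialPair a b κ p η₁ ηl₁ w₁ wl₁) (h₂ : IsRadialPair a b κ p η₂ ηl₂ w₂ wl₂)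
    {R : ℝ} (hbR : b ≤ R) :
    -∫ z in (0 : ℝ)..R, 2 * (conj (abelCut (fun l r => κ₁ l * w₁ l r) 0 (Real.sqrt R) z) *
        (z * abelCut (fun l r => κ₁' l * w₂ l r + κ₁ l * wl₂ l r) 0 (Real.sqrt R) z +
          1 / 2 * abelCut (fun l r => κ₁ l * w₂ l r) 0 (Real.sqrt R) z)).re =
      1 / 2 * ∫ q in Icc a b ×ˢ Icc a b,
        (axisForm η₁ η₂ w₁ w₂ q - axisForm η₁ η₂ w₁ w₂ q.swap) / (q.1 - q.2) := by
  have hR0 : 0 ≤ R := by linarith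
  have p₁ := h₁.isProfile hκ hp hκ₁ hκ₁'
  have p₂ := h₂.isProfile hκ hp hκ₁ hκ₁'
  set F₁ : ℝ → ℝ → ℂ := fun l r => κ₁ l * w₁ l r with hF₁
  set F₂ : ℝ → ℝ → ℂ := fun l r => κ₁ l * w₂ l r with hF₂
  set Fl₂ : ℝ → ℝ → ℂ := fun l r => κ₁' l * w₂ l r + κ₁ l * wl₂ l r with hFl₂
  set Fr₂ : ℝ → ℝ → ℂ := fun l r => κ₁ l * (4 * κ l * Complex.I * p (l - r ^ 2) * η₂ l r) with hFr₂
  -- The bracket with cutoff `σ`. It is continuous up to `σ = 0`.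
  set I : ℝ → ℝ := fun σ => -∫ z in (0 : ℝ)..R, 2 * (conj (abelCut F₁ σ (Real.sqrt R) z) *
    (z * abelCut Fl₂ σ (Real.sqrt R) z + 1 / 2 * abelCut F₂ σ (Real.sqrt R) z)).re with hI
  have hIc : Continuous I := by
    have cl : Continuous fun x : ℝ × ℝ => abelCut Fl₂ x.1 (Real.sqrt R) x.2 := by
      have e : ∀ x : ℝ × ℝ, abelCut Fl₂ x.1 (Real.sqrt R) x.2 =
          -2 * ∫ r in (Real.sqrt R)..x.1, Fl₂ (x.2 + r ^ 2) r := fun x => by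
        rw [abelCut, intervalIntegral.integral_symm]; ring
      simp only [e]
      exact continuous_const.mul
        (intervalIntegral.continuous_parametric_intervalIntegral_of_continuous
          (f := fun (x : ℝ × ℝ) r => Fl₂ (x.2 + r ^ 2) r)
          (p₂.continuous_l.comp (by fun_prop :
            Continuous fun y : (ℝ × ℝ) × ℝ => (y.1.2 + y.2 ^ 2, y.2))) continuous_fst)
    refine (intervalIntegral.continuous_parametric_intervalIntegral_of_continuous'
      (f := fun σ z => 2 * (conj (abelCut F₁ σ (Real.sqrt R) z) *
        (z * abelCut Fl₂ σ (Real.sqrt R) z + 1 / 2 * abelCut F₂ σ (Real.sqrt R) z)).re) ?_ _ _).neg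
    exact continuous_const.mul (Complex.continuous_re.comp ((Complex.continuous_conj.comp
      (continuous_abelCut_cutoff p₁ _)).mul
      (((Complex.continuous_ofReal.comp continuous_snd).mul cl).add
        (continuous_const.mul (continuous_abelCut_cutoff p₂ _)))))
  have t1 : Tendsto I (𝓝[>] 0) (𝓝 (I 0)) := hIc.continuousAt.tendsto.mono_left nhdsWithin_le_nhds
  obtain ⟨L, hL⟩ := exists_axisForm_sub_swap_le ha hκ hp h₁ h₂
  obtain ⟨L', hL'⟩ := abs_weightedForm_sub_le ha hκ hp h₁ h₂ (Real.sqrt a)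
  -- For `σ > 0` the bracket is also the integral of `E σ` over the square. After symmetrization the
  -- integrand is bounded uniformly in `σ`, and converges off the diagonal, which is a null set.
  set E : ℝ → ℝ × ℝ → ℝ := fun σ q => cutBoundary F₁ F₂ σ q -
    ∫ z in (0 : ℝ)..R, cutKernel F₁ F₂ Fr₂ σ z q with hE
  have hev : ∀ᶠ σ : ℝ in 𝓝[>] 0, 0 < σ ∧ σ ≤ Real.sqrt a := by
    filter_upwards [Ioc_mem_nhdsGT (Real.sqrt_pos.mpr ha)] with σ hσ using hσ
  have hEi : ∀ σ, 0 < σ → IntegrableOn (E σ) (Icc a b ×ˢ Icc a b) := fun σ hσ =>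
    (integrable_cutBoundary p₁ p₂ hσ).sub (integrable_integral_cutKernel p₁ p₂ hσ hR0)
  have hIE : ∀ᶠ σ : ℝ in 𝓝[>] 0, I σ =
      1 / 2 * ∫ q in Icc a b ×ˢ Icc a b, (E σ q + E σ q.swap) := by
    filter_upwards [hev] with σ hσ
    have hσa : σ ^ 2 ≤ a := by
      rw [← Real.sq_sqrt ha.le]; exact pow_le_pow_left₀ hσ.1.le hσ.2 2
    rw [← setIntegral_box_symm (hEi σ hσ.1), hI, hE]
    simp only
    rw [cutBracket_eq p₁ p₂ hσ.1 hσa hab hbR, integral_sub (integrable_cutBoundary p₁ p₂ hσ.1)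
      (integrable_integral_cutKernel p₁ p₂ hσ.1 hR0)]
    ring
  have hdiag : ∀ᵐ q : ℝ × ℝ ∂(volume.restrict (Icc a b ×ˢ Icc a b)), q.1 ≠ q.2 := by
    refine ae_restrict_of_ae ?_
    have hm : MeasurableSet {q : ℝ × ℝ | q.1 ≠ q.2} :=
      (isClosed_eq continuous_fst continuous_snd).measurableSet.compl
    rw [Measure.volume_eq_prod, Measure.ae_prod_iff_ae_ae hm]
    refine ae_of_all _ fun x => ?_
    simp [ae_iff]
  have hbox : MeasurableSet (Icc a b ×ˢ Icc a b : Set (ℝ × ℝ)) :=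
    measurableSet_Icc.prod measurableSet_Icc
  have hEeq : ∀ σ, 0 < σ → σ ≤ Real.sqrt a → ∀ q ∈ Icc a b ×ˢ Icc a b, q.1 ≠ q.2 →
      E σ q + E σ q.swap =
        (axisForm η₁ η₂ w₁ w₂ q - axisForm η₁ η₂ w₁ w₂ q.swap) / (q.1 - q.2) +
        cutDefect η₁ η₂ w₁ w₂ σ q / |q.1 - q.2| := fun σ hσ hσa q hq hne =>
    neg_integral_cutKernel_add_swap ha hκ hp hκ₁ hκ₁' hκs hκ₁s h₁ h₂ hσ
      (by rw [← Real.sq_sqrt ha.le]; exact pow_le_pow_left₀ hσ.le hσa 2) hbR hq hne rfl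
  have hdef : ∀ σ, 0 < σ → σ ≤ Real.sqrt a → ∀ q ∈ Icc a b ×ˢ Icc a b,
      |cutDefect η₁ η₂ w₁ w₂ σ q| ≤ L' * |q.1 - q.2| := by
    intro σ hσ hσa q hq
    have := hL' (min q.1 q.2) ⟨le_min hq.1.1 hq.2.1, (min_le_left _ _).trans hq.1.2⟩ (max q.1 q.2)
      ⟨hq.1.1.trans (le_max_left _ _), max_le hq.1.2 hq.2.2⟩ min_le_max σ hσ hσa
    rwa [max_sub_min_eq_abs'] at this
  have t2 : Tendsto (fun σ => ∫ q in Icc a b ×ˢ Icc a b, (E σ q + E σ q.swap)) (𝓝[>] 0)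
      (𝓝 (∫ q in Icc a b ×ˢ Icc a b,
        (axisForm η₁ η₂ w₁ w₂ q - axisForm η₁ η₂ w₁ w₂ q.swap) / (q.1 - q.2))) := by
    refine tendsto_integral_filter_of_dominated_convergence (fun _ => L + L') ?_ ?_ ?_ ?_
    · filter_upwards [hev] with σ hσ
      have h := hEi σ hσ.1
      have hb : (volume.restrict (Icc a b ×ˢ Icc a b) : Measure (ℝ × ℝ)) =
          (volume.restrict (Icc a b)).prod (volume.restrict (Icc a b)) := by
        rw [Measure.prod_restrict]; rfl
      rw [IntegrableOn, hb] at h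
      have hs : Integrable (fun q : ℝ × ℝ => E σ q.swap)
        ((volume.restrict (Icc a b)).prod (volume.restrict (Icc a b))) := h.swap
      rw [hb]
      exact (h.add hs).aestronglyMeasurable
    · filter_upwards [hev] with σ hσ
      filter_upwards [hdiag, ae_restrict_mem hbox] with q hne hq
      have hd : 0 < |q.1 - q.2| := abs_pos.mpr (sub_ne_zero.mpr hne)
      rw [hEeq σ hσ.1 hσ.2 q hq hne]
      refine (norm_add_le _ _).trans (add_le_add ?_ ?_)
      · rw [norm_div, Real.norm_eq_abs, Real.norm_eq_abs, div_le_iff₀ hd]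
        exact hL q
      · rw [norm_div, Real.norm_eq_abs, Real.norm_eq_abs, abs_abs, div_le_iff₀ hd]
        exact hdef σ hσ.1 hσ.2 q hq
    · have : IsFiniteMeasure (volume.restrict (Icc a b ×ˢ Icc a b) : Measure (ℝ × ℝ)) :=
        isFiniteMeasure_restrict.mpr (isCompact_Icc.prod isCompact_Icc).measure_lt_top.ne
      exact integrable_const _
    · filter_upwards [hdiag, ae_restrict_mem hbox] with q hne hq
      have hlt : min q.1 q.2 < max q.1 q.2 := min_lt_max.mpr hne
      have h0 : 0 < min q.1 q.2 := lt_min (ha.trans_le hq.1.1) (ha.trans_le hq.2.1)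
      have k := ((tendsto_weightedForm h₁ h₂ h0 hlt).sub
        (tendsto_weightedForm h₂ h₁ h0 hlt)).div_const |q.1 - q.2|
      have k' := k.const_add
        ((axisForm η₁ η₂ w₁ w₂ q - axisForm η₁ η₂ w₁ w₂ q.swap) / (q.1 - q.2))
      rw [sub_zero, zero_div, add_zero] at k'
      refine k'.congr' ?_
      filter_upwards [hev] with σ hσ
      exact (hEeq σ hσ.1 hσ.2 q hq hne).symm
  exact tendsto_nhds_unique t1 ((t2.const_mul (1 / 2)).congr' (hIE.mono fun σ h => h.symm))

end Limit

/-! ### Components of `2 × 2` matrices -/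

/-- The generator of the rotations. -/
def hMat : Mat2 := !![0, 1; -1, 0]

/-- The symmetric trace free matrix with complex component `w`. -/
def kMat (w : ℂ) : Mat2 := !![w.re, w.im; w.im, -w.re]

/-- The component of a matrix along `hMat`. -/
def hComp (M : Mat2) : ℝ := (M 0 1 - M 1 0) / 2

/-- The complex component of the symmetric trace free part of a matrix. -/
def wComp (M : Mat2) : ℂ :=
  (((M 0 0 - M 1 1) / 2 : ℝ) : ℂ) + (((M 0 1 + M 1 0) / 2 : ℝ) : ℂ) * Complex.I

@[simp] lemma wComp_re (M : Mat2) : (wComp M).re = (M 0 0 - M 1 1) / 2 := by simp [wComp]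

@[simp] lemma wComp_im (M : Mat2) : (wComp M).im = (M 0 1 + M 1 0) / 2 := by simp [wComp]

lemma hComp_add (M N : Mat2) : hComp (M + N) = hComp M + hComp N := by
  simp only [hComp, Matrix.add_apply]; ring

lemma wComp_add (M N : Mat2) : wComp (M + N) = wComp M + wComp N := by
  simp only [wComp, Matrix.add_apply]; push_cast; ring

lemma trace_mul_eq (M N : Mat2) : (M * N).trace =
    1 / 2 * M.trace * N.trace + 2 * (conj (wComp M) * wComp N).re - 2 * hComp M * hComp N := by
  simp only [Matrix.trace_fin_two, Matrix.mul_apply, Fin.sum_univ_two, hComp, Complex.mul_re,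
    Complex.conj_re, Complex.conj_im, wComp_re, wComp_im]
  ring

lemma eq_of_components {M : Mat2} (h : M.trace = 0) :
    M = hComp M • hMat + kMat (wComp M) := by
  rw [Matrix.trace_fin_two] at h
  ext i j
  fin_cases i <;> fin_cases j <;> simp [hMat, kMat, hComp] <;> linarith

lemma comb_apply (s t : ℝ) (p : ℂ) (i j : Fin 2) : (s • hMat + t • kMat p) i j =
    !![t * p.re, s + t * p.im; -s + t * p.im, -(t * p.re)] i j := by
  fin_cases i <;> fin_cases j <;> simp [hMat, kMat]

lemma hComp_commutator (s t : ℝ) (p : ℂ) (X : Mat2) :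
    hComp ((s • hMat + t • kMat p) * X - X * (s • hMat + t • kMat p)) =
      2 * t * (conj p * wComp X).im := by
  simp [hComp, Matrix.sub_apply, Matrix.mul_apply, Fin.sum_univ_two, comb_apply,
    -Matrix.add_apply,
    Complex.mul_im, Complex.conj_re, Complex.conj_im, wComp_re, wComp_im]
  ring

lemma wComp_commutator (s t : ℝ) (p : ℂ) (X : Mat2) :
    wComp ((s • hMat + t • kMat p) * X - X * (s • hMat + t • kMat p)) =
      -2 * Complex.I * s * wComp X + 2 * t * Complex.I * p * hComp X := by
  apply Complex.ext <;>
  simp [hComp, Matrix.sub_apply, Matrix.mul_apply, Fin.sum_univ_two, comb_apply,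
    -Matrix.add_apply] <;> ring

lemma hComp_comb (s t : ℝ) (p : ℂ) : hComp (s • hMat + t • kMat p) = s := by
  simp [hComp, hMat, kMat]

lemma wComp_comb (s t : ℝ) (p : ℂ) : wComp (s • hMat + t • kMat p) = t * p := by
  apply Complex.ext
  · simp [hMat, kMat]
  · simp only [wComp_im, comb_apply]
    simp
    ring

lemma trace_comb (s t : ℝ) (p : ℂ) : (s • hMat + t • kMat p).trace = 0 := by
  simp [Matrix.trace_fin_two, hMat, kMat]

lemma hComp_eq_zero_of_symm {M : Mat2} (h : Mᵀ = M) : hComp M = 0 := by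
  have := congr_fun (congr_fun h 0) 1
  rw [Matrix.transpose_apply] at this
  rw [hComp, this]; ring

lemma hasDerivAt_hComp {f : ℝ → Mat2} {f' : Mat2} {x : ℝ} (h : HasDerivAt f f' x) :
    HasDerivAt (fun x => hComp (f x)) (hComp f') x := by
  have h := hasDerivAt_mat2_iff.mp h
  exact ((h 0 1).sub (h 1 0)).div_const 2

lemma hasDerivAt_wComp {f : ℝ → Mat2} {f' : Mat2} {x : ℝ} (h : HasDerivAt f f' x) :
    HasDerivAt (fun x => wComp (f x)) (wComp f') x := by
  have h := hasDerivAt_mat2_iff.mp h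
  exact (((h 0 0).sub (h 1 1)).div_const 2).ofReal_comp.add
    ((((h 0 1).add (h 1 0)).div_const 2).ofReal_comp.mul_const _)

lemma continuous_hComp {X : Type*} [TopologicalSpace X] {f : X → Mat2} (h : Continuous f) :
    Continuous fun x => hComp (f x) := by
  have h := continuous_mat2_iff.mp h
  exact ((h 0 1).sub (h 1 0)).div_const 2

lemma continuous_wComp {X : Type*} [TopologicalSpace X] {f : X → Mat2} (h : Continuous f) :
    Continuous fun x => wComp (f x) := by
  have h := continuous_mat2_iff.mp h
  exact (Complex.continuous_ofReal.comp (((h 0 0).sub (h 1 1)).div_const 2)).add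
    ((Complex.continuous_ofReal.comp (((h 0 1).add (h 1 0)).div_const 2)).mul continuous_const)

lemma continuous_kMat {X : Type*} [TopologicalSpace X] {f : X → ℂ} (h : Continuous f) :
    Continuous fun x => kMat (f x) := by
  have h1 := Complex.continuous_re.comp h
  have h2 := Complex.continuous_im.comp h
  refine continuous_mat2_iff.mpr fun i j => ?_
  fin_cases i <;> fin_cases j <;> first | exact h1 | exact h2 | exact h1.neg

lemma hasDerivAt_kMat {f : ℝ → ℂ} {f' : ℂ} {x : ℝ} (h : HasDerivAt f f' x) :
    HasDerivAt (fun x => kMat (f x)) (kMat f') x := by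
  have h1 : HasDerivAt (fun x => (f x).re) f'.re x := Complex.reCLM.hasFDerivAt.comp_hasDerivAt x h
  have h2 : HasDerivAt (fun x => (f x).im) f'.im x := Complex.imCLM.hasFDerivAt.comp_hasDerivAt x h
  refine hasDerivAt_mat2_iff.mpr fun i j => ?_
  fin_cases i <;> fin_cases j <;>
    first | exact h1 | exact h2 | exact h1.neg

lemma hasDerivAt_adjugate {f : ℝ → Mat2} {f' : Mat2} {x : ℝ} (h : HasDerivAt f f' x) :
    HasDerivAt (fun x => (f x).adjugate) f'.adjugate x := by
  have h := hasDerivAt_mat2_iff.mp h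
  refine hasDerivAt_mat2_iff.mpr fun i j => ?_
  fin_cases i <;> fin_cases j <;> simp only [Matrix.adjugate_fin_two] <;>
    first | exact h 0 0 | exact h 1 1 | exact (h 0 1).neg | exact (h 1 0).neg

/-! ### The deformed connection in the radial coordinate -/

/-- The deformed connection in the coordinate `r = √(l - z)`, with components `q` and `p` of the
undeformed connection. It is regular at `r = 0`. The weight `κ` is `√l` where it matters. -/
def radialConn (κ q : ℝ → ℝ) (p : ℝ → ℂ) (l r : ℝ) : Mat2 :=
  (2 * r * q (l - r ^ 2)) • hMat + (2 * κ l) • kMat (p (l - r ^ 2))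

/-- The fundamental solution of the linear equation of the deformed connection, normalized at
`r = 0`, with its derivative with respect to the deformation parameter. -/
structure IsRadialSolution (κ q : ℝ → ℝ) (p : ℝ → ℂ) (S S' : ℝ → ℝ → Mat2) : Prop where
  cont : Continuous fun x : ℝ × ℝ => S x.1 x.2
  cont' : Continuous fun x : ℝ × ℝ => S' x.1 x.2
  zero : ∀ l, S l 0 = 1
  det : ∀ l r, (S l r).det = 1
  deriv_r : ∀ l r, HasDerivAt (S l) (radialConn κ q p l r * S l r) r
  deriv_l : ∀ l r, HasDerivAt (fun l => S l r) (S' l r) l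

variable {κ κ' q q' θ : ℝ → ℝ} {p p' : ℝ → ℂ}

lemma trace_radialConn (l r : ℝ) : (radialConn κ q p l r).trace = 0 := trace_comb _ _ _

lemma continuous_radialConn (hκ : Continuous κ) (hq : Continuous q) (hp : Continuous p) :
    Continuous fun x : ℝ × ℝ => radialConn κ q p x.1 x.2 := by
  have h1 : Continuous fun x : ℝ × ℝ => 2 * x.2 * q (x.1 - x.2 ^ 2) :=
    (continuous_const.mul continuous_snd).mul (hq.comp (by fun_prop))
  have h2 : Continuous fun x : ℝ × ℝ => 2 * κ x.1 :=
    continuous_const.mul (hκ.comp continuous_fst)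
  exact (h1.smul continuous_const).add (h2.smul (continuous_kMat (hp.comp (by fun_prop))))

lemma exists_radialSolution (hκ : ∀ l, HasDerivAt κ (κ' l) l) (hκ' : Continuous κ')
    (hq : ∀ z, HasDerivAt q (q' z) z) (hq' : Continuous q')
    (hp : ∀ z, HasDerivAt p (p' z) z) (hp' : Continuous p') :
    ∃ S S', IsRadialSolution κ q p S S' := by
  have cκ : Continuous κ := continuous_iff_continuousAt.mpr fun l => (hκ l).continuousAt
  have cq : Continuous q := continuous_iff_continuousAt.mpr fun l => (hq l).continuousAt
  have cp : Continuous p := continuous_iff_continuousAt.mpr fun l => (hp l).continuousAt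
  have hm : Continuous fun x : Unit × ℝ × ℝ => (x.2.1, x.2.2) := by fun_prop
  obtain ⟨S, S', h1, h2, h3, h4, h5, h6, -⟩ := exists_param_ode (Y := Unit)
    (A := fun _ l r => radialConn κ q p l r)
    (A' := fun _ l r => (2 * r * q' (l - r ^ 2)) • hMat +
      ((2 * κ l) • kMat (p' (l - r ^ 2)) + (2 * κ' l) • kMat (p (l - r ^ 2))))
    ((continuous_radialConn cκ cq cp).comp hm) (by
      have k1 : Continuous fun x : ℝ × ℝ => 2 * x.2 * q' (x.1 - x.2 ^ 2) :=
        (continuous_const.mul continuous_snd).mul (hq'.comp (by fun_prop))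
      have k2 : Continuous fun x : ℝ × ℝ => 2 * κ x.1 :=
        continuous_const.mul (cκ.comp continuous_fst)
      have k3 : Continuous fun x : ℝ × ℝ => 2 * κ' x.1 :=
        continuous_const.mul (hκ'.comp continuous_fst)
      have k4 : Continuous fun x : ℝ × ℝ => p' (x.1 - x.2 ^ 2) := hp'.comp (by fun_prop)
      have k5 : Continuous fun x : ℝ × ℝ => p (x.1 - x.2 ^ 2) := cp.comp (by fun_prop)
      exact ((k1.smul continuous_const).add ((k2.smul (continuous_kMat k4)).add
        (k3.smul (continuous_kMat k5)))).comp hm)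
    (fun _ l r => by
      have d : HasDerivAt (fun l : ℝ => l - r ^ 2) 1 l := (hasDerivAt_id l).sub_const _
      have d1 : HasDerivAt (fun l => q (l - r ^ 2)) (q' (l - r ^ 2)) l := by
        simpa [Function.comp_def] using (hq (l - r ^ 2)).comp l d
      have d2 : HasDerivAt (fun l => p (l - r ^ 2)) (p' (l - r ^ 2)) l := by
        simpa [Function.comp_def] using (hp (l - r ^ 2)).scomp l d
      exact ((d1.const_mul (2 * r)).smul_const hMat).add
        (((hκ l).const_mul 2).smul (hasDerivAt_kMat d2)))
    (fun _ l r => trace_radialConn l r)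
  have hm' : Continuous fun x : ℝ × ℝ => (((), x.1, x.2) : Unit × ℝ × ℝ) := by fun_prop
  exact ⟨S (), S' (), h1.comp hm', h2.comp hm', h3 (), h4 (), h5 (), h6 ()⟩

/-- The section of the adjoint bundle with value `φ l` at the point `z = l`. -/
def adjointSection (S : ℝ → ℝ → Mat2) (φ : ℝ → Mat2) (l r : ℝ) : Mat2 :=
  S l r * φ l * (S l r).adjugate

/-- The derivative of `adjointSection` with respect to the deformation parameter. -/
def adjointSectionDeriv (S S' : ℝ → ℝ → Mat2) (φ φ' : ℝ → Mat2) (l r : ℝ) : Mat2 :=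
  (S' l r * φ l + S l r * φ' l) * (S l r).adjugate + S l r * φ l * (S' l r).adjugate

/-- The phase that turns the derivative covariant with respect to `q` into the derivative. -/
def gaugePhase (θ : ℝ → ℝ) (z : ℝ) : ℂ := Complex.exp (-Complex.I * θ z)

lemma hasDerivAt_gaugePhase {z : ℝ} (h : HasDerivAt θ (2 * q z) z) :
    HasDerivAt (gaugePhase θ) (gaugePhase θ z * (-Complex.I * (2 * q z))) z := by
  have := (h.ofReal_comp.const_mul (-Complex.I)).cexp
  refine this.congr_deriv ?_
  simp only [gaugePhase]
  push_cast
  rfl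

lemma conj_gaugePhase_mul (θ : ℝ → ℝ) (z : ℝ) : conj (gaugePhase θ z) * gaugePhase θ z = 1 := by
  rw [gaugePhase, ← Complex.exp_conj, ← Complex.exp_add]
  simp

section AdjointSection

variable {S S' : ℝ → ℝ → Mat2} {φ φ' : ℝ → Mat2}

/-- The section is covariantly constant with respect to the deformed connection. -/
lemma hasDerivAt_adjointSection_r (h : IsRadialSolution κ q p S S') (l r : ℝ) :
    HasDerivAt (adjointSection S φ l) (radialConn κ q p l r * adjointSection S φ l r -
      adjointSection S φ l r * radialConn κ q p l r) r := by
  have h1 := hasDerivAt_adjugate_of_ode (fun r => trace_radialConn l r) (h.deriv_r l) r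
  refine (((h.deriv_r l r).mul_const (φ l)).mul h1).congr_deriv ?_
  simp only [adjointSection]
  noncomm_ring

/-- In the rotating frame the section satisfies a system of equations from which the antisymmetric
part `q` of the connection has disappeared. -/
lemma isRadialPair_adjointSection (h : IsRadialSolution κ q p S S') {a b : ℝ}
    (hq : Continuous q) (hθ : ∀ z, HasDerivAt θ (2 * q z) z)
    (hφ : ∀ l, HasDerivAt φ (φ' l) l) (hφ' : Continuous φ') (hsupp : ∀ l ∉ Icc a b, φ l = 0)
    (hsymm : ∀ l, (φ l)ᵀ = φ l) :
    IsRadialPair a b κ (fun z => gaugePhase θ z * p z)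
      (fun l r => hComp (adjointSection S φ l r))
      (fun l r => hComp (adjointSectionDeriv S S' φ φ' l r))
      (fun l r => gaugePhase θ (l - r ^ 2) * wComp (adjointSection S φ l r))
      (fun l r => gaugePhase θ (l - r ^ 2) * (-Complex.I * (2 * q (l - r ^ 2))) *
        wComp (adjointSection S φ l r) +
        gaugePhase θ (l - r ^ 2) * wComp (adjointSectionDeriv S S' φ φ' l r)) := by
  have cφ : Continuous fun x : ℝ × ℝ => φ x.1 :=
    (continuous_iff_continuousAt.mpr fun l => (hφ l).continuousAt).comp continuous_fst
  have cφ' : Continuous fun x : ℝ × ℝ => φ' x.1 := hφ'.comp continuous_fst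
  have cX : Continuous fun x : ℝ × ℝ => adjointSection S φ x.1 x.2 :=
    (h.cont.mul cφ).mul (continuous_adjugate h.cont)
  have cX' : Continuous fun x : ℝ × ℝ => adjointSectionDeriv S S' φ φ' x.1 x.2 :=
    (((h.cont'.mul cφ).add (h.cont.mul cφ')).mul (continuous_adjugate h.cont)).add
      ((h.cont.mul cφ).mul (continuous_adjugate h.cont'))
  have cg : Continuous (gaugePhase θ) :=
    continuous_iff_continuousAt.mpr fun z => (hasDerivAt_gaugePhase (hθ z)).continuousAt
  have cg' : Continuous fun x : ℝ × ℝ => gaugePhase θ (x.1 - x.2 ^ 2) := cg.comp (by fun_prop)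
  have cq' : Continuous fun x : ℝ × ℝ => -Complex.I * (2 * (q (x.1 - x.2 ^ 2) : ℂ)) :=
    continuous_const.mul (continuous_const.mul (Complex.continuous_ofReal.comp
      (hq.comp (by fun_prop))))
  have dX : ∀ l r, HasDerivAt (fun l => adjointSection S φ l r)
      (adjointSectionDeriv S S' φ φ' l r) l := fun l r =>
    ((h.deriv_l l r).mul (hφ l)).mul (hasDerivAt_adjugate (h.deriv_l l r))
  have dz : ∀ l r : ℝ, HasDerivAt (fun r : ℝ => l - r ^ 2) (-(2 * r)) r := fun l r => by
    simpa using (hasDerivAt_pow 2 r).const_sub l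
  refine ⟨continuous_hComp cX, continuous_hComp cX', cg'.mul (continuous_wComp cX),
    ((cg'.mul cq').mul (continuous_wComp cX)).add (cg'.mul (continuous_wComp cX')),
    fun l r => hasDerivAt_hComp (dX l r), fun l r => ?_, fun l r => ?_, fun l r => ?_, fun l => ?_,
    fun l hl r => ?_, fun l hl r => ?_⟩
  · have d : HasDerivAt (fun l : ℝ => l - r ^ 2) 1 l := (hasDerivAt_id l).sub_const _
    have d1 := (hasDerivAt_gaugePhase (hθ (l - r ^ 2))).scomp l d
    rw [one_smul] at d1
    exact d1.mul (hasDerivAt_wComp (dX l r))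
  · refine (hasDerivAt_hComp (hasDerivAt_adjointSection_r h l r)).congr_deriv ?_
    rw [radialConn, hComp_commutator]
    have := conj_gaugePhase_mul θ (l - r ^ 2)
    rw [map_mul, show conj (gaugePhase θ (l - r ^ 2)) * conj (p (l - r ^ 2)) *
      (gaugePhase θ (l - r ^ 2) * wComp (adjointSection S φ l r)) =
      (conj (gaugePhase θ (l - r ^ 2)) * gaugePhase θ (l - r ^ 2)) *
        (conj (p (l - r ^ 2)) * wComp (adjointSection S φ l r)) by ring, this, one_mul]
    ring
  · have d1 := (hasDerivAt_gaugePhase (hθ (l - r ^ 2))).scomp r (dz l r)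
    refine (d1.mul (hasDerivAt_wComp (hasDerivAt_adjointSection_r h l r))).congr_deriv ?_
    rw [radialConn, wComp_commutator]
    simp only [Function.comp_apply, Complex.real_smul]
    push_cast
    ring
  · have : adjointSection S φ l 0 = φ l := by simp [adjointSection, h.zero]
    rw [this, hComp_eq_zero_of_symm (hsymm l)]
  · simp [adjointSection, hsupp l hl, hComp]
  · simp [adjointSection, hsupp l hl, wComp]

end AdjointSection

/-! ### Smooth one-parameter families of fields -/

section Strip

variable {δ R : ℝ}

lemma uniqueDiffOn_strip (hR : 0 < R) :
    UniqueDiffOn ℝ (Ioo (-δ) δ ×ˢ Icc (0 : ℝ) R) :=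
  isOpen_Ioo.uniqueDiffOn.prod (uniqueDiffOn_Icc hR)

lemma hasDerivAt_fst_of_strip {f : ℝ × ℝ → ℝ}
    (hf : ContDiffOn ℝ ∞ f (Ioo (-δ) δ ×ˢ Icc 0 R)) {t x : ℝ} (ht : t ∈ Ioo (-δ) δ)
    (hx : x ∈ Icc 0 R) :
    HasDerivAt (fun s => f (s, x)) (fderivWithin ℝ f (Ioo (-δ) δ ×ˢ Icc 0 R) (t, x) (1, 0)) t := by
  have h1 := (hf.differentiableOn (by simp) (t, x) ⟨ht, hx⟩).hasFDerivWithinAt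
  have h2 : HasDerivWithinAt (fun s : ℝ => (s, x)) ((1 : ℝ), (0 : ℝ)) (Ioo (-δ) δ) t :=
    ((hasDerivAt_id t).prodMk (hasDerivAt_const t x)).hasDerivWithinAt
  have h3 := h1.comp_hasDerivWithinAt t h2 fun s hs => mk_mem_prod hs hx
  exact h3.hasDerivAt (isOpen_Ioo.mem_nhds ht)

lemma hasDerivWithinAt_snd_of_strip {f : ℝ × ℝ → ℝ}
    (hf : ContDiffOn ℝ ∞ f (Ioo (-δ) δ ×ˢ Icc 0 R)) {t x : ℝ} (ht : t ∈ Ioo (-δ) δ)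
    (hx : x ∈ Icc 0 R) :
    HasDerivWithinAt (fun y => f (t, y))
      (fderivWithin ℝ f (Ioo (-δ) δ ×ˢ Icc 0 R) (t, x) (0, 1)) (Icc 0 R) x := by
  have h1 := (hf.differentiableOn (by simp) (t, x) ⟨ht, hx⟩).hasFDerivWithinAt
  have h2 : HasDerivWithinAt (fun y : ℝ => (t, y)) ((0 : ℝ), (1 : ℝ)) (Icc 0 R) x :=
    ((hasDerivAt_const x t).prodMk (hasDerivAt_id x)).hasDerivWithinAt
  exact h1.comp_hasDerivWithinAt x h2 fun y hy => mk_mem_prod ht hy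

lemma contDiffOn_fderivWithin_strip (hR : 0 < R) {f : ℝ × ℝ → ℝ}
    (hf : ContDiffOn ℝ ∞ f (Ioo (-δ) δ ×ˢ Icc 0 R)) (v : ℝ × ℝ) :
    ContDiffOn ℝ ∞ (fun p => fderivWithin ℝ f (Ioo (-δ) δ ×ˢ Icc 0 R) p v)
      (Ioo (-δ) δ ×ˢ Icc 0 R) :=
  (hf.fderivWithin (uniqueDiffOn_strip hR) (by simp)).clm_apply contDiffOn_const

lemma two_le_infty : (2 : WithTop ℕ∞) ≤ ∞ :=
  WithTop.coe_le_coe.mpr (le_top : (2 : ℕ∞) ≤ ⊤)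

lemma fderivWithin_strip_comm (hR : 0 < R) {f : ℝ × ℝ → ℝ}
    (hf : ContDiffOn ℝ ∞ f (Ioo (-δ) δ ×ˢ Icc 0 R)) {p : ℝ × ℝ}
    (hp : p ∈ Ioo (-δ) δ ×ˢ Icc 0 R) (v w : ℝ × ℝ) :
    fderivWithin ℝ (fun p => fderivWithin ℝ f (Ioo (-δ) δ ×ˢ Icc 0 R) p v)
      (Ioo (-δ) δ ×ˢ Icc 0 R) p w =
    fderivWithin ℝ (fun p => fderivWithin ℝ f (Ioo (-δ) δ ×ˢ Icc 0 R) p w)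
      (Ioo (-δ) δ ×ˢ Icc 0 R) p v := by
  have hu := uniqueDiffOn_strip (δ := δ) hR
  have hcl : p ∈ closure (interior (Ioo (-δ) δ ×ˢ Icc (0 : ℝ) R)) := by
    rw [interior_prod_eq, isOpen_Ioo.interior_eq, interior_Icc, closure_prod_eq,
      closure_Ioo hR.ne]
    exact ⟨subset_closure hp.1, hp.2⟩
  have hs := (hf p hp).isSymmSndFDerivWithinAt (by simpa using two_le_infty) hu hcl hp
  have hd : DifferentiableWithinAt ℝ (fderivWithin ℝ f (Ioo (-δ) δ ×ˢ Icc 0 R))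
      (Ioo (-δ) δ ×ˢ Icc 0 R) p :=
    (hf.fderivWithin hu (m := ∞) (by simp)).differentiableOn (by simp) p hp
  have key : ∀ v w : ℝ × ℝ, fderivWithin ℝ (fun p => fderivWithin ℝ f (Ioo (-δ) δ ×ˢ Icc 0 R) p v)
      (Ioo (-δ) δ ×ˢ Icc 0 R) p w =
      fderivWithin ℝ (fderivWithin ℝ f (Ioo (-δ) δ ×ˢ Icc 0 R)) (Ioo (-δ) δ ×ˢ Icc 0 R) p w v := by
    intro v w
    rw [fderivWithin_clm_apply (hu p hp) hd (differentiableWithinAt_const v)]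
    simp
  rw [key, key, hs w v]

end Strip

lemma hasDerivWithinAt_mat2_iff {f : ℝ → Mat2} {f' : Mat2} {s : Set ℝ} {x : ℝ} :
    HasDerivWithinAt f f' s x ↔ ∀ i j, HasDerivWithinAt (fun x => f x i j) (f' i j) s x := by
  constructor
  · intro h i j
    exact (entryCLM i j).hasFDerivAt.comp_hasDerivWithinAt x h
  · intro h
    have h1 : HasDerivWithinAt (fun x => ∑ i, ∑ j, f x i j • Matrix.single i j (1 : ℝ))
        (∑ i, ∑ j, f' i j • Matrix.single i j (1 : ℝ)) s x := by
      refine HasDerivWithinAt.fun_sum fun i _ => HasDerivWithinAt.fun_sum fun j _ =>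
        (h i j).smul_const _
    simpa only [sum_smul_single] using h1

lemma continuousOn_mat2_iff {X : Type*} [TopologicalSpace X] {f : X → Mat2} {s : Set X} :
    ContinuousOn f s ↔ ∀ i j, ContinuousOn (fun x => f x i j) s := by
  simp only [continuousOn_iff_continuous_domRestrict]
  exact continuous_mat2_iff

/-- A family `V t x` of unimodular matrices, `-δ < t < δ`, `0 ≤ x ≤ R`, with its continuous partial
derivatives. -/
structure IsStripFamily (δ R : ℝ) (V Vt Vx Vxt Vxx : ℝ → ℝ → Mat2) : Prop where
  cont : ContinuousOn (fun p : ℝ × ℝ => V p.1 p.2) (Ioo (-δ) δ ×ˢ Icc 0 R)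
  cont_t : ContinuousOn (fun p : ℝ × ℝ => Vt p.1 p.2) (Ioo (-δ) δ ×ˢ Icc 0 R)
  cont_x : ContinuousOn (fun p : ℝ × ℝ => Vx p.1 p.2) (Ioo (-δ) δ ×ˢ Icc 0 R)
  cont_xt : ContinuousOn (fun p : ℝ × ℝ => Vxt p.1 p.2) (Ioo (-δ) δ ×ˢ Icc 0 R)
  cont_xx : ContinuousOn (fun p : ℝ × ℝ => Vxx p.1 p.2) (Ioo (-δ) δ ×ˢ Icc 0 R)
  deriv_t : ∀ t ∈ Ioo (-δ) δ, ∀ x ∈ Icc 0 R, HasDerivAt (fun t => V t x) (Vt t x) t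
  deriv_x : ∀ t ∈ Ioo (-δ) δ, ∀ x ∈ Icc 0 R, HasDerivWithinAt (V t) (Vx t x) (Icc 0 R) x
  deriv_xt : ∀ t ∈ Ioo (-δ) δ, ∀ x ∈ Icc 0 R, HasDerivAt (fun t => Vx t x) (Vxt t x) t
  deriv_tx : ∀ t ∈ Ioo (-δ) δ, ∀ x ∈ Icc 0 R, HasDerivWithinAt (Vt t) (Vxt t x) (Icc 0 R) x
  deriv_xx : ∀ t ∈ Ioo (-δ) δ, ∀ x ∈ Icc 0 R, HasDerivWithinAt (Vx t) (Vxx t x) (Icc 0 R) x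
  det : ∀ t ∈ Ioo (-δ) δ, ∀ x ∈ Icc 0 R, (V t x).det = 1

lemma exists_stripFamily {δ R : ℝ} (hR : 0 < R) {V : ℝ → ℝ → Mat2}
    (hV : ∀ i j, ContDiffOn ℝ ∞ (fun p : ℝ × ℝ => V p.1 p.2 i j) (Ioo (-δ) δ ×ˢ Icc 0 R))
    (hdet : ∀ t ∈ Ioo (-δ) δ, ∀ x ∈ Icc 0 R, (V t x).det = 1) :
    ∃ Vt Vx Vxt Vxx, IsStripFamily δ R V Vt Vx Vxt Vxx := by
  set D := Ioo (-δ) δ ×ˢ Icc (0 : ℝ) R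
  set f : Fin 2 → Fin 2 → ℝ × ℝ → ℝ := fun i j p => V p.1 p.2 i j with hf
  set fd : ℝ × ℝ → Fin 2 → Fin 2 → ℝ × ℝ → ℝ := fun v i j p => fderivWithin ℝ (f i j) D p v with hfd
  have h1 : ∀ v i j, ContDiffOn ℝ ∞ (fd v i j) D := fun v i j =>
    contDiffOn_fderivWithin_strip hR (hV i j) v
  set fdd : Fin 2 → Fin 2 → ℝ × ℝ → ℝ × ℝ → ℝ := fun i j w p => fderivWithin ℝ (fd (0, 1) i j) D p w
    with hfdd
  have h2 : ∀ w i j, ContDiffOn ℝ ∞ (fdd i j w) D := fun w i j =>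
    contDiffOn_fderivWithin_strip hR (h1 (0, 1) i j) w
  refine ⟨fun t x => Matrix.of fun i j => fd (1, 0) i j (t, x),
    fun t x => Matrix.of fun i j => fd (0, 1) i j (t, x),
    fun t x => Matrix.of fun i j => fdd i j (1, 0) (t, x),
    fun t x => Matrix.of fun i j => fdd i j (0, 1) (t, x),
    continuousOn_mat2_iff.mpr fun i j => (hV i j).continuousOn,
    continuousOn_mat2_iff.mpr fun i j => (h1 _ i j).continuousOn,
    continuousOn_mat2_iff.mpr fun i j => (h1 _ i j).continuousOn,
    continuousOn_mat2_iff.mpr fun i j => (h2 _ i j).continuousOn,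
    continuousOn_mat2_iff.mpr fun i j => (h2 _ i j).continuousOn,
    fun t ht x hx => hasDerivAt_mat2_iff.mpr fun i j => hasDerivAt_fst_of_strip (hV i j) ht hx,
    fun t ht x hx => hasDerivWithinAt_mat2_iff.mpr fun i j =>
      hasDerivWithinAt_snd_of_strip (hV i j) ht hx,
    fun t ht x hx => hasDerivAt_mat2_iff.mpr fun i j => hasDerivAt_fst_of_strip (h1 _ i j) ht hx,
    fun t ht x hx => hasDerivWithinAt_mat2_iff.mpr fun i j => ?_,
    fun t ht x hx => hasDerivWithinAt_mat2_iff.mpr fun i j =>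
      hasDerivWithinAt_snd_of_strip (h1 _ i j) ht hx, hdet⟩
  refine (hasDerivWithinAt_snd_of_strip (h1 (1, 0) i j) ht hx).congr_deriv ?_
  exact fderivWithin_strip_comm hR (hV i j) ⟨ht, hx⟩ (1, 0) (0, 1)

/-- Along a straight line of variations the Beltrami condition persists for small parameters, and
the zweibein is a smooth family. -/
lemma IsZweibein.exists_stripFamily {R : ℝ} (hR : 0 < R) {𝒱 : (ℝ → ℂ) → ℝ → Mat2}
    (h𝒱 : IsZweibein R 𝒱) {μ : ℝ → ℂ} (hμ : IsBeltrami R μ) {ζ : ℝ → ℂ}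
    (hζ : ContDiffOn ℝ ∞ ζ (Icc 0 R)) :
    ∃ δ > 0, (∀ t ∈ Ioo (-δ) δ, IsBeltrami R fun y => μ y + t • ζ y) ∧ ∃ Vt Vx Vxt Vxx,
      IsStripFamily δ R (fun t => 𝒱 fun y => μ y + t • ζ y) Vt Vx Vxt Vxx := by
  obtain ⟨δ₁, hδ₁, hV⟩ := h𝒱.smooth μ hμ ζ hζ
  have hne : (Icc (0 : ℝ) R).Nonempty := nonempty_Icc.mpr hR.le
  obtain ⟨x₀, hx₀, hmax⟩ := isCompact_Icc.exists_isMaxOn hne hμ.smooth.continuousOn.norm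
  obtain ⟨C, hC⟩ := isCompact_Icc.exists_bound_of_continuousOn hζ.continuousOn
  have hlt := hμ.norm_lt_one x₀ hx₀
  set δ := min δ₁ ((1 - ‖μ x₀‖) / (|C| + 1)) with hδ
  have hC1 : 0 < |C| + 1 := by positivity
  have hδ0 : 0 < δ := lt_min hδ₁ (div_pos (by linarith) hC1)
  have hB : ∀ t ∈ Ioo (-δ) δ, IsBeltrami R fun y => μ y + t • ζ y := by
    intro t ht
    refine ⟨hμ.smooth.add (hζ.const_smul t), fun x hx => ?_⟩
    have h1 : |t| < (1 - ‖μ x₀‖) / (|C| + 1) := (abs_lt.mpr ht).trans_le (min_le_right _ _)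
    rw [lt_div_iff₀ hC1] at h1
    have h2 : ‖μ x‖ ≤ ‖μ x₀‖ := hmax hx
    have h3 : ‖ζ x‖ ≤ |C| := (hC x hx).trans (le_abs_self C)
    have h4 : ‖μ x + t • ζ x‖ ≤ ‖μ x‖ + |t| * ‖ζ x‖ := by
      refine (norm_add_le _ _).trans ?_
      rw [norm_smul, Real.norm_eq_abs]
    have h5 : |t| * ‖ζ x‖ ≤ |t| * (|C| + 1) :=
      mul_le_mul_of_nonneg_left (by linarith) (abs_nonneg t)
    linarith
  refine ⟨δ, hδ0, hB, CylGrav.exists_stripFamily hR (fun i j => (hV i j).mono ?_)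
    fun t ht x hx => h𝒱.det_eq_one _ (hB t ht) x hx⟩
  exact prod_mono (Ioo_subset_Ioo (neg_le_neg (min_le_left _ _)) (min_le_left _ _)) Subset.rfl

/-! ### The zweibein and its connection -/

/-- A real matrix acts on `ℂ = ℝ²` by `v ↦ α v + β v̄`. This is the coefficient `α`; the
coefficient `β` is `wComp`. -/
def rotComp (M : Mat2) : ℂ := ((M.trace / 2 : ℝ) : ℂ) - Complex.I * hComp M

lemma rotComp_re (M : Mat2) : (rotComp M).re = (M 0 0 + M 1 1) / 2 := by
  simp [rotComp, Matrix.trace_fin_two]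

lemma rotComp_im (M : Mat2) : (rotComp M).im = (M 1 0 - M 0 1) / 2 := by
  simp [rotComp, hComp]; ring

/-- As a real linear map, a zweibein `V` of the conformal metric is `v ↦ α v + β v̄` with Beltrami
coefficient `β / ᾱ = μ`, whatever the gauge; and `|α|² - |β|² = det V = 1`. -/
lemma normSq_rotComp_of_zweibein {V : Mat2} {m : ℂ} (hm : ‖m‖ < 1) (hV : V * Vᵀ = confMetric m)
    (hdet : V.det = 1) :
    conj (rotComp V) * rotComp V * (1 - m * conj m) = 1 ∧ wComp V = m * conj (rotComp V) := by
  obtain ⟨x, y⟩ := m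
  have hns : ‖(⟨x, y⟩ : ℂ)‖ ^ 2 = x ^ 2 + y ^ 2 := by
    rw [Complex.sq_norm, Complex.normSq_mk]; ring
  have hD : 0 < 1 - (x ^ 2 + y ^ 2) := by
    rw [← hns]; nlinarith [norm_nonneg (⟨x, y⟩ : ℂ)]
  have n1 : ‖1 + (⟨x, y⟩ : ℂ)‖ ^ 2 = (1 + x) ^ 2 + y ^ 2 := by
    rw [Complex.sq_norm, Complex.normSq_apply]; simp; ring
  have n2 : ‖1 - (⟨x, y⟩ : ℂ)‖ ^ 2 = (1 - x) ^ 2 + y ^ 2 := by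
    rw [Complex.sq_norm, Complex.normSq_apply]; simp; ring
  rw [confMetric, hns, n1, n2] at hV
  have e00 := congr_fun (congr_fun hV 0) 0
  have e01 := congr_fun (congr_fun hV 0) 1
  have e11 := congr_fun (congr_fun hV 1) 1
  simp only [Matrix.mul_apply, Fin.sum_univ_two, Matrix.transpose_apply, Matrix.smul_apply,
    Matrix.of_apply, Matrix.cons_val', Matrix.cons_val_zero, Matrix.cons_val_one,
    Matrix.cons_val_fin_one, smul_eq_mul] at e00 e01 e11
  rw [Matrix.det_fin_two] at hdet
  have hD' := hD.ne'
  rw [inv_mul_eq_div, eq_div_iff hD'] at e00 e01 e11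
  have r := rotComp_re V
  have i := rotComp_im V
  have h1 : conj (rotComp V) * rotComp V * (1 - (⟨x, y⟩ : ℂ) * conj (⟨x, y⟩ : ℂ)) = 1 := by
    apply Complex.ext
    · simp [r, i]
      linear_combination (e00 + e11) / 4 + hdet * (1 - (x ^ 2 + y ^ 2)) / 2
    · simp [r, i]
      ring
  refine ⟨h1, ?_⟩
  have hne : rotComp V ≠ 0 := fun h => by rw [h] at h1; simp at h1
  have hD2 : (1 - (⟨x, y⟩ : ℂ) * conj (⟨x, y⟩ : ℂ)) ≠ 0 := fun h => by rw [h] at h1; simp at h1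
  refine mul_right_cancel₀ hne (mul_right_cancel₀ hD2 ?_)
  have h2 : (⟨x, y⟩ : ℂ) * conj (rotComp V) * rotComp V *
      (1 - (⟨x, y⟩ : ℂ) * conj (⟨x, y⟩ : ℂ)) = ⟨x, y⟩ := by linear_combination (⟨x, y⟩ : ℂ) * h1
  rw [h2]
  apply Complex.ext
  · simp [r, i]
    linear_combination (e00 - e11) / 4
  · simp [r, i]
    linear_combination e01 / 2

lemma adjugate_mul_apply (V M : Mat2) (i j : Fin 2) : (V.adjugate * M) i j =
    !![V 1 1 * M 0 0 - V 0 1 * M 1 0, V 1 1 * M 0 1 - V 0 1 * M 1 1;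
      V 0 0 * M 1 0 - V 1 0 * M 0 0, V 0 0 * M 1 1 - V 1 0 * M 0 1] i j := by
  rw [Matrix.mul_apply, Fin.sum_univ_two]
  fin_cases i <;> fin_cases j <;> simp [Matrix.adjugate_fin_two] <;> ring

lemma wComp_adjugate_mul (V M : Mat2) : wComp (V.adjugate * M) =
    conj (rotComp V) * wComp M - wComp V * conj (rotComp M) := by
  apply Complex.ext <;>
  simp only [wComp_re, wComp_im, adjugate_mul_apply, Complex.sub_re, Complex.sub_im,
    Complex.mul_re, Complex.mul_im, Complex.conj_re, Complex.conj_im, rotComp_re, rotComp_im,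
    Matrix.of_apply, Matrix.cons_val', Matrix.cons_val_zero, Matrix.cons_val_one,
    Matrix.cons_val_fin_one] <;>
  ring

lemma hComp_adjugate_mul (V M : Mat2) : hComp (V.adjugate * M) =
    -(conj (rotComp V) * rotComp M - wComp V * conj (wComp M)).im := by
  simp only [hComp, wComp_re, wComp_im, adjugate_mul_apply, Complex.sub_im, Complex.mul_im,
    Complex.conj_re, Complex.conj_im, rotComp_re, rotComp_im, Matrix.of_apply, Matrix.cons_val',
    Matrix.cons_val_zero, Matrix.cons_val_one, Matrix.cons_val_fin_one]
  ring

lemma hasDerivWithinAt_hComp {f : ℝ → Mat2} {f' : Mat2} {s : Set ℝ} {x : ℝ}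
    (h : HasDerivWithinAt f f' s x) : HasDerivWithinAt (fun x => hComp (f x)) (hComp f') s x := by
  have h := hasDerivWithinAt_mat2_iff.mp h
  exact ((h 0 1).sub (h 1 0)).div_const 2

lemma hasDerivWithinAt_ofReal {f : ℝ → ℝ} {f' : ℝ} {s : Set ℝ} {x : ℝ}
    (h : HasDerivWithinAt f f' s x) : HasDerivWithinAt (fun x => (f x : ℂ)) (f' : ℂ) s x :=
  Complex.ofRealCLM.hasFDerivAt.comp_hasDerivWithinAt x h

lemma hasDerivWithinAt_conj {f : ℝ → ℂ} {f' : ℂ} {s : Set ℝ} {x : ℝ}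
    (h : HasDerivWithinAt f f' s x) : HasDerivWithinAt (fun x => conj (f x)) (conj f') s x :=
  Complex.conjCLE.toContinuousLinearMap.hasFDerivAt.comp_hasDerivWithinAt x h

lemma hasDerivWithinAt_wComp {f : ℝ → Mat2} {f' : Mat2} {s : Set ℝ} {x : ℝ}
    (h : HasDerivWithinAt f f' s x) : HasDerivWithinAt (fun x => wComp (f x)) (wComp f') s x := by
  have h := hasDerivWithinAt_mat2_iff.mp h
  exact (hasDerivWithinAt_ofReal (((h 0 0).sub (h 1 1)).div_const 2)).add
    ((hasDerivWithinAt_ofReal (((h 0 1).add (h 1 0)).div_const 2)).mul_const _)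

lemma hasDerivWithinAt_rotComp {f : ℝ → Mat2} {f' : Mat2} {s : Set ℝ} {x : ℝ}
    (h : HasDerivWithinAt f f' s x) :
    HasDerivWithinAt (fun x => rotComp (f x)) (rotComp f') s x := by
  have ht : HasDerivWithinAt (fun x => (f x).trace / 2) (f'.trace / 2) s x := by
    have h := hasDerivWithinAt_mat2_iff.mp h
    simp only [Matrix.trace_fin_two]
    exact ((h 0 0).add (h 1 1)).div_const 2
  exact (hasDerivWithinAt_ofReal ht).sub
    ((hasDerivWithinAt_ofReal (hasDerivWithinAt_hComp h)).const_mul _)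

lemma hasDerivWithinAt_adjugate {f : ℝ → Mat2} {f' : Mat2} {s : Set ℝ} {x : ℝ}
    (h : HasDerivWithinAt f f' s x) :
    HasDerivWithinAt (fun x => (f x).adjugate) f'.adjugate s x := by
  have h := hasDerivWithinAt_mat2_iff.mp h
  refine hasDerivWithinAt_mat2_iff.mpr fun i j => ?_
  fin_cases i <;> fin_cases j <;> simp only [Matrix.adjugate_fin_two] <;>
    first | exact h 0 0 | exact h 1 1 | exact (h 0 1).neg | exact (h 1 0).neg

namespace IsStripFamily

variable {δ R : ℝ} {V Vt Vx Vxt Vxx : ℝ → ℝ → Mat2}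

lemma trace_adjugate_mul_x (h : IsStripFamily δ R V Vt Vx Vxt Vxx) (hR : 0 < R) {t x : ℝ}
    (ht : t ∈ Ioo (-δ) δ) (hx : x ∈ Icc 0 R) : ((V t x).adjugate * Vx t x).trace = 0 := by
  have h1 := hasDerivWithinAt_mat2_iff.mp (h.deriv_x t ht x hx)
  have h2 : HasDerivWithinAt (fun y => V t y 0 0 * V t y 1 1 - V t y 0 1 * V t y 1 0) 0
      (Icc 0 R) x := by
    refine (hasDerivWithinAt_const x (Icc 0 R) (1 : ℝ)).congr (fun y hy => ?_) ?_
    · rw [← Matrix.det_fin_two, h.det t ht y hy]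
    · rw [← Matrix.det_fin_two, h.det t ht x hx]
  have h3 := (((h1 0 0).mul (h1 1 1)).sub ((h1 0 1).mul (h1 1 0)))
  have h4 := (uniqueDiffOn_Icc hR x hx).eq_deriv _ h2 h3
  simp only [Matrix.trace_fin_two, adjugate_mul_apply, Matrix.of_apply, Matrix.cons_val',
    Matrix.cons_val_zero, Matrix.cons_val_one, Matrix.cons_val_fin_one]
  linarith

lemma trace_adjugate_mul_t (h : IsStripFamily δ R V Vt Vx Vxt Vxx) {t x : ℝ}
    (ht : t ∈ Ioo (-δ) δ) (hx : x ∈ Icc 0 R) : ((V t x).adjugate * Vt t x).trace = 0 := by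
  have h1 := hasDerivAt_mat2_iff.mp (h.deriv_t t ht x hx)
  have h2 : HasDerivAt (fun s => V s x 0 0 * V s x 1 1 - V s x 0 1 * V s x 1 0) 0 t := by
    refine (hasDerivAt_const t (1 : ℝ)).congr_of_eventuallyEq ?_
    filter_upwards [isOpen_Ioo.mem_nhds ht] with s hs
    rw [← Matrix.det_fin_two, h.det s hs x hx]
  have h3 := (((h1 0 0).mul (h1 1 1)).sub ((h1 0 1).mul (h1 1 0)))
  have h4 := h2.unique h3
  simp only [Matrix.trace_fin_two, adjugate_mul_apply, Matrix.of_apply, Matrix.cons_val',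
    Matrix.cons_val_zero, Matrix.cons_val_one, Matrix.cons_val_fin_one]
  linarith

lemma connJ_eq (h : IsStripFamily δ R V Vt Vx Vxt Vxx) (hR : 0 < R) {t x : ℝ}
    (ht : t ∈ Ioo (-δ) δ) (hx : x ∈ Icc 0 R) : connJ R (V t) x = (V t x).adjugate * Vx t x := by
  rw [connJ, inv_eq_adjugate_of_det (h.det t ht x hx)]
  congr 1
  ext i j
  exact ((hasDerivWithinAt_mat2_iff.mp (h.deriv_x t ht x hx)) i j).derivWithin
    (uniqueDiffOn_Icc hR x hx)

lemma connQ_eq (h : IsStripFamily δ R V Vt Vx Vxt Vxx) (hR : 0 < R) {t x : ℝ}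
    (ht : t ∈ Ioo (-δ) δ) (hx : x ∈ Icc 0 R) :
    connQ R (V t) x = hComp ((V t x).adjugate * Vx t x) • hMat := by
  rw [connQ, h.connJ_eq hR ht hx]
  set J := (V t x).adjugate * Vx t x
  ext i j
  fin_cases i <;> fin_cases j <;> simp [hMat, hComp] <;> ring

lemma connP_eq (h : IsStripFamily δ R V Vt Vx Vxt Vxx) (hR : 0 < R) {t x : ℝ}
    (ht : t ∈ Ioo (-δ) δ) (hx : x ∈ Icc 0 R) :
    connP R (V t) x = kMat (wComp ((V t x).adjugate * Vx t x)) := by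
  have htr := h.trace_adjugate_mul_x hR ht hx
  rw [connP, h.connJ_eq hR ht hx]
  set J := (V t x).adjugate * Vx t x
  rw [Matrix.trace_fin_two] at htr
  ext i j
  fin_cases i <;> fin_cases j <;> simp [kMat] <;> linarith

/-- The variation of the connection is the covariant derivative of `ξ = V⁻¹ δV`. -/
lemma connection_variation (h : IsStripFamily δ R V Vt Vx Vxt Vxx) (hR : 0 < R) {t x : ℝ}
    (ht : t ∈ Ioo (-δ) δ) (hx : x ∈ Icc 0 R) :
    (Vt t x).adjugate * Vx t x + (V t x).adjugate * Vxt t x =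
      (Vx t x).adjugate * Vt t x + (V t x).adjugate * Vxt t x +
        ((V t x).adjugate * Vx t x * ((V t x).adjugate * Vt t x) -
          (V t x).adjugate * Vt t x * ((V t x).adjugate * Vx t x)) := by
  have key : ∀ M : Mat2, ((V t x).adjugate * M).trace = 0 →
      M.adjugate = -((V t x).adjugate * M * (V t x).adjugate) := by
    intro M hM
    have hd := h.det t ht x hx
    -- a trace free matrix is minus its adjugate
    have e1 : ((V t x).adjugate * M).adjugate = -((V t x).adjugate * M) := by
      set N := (V t x).adjugate * M
      rw [Matrix.trace_fin_two] at hM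
      ext i j
      fin_cases i <;> fin_cases j <;> simp [Matrix.adjugate_fin_two] <;> linarith
    have e2 : (V t x).adjugate.adjugate = V t x := by
      ext i j
      fin_cases i <;> fin_cases j <;> simp [Matrix.adjugate_fin_two]
    rw [Matrix.adjugate_mul_distrib, e2] at e1
    have e3 := congrArg (fun N => N * (V t x).adjugate) e1
    simp only [mul_assoc, mul_adjugate_of_det hd, mul_one, neg_mul] at e3
    rw [e3]
    simp only [mul_assoc]
  rw [key _ (h.trace_adjugate_mul_x hR ht hx), key _ (h.trace_adjugate_mul_t ht hx)]
  noncomm_ring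

end IsStripFamily

/-! ### The phase of the bracket of the fundamental fields -/

/-- The factor that relates the variation of the Beltrami coefficient to the `𝔨` component of
`V⁻¹ δV`, in the frame in which `𝔥` does not rotate. -/
def gaugeFactor (θ : ℝ → ℝ) (V : ℝ → Mat2) (x : ℝ) : ℂ :=
  gaugePhase θ x * conj (rotComp (V x)) ^ 2

/-- The integrand of the phase of the bracket. -/
def phaseDensity (R : ℝ) (μ : ℝ → ℂ) (z : ℝ) : ℂ :=
  (conj (μ z) * derivWithin μ (Icc 0 R) z - μ z * conj (derivWithin μ (Icc 0 R) z)) /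
    (1 - μ z * conj (μ z))

lemma one_sub_mul_conj_ne_zero {m : ℂ} (hm : ‖m‖ < 1) : 1 - m * conj m ≠ 0 := by
  rw [Complex.mul_conj, Complex.normSq_eq_norm_sq]
  have : ‖m‖ ^ 2 < 1 := by nlinarith [norm_nonneg m]
  exact_mod_cast (sub_pos.mpr this).ne'

section Phase

variable {R : ℝ} {μ : ℝ → ℂ}

lemma IsBeltrami.hasDerivWithinAt (hμ : IsBeltrami R μ) {x : ℝ} (hx : x ∈ Icc 0 R) :
    HasDerivWithinAt μ (derivWithin μ (Icc 0 R) x) (Icc 0 R) x :=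
  (hμ.smooth.differentiableOn (by simp) x hx).hasDerivWithinAt

lemma IsBeltrami.continuousOn_derivWithin (hR : 0 < R) (hμ : IsBeltrami R μ) :
    ContinuousOn (derivWithin μ (Icc 0 R)) (Icc 0 R) :=
  hμ.smooth.continuousOn_derivWithin (uniqueDiffOn_Icc hR) (by simp)

lemma IsBeltrami.continuousOn_phaseDensity (hR : 0 < R) (hμ : IsBeltrami R μ) :
    ContinuousOn (phaseDensity R μ) (Icc 0 R) := by
  have h1 := hμ.smooth.continuousOn
  have h2 := hμ.continuousOn_derivWithin hR
  have h3 : ContinuousOn (fun x => conj (μ x)) (Icc 0 R) :=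
    Complex.continuous_conj.comp_continuousOn h1
  have h4 : ContinuousOn (fun x => conj (derivWithin μ (Icc 0 R) x)) (Icc 0 R) :=
    Complex.continuous_conj.comp_continuousOn h2
  exact ((h3.mul h2).sub (h1.mul h4)).div (continuousOn_const.sub (h1.mul h3))
    fun x hx => one_sub_mul_conj_ne_zero (hμ.norm_lt_one x hx)

/-- The unimodular number `e^{-iθ} ᾱ² (1 - |μ|²)`. -/
def unitPhase (θ : ℝ → ℝ) (V : ℝ → Mat2) (μ : ℝ → ℂ) (x : ℝ) : ℂ :=
  gaugeFactor θ V x * (1 - μ x * conj (μ x))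

variable {V Vx : ℝ → Mat2} {θ q : ℝ → ℝ}

lemma unitPhase_mul_conj (θ : ℝ → ℝ) {x : ℝ}
    (h1 : conj (rotComp (V x)) * rotComp (V x) * (1 - μ x * conj (μ x)) = 1) :
    unitPhase θ V μ x * conj (unitPhase θ V μ x) = 1 := by
  have h2 := conj_gaugePhase_mul θ x
  simp only [unitPhase, gaugeFactor, map_mul, map_pow, map_sub, map_one, Complex.conj_conj]
  set g := gaugePhase θ x
  set α := rotComp (V x)
  linear_combination (conj α * α * (1 - μ x * conj (μ x)) + 1) * h1 +
    (conj α * α * (1 - μ x * conj (μ x))) ^ 2 * h2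

/-- The phase satisfies the equation of parallel transport for the connection of the bracket. -/
lemma hasDerivWithinAt_unitPhase (hR : 0 < R) (hμ : IsBeltrami R μ)
    (hV : ∀ x ∈ Icc 0 R, HasDerivWithinAt V (Vx x) (Icc 0 R) x)
    (h1 : ∀ x ∈ Icc 0 R, conj (rotComp (V x)) * rotComp (V x) * (1 - μ x * conj (μ x)) = 1)
    (h2 : ∀ x ∈ Icc 0 R, wComp (V x) = μ x * conj (rotComp (V x)))
    (hq : ∀ x ∈ Icc 0 R, q x = hComp ((V x).adjugate * Vx x))
    (hθ : ∀ x, HasDerivAt θ (2 * q x) x) {x : ℝ} (hx : x ∈ Icc 0 R) :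
    HasDerivWithinAt (unitPhase θ V μ) (phaseDensity R μ x * unitPhase θ V μ x) (Icc 0 R) x := by
  have u := uniqueDiffOn_Icc hR x hx
  have dμ := hμ.hasDerivWithinAt hx
  have dμc := hasDerivWithinAt_conj dμ
  have dα := hasDerivWithinAt_rotComp (hV x hx)
  have dαc := hasDerivWithinAt_conj dα
  have dD := (dμ.mul dμc).const_sub 1
  have dβ := hasDerivWithinAt_wComp (hV x hx)
  have dg := (hasDerivAt_gaugePhase (hθ x)).hasDerivWithinAt (s := Icc 0 R)
  have r1 := u.eq_deriv _ ((hasDerivWithinAt_const x (Icc 0 R) (1 : ℂ)).congr h1 (h1 x hx))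
    ((dαc.mul dα).mul dD)
  have r2 := u.eq_deriv _ (dβ.congr (fun y hy => (h2 y hy).symm) (h2 x hx).symm) (dμ.mul dαc)
  have hD := one_sub_mul_conj_ne_zero (hμ.norm_lt_one x hx)
  refine ((dg.mul (dαc.pow 2)).mul dD).congr_deriv ?_
  have hqx := hq x hx
  rw [hComp_adjugate_mul, r2, h2 x hx] at hqx
  have e1 := h1 x hx
  set α := rotComp (V x)
  set α' := rotComp (Vx x)
  set m := μ x
  set m' := derivWithin μ (Icc 0 R) x
  have him : ∀ z : ℂ, ((z.im : ℝ) : ℂ) = (conj z - z) * (Complex.I / 2) := by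
    intro z
    apply Complex.ext <;> simp
    ring
  have hq2 : -Complex.I * (2 * (q x : ℂ)) =
      (conj α * α' - m * conj α * (conj m' * α + conj m * α')) -
        (α * conj α' - conj m * α * (m' * conj α + m * conj α')) := by
    rw [hqx, Complex.ofReal_neg, him]
    simp only [map_sub, map_mul, map_add, Complex.conj_conj]
    linear_combination (-((conj α * α' - m * conj α * (conj m' * α + conj m * α')) -
        (α * conj α' - conj m * α * (m' * conj α + m * conj α')))) * Complex.I_sq
  simp only [Pi.mul_apply, Pi.pow_apply] at r1 ⊢
  rw [hq2]
  simp only [unitPhase, gaugeFactor, phaseDensity]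
  change _ = (conj m * m' - m * conj m') / (1 - m * conj m) *
    (gaugePhase θ x * conj α ^ 2 * (1 - m * conj m))
  rw [div_mul_eq_mul_div, eq_div_iff hD]
  have hs : (↑(2 : ℕ) : ℂ) * conj α ^ (2 - 1) = 2 * conj α := by norm_num
  rw [hs]
  linear_combination gaugePhase θ x * (1 - m * conj m) *
    ((conj α ^ 2 * (conj m * m' - m * conj m') + conj α ^ 2 * (m' * conj m + m * conj m') -
      2 * conj α * conj α' * (1 - m * conj m)) * e1 - conj α ^ 2 * (1 - m * conj m) * r1)

/-- The phase in the bracket transports solutions of its linear equation from `x` to `y`. -/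
lemma unitPhase_mul_phaseFactor (hR : 0 < R) (hμ : IsBeltrami R μ) {n : ℝ → ℂ}
    (hn : ∀ x ∈ Icc 0 R, HasDerivWithinAt n (phaseDensity R μ x * n x) (Icc 0 R) x)
    {x y : ℝ} (hx : x ∈ Icc 0 R) (hy : y ∈ Icc 0 R) :
    n x * phaseFactor R μ x y = n y := by
  set c : ℝ → ℂ := IccExtend hR.le ((Icc 0 R).domRestrict (phaseDensity R μ)) with hc
  have hcc : Continuous c :=
    continuous_IccExtend_iff.mpr (hμ.continuousOn_phaseDensity hR).domRestrict
  have hceq : ∀ z ∈ Icc 0 R, c z = phaseDensity R μ z := fun z hz => IccExtend_of_mem _ _ hz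
  set C : ℝ → ℂ := fun z => ∫ s in (0 : ℝ)..z, c s with hC
  have hCd : ∀ z, HasDerivAt C (c z) z := fun z =>
    intervalIntegral.integral_hasDerivAt_right (hcc.intervalIntegrable _ _)
      (hcc.stronglyMeasurableAtFilter _ _) hcc.continuousAt
  have hE : ∀ z ∈ Icc 0 R, HasDerivWithinAt (fun z => Complex.exp (-C z) * n z) 0 (Icc 0 R) z := by
    intro z hz
    refine ((hCd z).neg.cexp.hasDerivWithinAt.mul (hn z hz)).congr_deriv ?_
    rw [hceq z hz]
    simp only [Pi.neg_apply]
    ring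
  have hconst : ∀ z ∈ Icc 0 R, Complex.exp (-C z) * n z = Complex.exp (-C 0) * n 0 :=
    constant_of_derivWithin_zero (fun z hz => (hE z hz).differentiableWithinAt) fun z hz =>
      (hE z (Ico_subset_Icc_self hz)).derivWithin (uniqueDiffOn_Icc hR z (Ico_subset_Icc_self hz))
  have h1 : phaseFactor R μ x y = Complex.exp (C y - C x) := by
    rw [phaseFactor, hC]
    simp only
    rw [intervalIntegral.integral_interval_sub_left (hcc.intervalIntegrable _ _)
      (hcc.intervalIntegrable _ _)]
    congr 1
    exact intervalIntegral.integral_congr fun z hz => (hceq z (uIcc_subset_Icc hx hy hz)).symm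
  have h2 := (hconst x hx).trans (hconst y hy).symm
  have h3 : Complex.exp (C y) * Complex.exp (-C y) = 1 := by rw [← Complex.exp_add]; simp
  rw [h1, sub_eq_add_neg, Complex.exp_add]
  linear_combination Complex.exp (C y) * h2 + n y * h3

/-- In terms of the components in the frame without rotation, the bracket of the fundamental
fields carries no phase. -/
lemma gaugeFactor_mul_muBracket (hR : 0 < R) (hμ : IsBeltrami R μ)
    (hV : ∀ x ∈ Icc 0 R, HasDerivWithinAt V (Vx x) (Icc 0 R) x)
    (h1 : ∀ x ∈ Icc 0 R, conj (rotComp (V x)) * rotComp (V x) * (1 - μ x * conj (μ x)) = 1)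
    (h2 : ∀ x ∈ Icc 0 R, wComp (V x) = μ x * conj (rotComp (V x)))
    (hq : ∀ x ∈ Icc 0 R, q x = hComp ((V x).adjugate * Vx x))
    (hθ : ∀ x, HasDerivAt θ (2 * q x) x) (G₂ : ℝ) {x y : ℝ} (hx : x ∈ Icc 0 R)
    (hy : y ∈ Icc 0 R) :
    gaugeFactor θ V x * muBracket R G₂ μ x y * conj (gaugeFactor θ V y) =
      4 * Real.pi * G₂ * (if y ≤ x then 1 else 0) / (Real.sqrt x * Real.sqrt y) := by
  have e1 := unitPhase_mul_phaseFactor hR hμ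
    (fun x hx => hasDerivWithinAt_unitPhase hR hμ hV h1 h2 hq hθ hx) hx hy
  have e2 := unitPhase_mul_conj θ (h1 y hy)
  have e3 : conj (unitPhase θ V μ y) =
      conj (gaugeFactor θ V y) * (1 - μ y * conj (μ y)) := by
    simp only [unitPhase, map_mul, map_sub, map_one, Complex.conj_conj]
    ring
  rw [e3, ← e1] at e2
  simp only [unitPhase] at e2
  rw [muBracket, div_eq_mul_inv, div_eq_mul_inv, div_eq_mul_inv, mul_inv]
  linear_combination (4 * Real.pi * G₂ * (if y ≤ x then 1 else 0) * (Real.sqrt x : ℂ)⁻¹ *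
    (Real.sqrt y : ℂ)⁻¹) * e2

end Phase

/-! ### Holonomies from the axis and their variation -/

section Holonomy

variable {R l : ℝ} {V : ℝ → Mat2} {κ q : ℝ → ℝ} {p : ℝ → ℂ} {S : ℝ → Mat2}

/-- In the coordinate `r = √(l - z)` the deformation factor is `(1 - z / l)^{-1/2} = √l / r`; the
factor `2 r` from the substitution cancels the pole. -/
lemma smul_connHat_eq_radialConn (hl : 0 < l) (hlR : l ≤ R)
    (hQ : ∀ x ∈ Icc 0 R, connQ R V x = q x • hMat) (hP : ∀ x ∈ Icc 0 R, connP R V x = kMat (p x))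
    (hκ : κ l = Real.sqrt l) {r : ℝ} (hr : 0 < r) (hr' : r < Real.sqrt l) :
    (2 * r) • connHat R V l (l - r ^ 2) = radialConn κ q p l r := by
  have hs : 0 < Real.sqrt l := Real.sqrt_pos.mpr hl
  have hrl : r ^ 2 < l := (Real.lt_sqrt hr.le).mp hr'
  have hx : l - r ^ 2 ∈ Icc 0 R := ⟨by linarith, by nlinarith⟩
  have e1 : Real.sqrt (1 - (l - r ^ 2) / l) = r / Real.sqrt l := by
    have : 1 - (l - r ^ 2) / l = r ^ 2 / l := by field_simp; ring
    rw [this, Real.sqrt_div (sq_nonneg r), Real.sqrt_sq hr.le]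
  rw [connHat, hQ _ hx, hP _ hx, e1, radialConn, hκ, smul_add, smul_smul, smul_smul]
  congr 2
  field_simp

/-- The holonomies in terms of the solution of the regularised equation. -/
lemma holonomy_eq (hl : 0 < l) (hlR : l ≤ R)
    (hQ : ∀ x ∈ Icc 0 R, connQ R V x = q x • hMat) (hP : ∀ x ∈ Icc 0 R, connP R V x = kMat (p x))
    (hκ : κ l = Real.sqrt l) (hc : Continuous (radialConn κ q p l)) (h0 : S 0 = 1)
    (hS : ∀ r, HasDerivAt S (radialConn κ q p l r * S r) r) {r : ℝ} (hr : 0 ≤ r)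
    (hr' : r ≤ Real.sqrt l) :
    holonomy R V l (l - r ^ 2) l = S r ∧ holonomy R V l l (l - r ^ 2) = (S r).adjugate := by
  have hAB : ∀ s, 0 < s → s < Real.sqrt l →
      (2 * s) • connHat R V l (l - s ^ 2) = radialConn κ q p l s := fun s hs hs' =>
    smul_connHat_eq_radialConn hl hlR hQ hP hκ hs hs'
  have e1 := pathOrderedExp_eq hc (fun r => trace_radialConn l r) le_rfl (Real.sqrt_nonneg l) hr hr'
    hAB h0 hS
  have e2 := pathOrderedExp_eq hc (fun r => trace_radialConn l r) hr hr' le_rfl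
    (Real.sqrt_nonneg l) hAB h0 hS
  have z : l - (0 : ℝ) ^ 2 = l := by ring
  rw [z, h0] at e1 e2
  exact ⟨by simpa [holonomy] using e1, by simpa [holonomy] using e2⟩

end Holonomy

/-- Integration by parts in the variation of the holonomy: the variation `ξ` of the zweibein, with
components `h` and `v`, is multiplied by the factors `1` and `r / √l` in `𝔥` and `𝔨`. -/
lemma integral_variation {a b : ℝ} {κ : ℝ → ℝ} {p : ℝ → ℂ} {η ηl : ℝ → ℝ → ℝ} {w wl : ℝ → ℝ → ℂ}
    (hp : Continuous p) (hrp : IsRadialPair a b κ p η ηl w wl) {v v' : ℝ → ℂ} {h h' : ℝ → ℝ}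
    (hv : ∀ z, HasDerivAt v (v' z) z) (hv' : Continuous v') (hh : ∀ z, HasDerivAt h (h' z) z)
    (hh' : Continuous h') {l : ℝ} (hl : 0 < l) (hκ : κ l = Real.sqrt l) :
    (2 * (conj (w l (Real.sqrt l)) * v 0).re - 2 * η l (Real.sqrt l) * h 0) +
      ∫ r in (0 : ℝ)..Real.sqrt l,
        (2 * (conj (w l r) * (2 * Real.sqrt l * (v' (l - r ^ 2) +
            2 * Complex.I * h (l - r ^ 2) * p (l - r ^ 2)))).re -
          2 * η l r * (2 * r * (h' (l - r ^ 2) + 2 * (conj (p (l - r ^ 2)) * v (l - r ^ 2)).im))) =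
      ∫ r in (0 : ℝ)..Real.sqrt l, 4 / Real.sqrt l * (conj (w l r) *
        (((l - r ^ 2 : ℝ) : ℂ) * v' (l - r ^ 2) + 1 / 2 * v (l - r ^ 2))).re := by
  have hs : 0 < Real.sqrt l := Real.sqrt_pos.mpr hl
  have hs2 : Real.sqrt l ^ 2 = l := Real.sq_sqrt hl.le
  have cv : Continuous v := continuous_iff_continuousAt.mpr fun z => (hv z).continuousAt
  have ch : Continuous h := continuous_iff_continuousAt.mpr fun z => (hh z).continuousAt
  have cz : Continuous fun r : ℝ => l - r ^ 2 := by fun_prop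
  have cη : Continuous fun r => η l r := hrp.cont_eta.comp (Continuous.prodMk_right l)
  have cw : Continuous fun r => w l r := hrp.cont_omega.comp (Continuous.prodMk_right l)
  set f₁ : ℝ → ℝ := fun r => 2 * (conj (w l r) * (2 * Real.sqrt l * (v' (l - r ^ 2) +
      2 * Complex.I * h (l - r ^ 2) * p (l - r ^ 2)))).re -
    2 * η l r * (2 * r * (h' (l - r ^ 2) + 2 * (conj (p (l - r ^ 2)) * v (l - r ^ 2)).im)) with hf₁
  set f₂ : ℝ → ℝ := fun r => 4 / Real.sqrt l * (conj (w l r) *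
        (((l - r ^ 2 : ℝ) : ℂ) * v' (l - r ^ 2) + 1 / 2 * v (l - r ^ 2))).re with hf₂
  have cwc : Continuous fun r => conj (w l r) := Complex.continuous_conj.comp cw
  have chC : Continuous fun r : ℝ => (h (l - r ^ 2) : ℂ) :=
    Complex.continuous_ofReal.comp (ch.comp cz)
  have c1 : Continuous f₁ := by
    refine (continuous_const.mul (Complex.continuous_re.comp (cwc.mul (continuous_const.mul
      ((hv'.comp cz).add ((continuous_const.mul chC).mul (hp.comp cz))))))).sub
      ((continuous_const.mul cη).mul ((continuous_const.mul continuous_id).mul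
        ((hh'.comp cz).add (continuous_const.mul (Complex.continuous_im.comp
          ((Complex.continuous_conj.comp (hp.comp cz)).mul (cv.comp cz)))))))
  have c2 : Continuous f₂ := continuous_const.mul (Complex.continuous_re.comp (cwc.mul
    (((Complex.continuous_ofReal.comp cz).mul (hv'.comp cz)).add
      (continuous_const.mul (cv.comp cz)))))
  -- The trace of the section with `ξ`, with `ξ` scaled by `r / √l` in `𝔨`. It vanishes at `r = 0`,
  -- where `η` does, and at `r = √l` it is the boundary term on the axis.
  set E : ℝ → ℝ := fun r => -2 * (η l r * h (l - r ^ 2)) +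
    r / Real.sqrt l * (2 * (conj (w l r) * v (l - r ^ 2)).re) with hE
  have dE : ∀ r, HasDerivAt E (f₂ r - f₁ r) r := by
    intro r
    have dz : HasDerivAt (fun r : ℝ => l - r ^ 2) (-(2 * r)) r := by
      simpa using (hasDerivAt_pow 2 r).const_sub l
    have d1 := (hh (l - r ^ 2)).comp r dz
    have d2 := (hv (l - r ^ 2)).scomp r dz
    have d3 : HasDerivAt (fun r => conj (w l r))
        (conj (4 * κ l * Complex.I * p (l - r ^ 2) * η l r)) r :=
      Complex.conjCLE.toContinuousLinearMap.hasFDerivAt.comp_hasDerivAt r (hrp.deriv_omega_r l r)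
    have d4 : HasDerivAt (fun r => (conj (w l r) * v (l - r ^ 2)).re) _ r :=
      Complex.reCLM.hasFDerivAt.comp_hasDerivAt r (d3.mul d2)
    refine ((((hrp.deriv_eta_r l r).mul d1).const_mul (-2)).add
      (((hasDerivAt_id r).div_const (Real.sqrt l)).mul (d4.const_mul 2))).congr_deriv ?_
    simp only [hf₁, hf₂, Function.comp_apply, Complex.reCLM_apply, hκ, id]
    have q1 : ((r : ℂ) ^ 2).re = r ^ 2 := by rw [← Complex.ofReal_pow, Complex.ofReal_re]
    have q2 : ((r : ℂ) ^ 2).im = 0 := by rw [← Complex.ofReal_pow, Complex.ofReal_im]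
    obtain ⟨p0, p1⟩ := p (l - r ^ 2)
    obtain ⟨w0, w1⟩ := w l r
    obtain ⟨v0, v1⟩ := v (l - r ^ 2)
    obtain ⟨v0', v1'⟩ := v' (l - r ^ 2)
    simp [q1, q2]
    field_simp
    rw [show l = Real.sqrt l ^ 2 from hs2.symm, Real.sqrt_sq hs.le]
    ring
  have hint := intervalIntegral.integral_eq_sub_of_hasDerivAt (a := 0) (b := Real.sqrt l)
    (fun r _ => dE r) ((c2.sub c1).intervalIntegrable _ _)
  rw [intervalIntegral.integral_sub (c2.intervalIntegrable _ _) (c1.intervalIntegrable _ _)] at hint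
  have e0 : E 0 = 0 := by simp [hE, hrp.eta_zero]
  have e1 : E (Real.sqrt l) = 2 * (conj (w l (Real.sqrt l)) * v 0).re -
      2 * η l (Real.sqrt l) * h 0 := by
    simp only [hE, hs2, sub_self, div_self hs.ne']
    ring
  rw [e0, e1] at hint
  linarith

/-- The change of the order of integration over the triangle `0 ≤ z ≤ l`. -/
lemma integral_triangle {a b R : ℝ} {H : ℝ → ℝ → ℝ} (hH : Continuous fun x : ℝ × ℝ => H x.1 x.2)
    (hR : 0 ≤ R) (hbR : b ≤ R) (hsupp : ∀ l ∉ Icc a b, ∀ r, H l r = 0) :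
    ∫ l in (0 : ℝ)..R, ∫ r in (0 : ℝ)..Real.sqrt l, H l r =
      ∫ z in (0 : ℝ)..R, ∫ r in (0 : ℝ)..Real.sqrt R, H (z + r ^ 2) r := by
  have hRs := Real.sqrt_nonneg R
  have hm : MeasurableSet {x : ℝ × ℝ | x.2 ^ 2 ≤ x.1} :=
    (isClosed_le (by fun_prop) (by fun_prop)).measurableSet
  set K : ℝ → ℝ → ℝ := fun l r => {x : ℝ × ℝ | x.2 ^ 2 ≤ x.1}.indicator (fun x => H x.1 x.2) (l, r)
    with hK
  have hK1 : ∀ l r, r ^ 2 ≤ l → K l r = H l r := fun l r h =>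
    indicator_of_mem (s := {x : ℝ × ℝ | x.2 ^ 2 ≤ x.1}) h _
  have hK0 : ∀ l r, ¬ r ^ 2 ≤ l → K l r = 0 := fun l r h =>
    indicator_of_notMem (s := {x : ℝ × ℝ | x.2 ^ 2 ≤ x.1}) h _
  have hKi : Integrable (Function.uncurry K)
      ((volume.restrict (Ioc 0 R)).prod (volume.restrict (Ioc 0 (Real.sqrt R)))) := by
    have h0 : IntegrableOn (fun x : ℝ × ℝ => H x.1 x.2) (Icc 0 R ×ˢ Icc 0 (Real.sqrt R)) :=
      hH.continuousOn.integrableOn_compact (isCompact_Icc.prod isCompact_Icc)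
    have h1 := h0.mono_set (prod_mono (Ioc_subset_Icc_self (a := (0 : ℝ)) (b := R))
      (Ioc_subset_Icc_self (a := (0 : ℝ)) (b := Real.sqrt R)))
    rw [Measure.prod_restrict, ← Measure.volume_eq_prod]
    exact Integrable.indicator h1 hm
  have e1 : ∀ l ∈ Ioc 0 R, ∫ r in (0 : ℝ)..Real.sqrt l, H l r =
      ∫ r in Ioc 0 (Real.sqrt R), K l r := by
    intro l hl
    rw [intervalIntegral.integral_of_le (Real.sqrt_nonneg l),
      ← integral_indicator measurableSet_Ioc,
      ← integral_indicator measurableSet_Ioc]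
    congr 1
    funext r
    by_cases hr : r ∈ Ioc 0 (Real.sqrt R)
    · rw [indicator_of_mem hr]
      by_cases hrl : r ^ 2 ≤ l
      · rw [indicator_of_mem (show r ∈ Ioc 0 (Real.sqrt l) from ⟨hr.1, Real.le_sqrt_of_sq_le hrl⟩)]
        exact (hK1 l r hrl).symm
      · rw [indicator_of_notMem (show r ∉ Ioc 0 (Real.sqrt l) from fun h =>
          hrl ((Real.le_sqrt hr.1.le hl.1.le).mp h.2))]
        exact (hK0 l r hrl).symm
    · rw [indicator_of_notMem hr, indicator_of_notMem (show r ∉ Ioc 0 (Real.sqrt l) from fun h =>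
        hr ⟨h.1, h.2.trans (Real.sqrt_le_sqrt hl.2)⟩)]
  have e2 : ∀ r ∈ Ioc 0 (Real.sqrt R), ∫ l in Ioc 0 R, K l r =
      ∫ z in (0 : ℝ)..R, H (z + r ^ 2) r := by
    intro r hr
    have hrR : r ^ 2 ≤ R := (Real.le_sqrt hr.1.le hR).mp hr.2
    have hr0 : 0 < r ^ 2 := by have := hr.1; positivity
    have hc : Continuous fun l => H l r := hH.comp (Continuous.prodMk_left r)
    have hc' : Continuous fun z => H (z + r ^ 2) r :=
      hc.comp (by fun_prop : Continuous fun z : ℝ => z + r ^ 2)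
    have k1 : ∫ l in Ioc 0 R, K l r = ∫ l in (r ^ 2)..R, H l r := by
      rw [intervalIntegral.integral_of_le hrR, ← integral_Icc_eq_integral_Ioc (x := r ^ 2),
        ← integral_indicator measurableSet_Ioc, ← integral_indicator measurableSet_Icc]
      congr 1
      funext l
      by_cases hl : l ∈ Icc (r ^ 2) R
      · rw [indicator_of_mem hl, indicator_of_mem
          (show l ∈ Ioc 0 R from ⟨hr0.trans_le hl.1, hl.2⟩)]
        exact hK1 l r hl.1
      · rw [indicator_of_notMem hl]
        refine indicator_apply_eq_zero.mpr fun hl' => ?_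
        exact hK0 l r fun h => hl ⟨h, hl'.2⟩
    have k2 : ∫ l in (r ^ 2)..R, H l r = ∫ z in (0 : ℝ)..(R - r ^ 2), H (z + r ^ 2) r := by
      rw [intervalIntegral.integral_comp_add_right (fun l => H l r), zero_add, sub_add_cancel]
    have k3 : ∫ z in (R - r ^ 2)..R, H (z + r ^ 2) r = 0 := by
      rw [intervalIntegral.integral_of_le (by linarith)]
      refine setIntegral_eq_zero_of_forall_eq_zero fun z hz => ?_
      exact hsupp _ (fun h => by linarith [h.2, hz.1]) r
    rw [k1, k2, ← intervalIntegral.integral_add_adjacent_intervals (a := 0)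
      (b := R - r ^ 2) (c := R)
      (hc'.intervalIntegrable _ _) (hc'.intervalIntegrable _ _), k3, add_zero]
  have hc2 : Continuous fun x : ℝ × ℝ => H (x.1 + x.2 ^ 2) x.2 :=
    hH.comp (by fun_prop : Continuous fun x : ℝ × ℝ => (x.1 + x.2 ^ 2, x.2))
  rw [intervalIntegral.integral_of_le hR, setIntegral_congr_fun measurableSet_Ioc e1,
    integral_integral_swap hKi, setIntegral_congr_fun measurableSet_Ioc e2,
    ← intervalIntegral.integral_of_le hRs]
  refine intervalIntegral_intervalIntegral_swap
    (F := fun r z => H (z + r ^ 2) r) ((hc2.comp continuous_swap).continuousOn.integrableOn_compact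
      (isCompact_uIcc.prod isCompact_uIcc) |>.mono_set
        (prod_mono uIoc_subset_uIcc uIoc_subset_uIcc))

/-! ### The variation of the smeared holonomies -/

/-- The fields of a zweibein `V` on `[0, R]`: its derivative, the components `q` and `p` of its
connection, extended to continuously differentiable functions on the line, and the angle `θ` by
which `q` rotates. -/
structure IsBackground (R : ℝ) (V Vx : ℝ → Mat2) (q q' : ℝ → ℝ) (p p' : ℝ → ℂ) (θ : ℝ → ℝ) :
    Prop where
  deriv_x : ∀ x ∈ Icc 0 R, HasDerivWithinAt V (Vx x) (Icc 0 R) x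
  q_eq : ∀ x ∈ Icc 0 R, q x = hComp ((V x).adjugate * Vx x)
  p_eq : ∀ x ∈ Icc 0 R, p x = wComp ((V x).adjugate * Vx x)
  connQ_eq : ∀ x ∈ Icc 0 R, connQ R V x = q x • hMat
  connP_eq : ∀ x ∈ Icc 0 R, connP R V x = kMat (p x)
  deriv_q : ∀ x, HasDerivAt q (q' x) x
  cont_q' : Continuous q'
  deriv_p : ∀ x, HasDerivAt p (p' x) x
  cont_p' : Continuous p'
  deriv_angle : ∀ x, HasDerivAt θ (2 * q x) x

lemma continuous_of_hasDerivAt {E : Type*} [NormedAddCommGroup E] [NormedSpace ℝ E] {f f' : ℝ → E}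
    (h : ∀ x, HasDerivAt f (f' x) x) : Continuous f :=
  continuous_iff_continuousAt.mpr fun x => (h x).continuousAt

lemma continuousOn_adjugate {X : Type*} [TopologicalSpace X] {f : X → Mat2} {s : Set X}
    (h : ContinuousOn f s) : ContinuousOn (fun x => (f x).adjugate) s := by
  simp only [continuousOn_iff_continuous_domRestrict] at h ⊢
  exact continuous_adjugate h

lemma continuousOn_hComp {X : Type*} [TopologicalSpace X] {f : X → Mat2} {s : Set X}
    (h : ContinuousOn f s) : ContinuousOn (fun x => hComp (f x)) s := by
  simp only [continuousOn_iff_continuous_domRestrict] at h ⊢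
  exact continuous_hComp h

lemma continuousOn_wComp {X : Type*} [TopologicalSpace X] {f : X → Mat2} {s : Set X}
    (h : ContinuousOn f s) : ContinuousOn (fun x => wComp (f x)) s := by
  simp only [continuousOn_iff_continuous_domRestrict] at h ⊢
  exact continuous_wComp h

namespace IsStripFamily

variable {δ R : ℝ} {V Vt Vx Vxt Vxx : ℝ → ℝ → Mat2}

lemma exists_background (h : IsStripFamily δ R V Vt Vx Vxt Vxx) (hδ : 0 < δ) (hR : 0 < R) :
    ∃ q q' p p' θ, IsBackground R (V 0) (Vx 0) q q' p p' θ := by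
  have h0 : (0 : ℝ) ∈ Ioo (-δ) δ := ⟨by linarith, hδ⟩
  have hm : MapsTo (fun x : ℝ => ((0 : ℝ), x)) (Icc 0 R) (Ioo (-δ) δ ×ˢ Icc 0 R) :=
    fun x hx => mk_mem_prod h0 hx
  have hc : Continuous fun x : ℝ => ((0 : ℝ), x) := by fun_prop
  have k0 : ContinuousOn (V 0) (Icc 0 R) := h.cont.comp hc.continuousOn hm
  have k1 : ContinuousOn (Vx 0) (Icc 0 R) := h.cont_x.comp hc.continuousOn hm
  have k2 : ContinuousOn (Vxx 0) (Icc 0 R) := h.cont_xx.comp hc.continuousOn hm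
  set J' : ℝ → Mat2 := fun x => (Vx 0 x).adjugate * Vx 0 x + (V 0 x).adjugate * Vxx 0 x with hJ'
  have cJ' : ContinuousOn J' (Icc 0 R) :=
    ((continuousOn_adjugate k1).mul k1).add ((continuousOn_adjugate k0).mul k2)
  have dJ : ∀ x ∈ Icc 0 R, HasDerivWithinAt (fun x => (V 0 x).adjugate * Vx 0 x) (J' x)
      (Icc 0 R) x := fun x hx =>
    (hasDerivWithinAt_adjugate (h.deriv_x 0 h0 x hx)).mul (h.deriv_xx 0 h0 x hx)
  obtain ⟨q, q', hq', hq, hqe, -⟩ := exists_C1_extension hR.le (continuousOn_hComp cJ')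
    fun x hx => hasDerivWithinAt_hComp (dJ x hx)
  obtain ⟨p, p', hp', hp, hpe, -⟩ := exists_C1_extension hR.le (continuousOn_wComp cJ')
    fun x hx => hasDerivWithinAt_wComp (dJ x hx)
  have cq : Continuous fun x => 2 * q x := continuous_const.mul (continuous_of_hasDerivAt hq)
  exact ⟨q, q', p, p', fun x => ∫ s in (0 : ℝ)..x, 2 * q s, h.deriv_x 0 h0, hqe, hpe,
    fun x hx => by rw [h.connQ_eq hR h0 hx, hqe hx],
    fun x hx => by rw [h.connP_eq hR h0 hx, hpe hx], hq, hq', hp, hp',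
    fun x => intervalIntegral.integral_hasDerivAt_right (cq.intervalIntegrable _ _)
      (cq.stronglyMeasurableAtFilter _ _) cq.continuousAt⟩

/-- The variation of the connection at the base point of the family. -/
def connVar (V Vt Vx Vxt : ℝ → ℝ → Mat2) (t x : ℝ) : Mat2 :=
  (Vt t x).adjugate * Vx t x + (V t x).adjugate * Vxt t x

/-- The components of the variation of the connection in terms of those of `ξ = V⁻¹ δV`. -/
lemma hComp_connVar (h : IsStripFamily δ R V Vt Vx Vxt Vxx) (hR : 0 < R) {t x : ℝ}
    (ht : t ∈ Ioo (-δ) δ) (hx : x ∈ Icc 0 R) :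
    hComp (connVar V Vt Vx Vxt t x) =
      hComp ((Vx t x).adjugate * Vt t x + (V t x).adjugate * Vxt t x) +
      2 * (conj (wComp ((V t x).adjugate * Vx t x)) * wComp ((V t x).adjugate * Vt t x)).im := by
  have e := eq_of_components (h.trace_adjugate_mul_x hR ht hx)
  rw [connVar, h.connection_variation hR ht hx, hComp_add]
  set J := (V t x).adjugate * Vx t x
  rw [← one_smul ℝ (kMat (wComp J))] at e
  conv_lhs => rw [e, hComp_commutator]
  ring

lemma wComp_connVar (h : IsStripFamily δ R V Vt Vx Vxt Vxx) (hR : 0 < R) {t x : ℝ}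
    (ht : t ∈ Ioo (-δ) δ) (hx : x ∈ Icc 0 R) :
    wComp (connVar V Vt Vx Vxt t x) =
      wComp ((Vx t x).adjugate * Vt t x + (V t x).adjugate * Vxt t x) -
      2 * Complex.I * hComp ((V t x).adjugate * Vx t x) * wComp ((V t x).adjugate * Vt t x) +
      2 * Complex.I * hComp ((V t x).adjugate * Vt t x) * wComp ((V t x).adjugate * Vx t x) := by
  have e := eq_of_components (h.trace_adjugate_mul_x hR ht hx)
  rw [connVar, h.connection_variation hR ht hx, wComp_add]
  set J := (V t x).adjugate * Vx t x
  rw [← one_smul ℝ (kMat (wComp J))] at e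
  conv_lhs => rw [e, wComp_commutator]
  push_cast
  ring

end IsStripFamily

/-- The trace against a fixed matrix, as a continuous linear map. -/
def traceMulCLM (φ : Mat2) : Mat2 →L[ℝ] ℝ :=
  LinearMap.toContinuousLinearMap ((Matrix.traceLinearMap (Fin 2) ℝ ℝ).comp
    (LinearMap.mulLeft ℝ φ))

lemma traceMulCLM_apply (φ M : Mat2) : traceMulCLM φ M = (φ * M).trace := rfl

lemma hasDerivAt_trace {f : ℝ → Mat2} {f' : Mat2} {x : ℝ} (h : HasDerivAt f f' x) :
    HasDerivAt (fun x => (f x).trace) f'.trace x := by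
  have := (traceMulCLM 1).hasFDerivAt.comp_hasDerivAt x h
  simpa [traceMulCLM_apply, Function.comp_def] using this

lemma continuous_trace {X : Type*} [TopologicalSpace X] {f : X → Mat2} (h : Continuous f) :
    Continuous fun x => (f x).trace := by
  have := (traceMulCLM 1).continuous.comp h
  simpa [traceMulCLM_apply, Function.comp_def] using this

lemma mul_det_eq_one {M N : Mat2} (hM : M.det = 1) (hN : N.det = 1) : (M * N).det = 1 := by
  rw [Matrix.det_mul, hM, hN, mul_one]

/-- If `F` is differentiable along the curve `t = (δ / 2) sin τ`, it is differentiable. -/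
lemma hasDerivAt_of_comp_sin {F : ℝ → ℝ} {δ c : ℝ} (hδ : 0 < δ)
    (h : HasDerivAt (fun τ => F (δ / 2 * Real.sin τ)) (δ / 2 * c) 0) : HasDerivAt F c 0 := by
  have h1 : HasDerivAt (fun t : ℝ => Real.arcsin (2 / δ * t)) (2 / δ) 0 := by
    have h2 := Real.hasDerivAt_arcsin (x := 2 / δ * 0) (by norm_num) (by norm_num)
    have h3 := h2.comp 0 ((hasDerivAt_id (0 : ℝ)).const_mul (2 / δ))
    simpa [Function.comp_def] using h3
  have h0 : Real.arcsin (2 / δ * 0) = 0 := by simp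
  rw [← h0] at h
  have h2 := h.comp 0 h1
  refine (h2.congr_of_eventuallyEq ?_).congr_deriv ?_
  · have : Ioo (-(δ / 2)) (δ / 2) ∈ 𝓝 (0 : ℝ) := Ioo_mem_nhds (by linarith) (by linarith)
    filter_upwards [this] with t ht
    have e1 : 2 / δ * t ≤ 1 := by
      rw [div_mul_eq_mul_div, div_le_one hδ]; linarith [ht.2]
    have e2 : -1 ≤ 2 / δ * t := by
      rw [div_mul_eq_mul_div, le_div_iff₀ hδ]; linarith [ht.1]
    simp only [Function.comp_apply]
    rw [Real.sin_arcsin e2 e1]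
    congr 1
    field_simp
  · field_simp

section Variation

variable {δ R a b : ℝ} {V Vt Vx Vxt Vxx : ℝ → ℝ → Mat2} {κ : ℝ → ℝ} {φ : ℝ → Mat2}

/-- The variation of the deformed connection, in the radial coordinate. -/
def radialVar (κ : ℝ → ℝ) (dJ : ℝ → Mat2) (l r : ℝ) : Mat2 :=
  (2 * r * hComp (dJ (l - r ^ 2))) • hMat + (2 * κ l) • kMat (wComp (dJ (l - r ^ 2)))

lemma trace_mul_rotate (φ S T N : Mat2) : (φ * (T * N * S)).trace = (S * φ * T * N).trace := by
  rw [Matrix.trace_mul_comm (S * φ * T) N, ← Matrix.mul_assoc, ← Matrix.mul_assoc,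
    Matrix.trace_mul_comm _ S, Matrix.trace_mul_comm N]
  simp only [Matrix.mul_assoc]

/-- The derivative at `τ = 0` of a smeared holonomy, for a connection with components `J τ x`
depending on a parameter. -/
lemma exists_hasDerivAt_smeared_aux {M M' : ℝ → Mat2} {J J' : ℝ → ℝ → Mat2}
    (cM : Continuous M) (cM' : Continuous M') (dM : ∀ τ, HasDerivAt M (M' τ) τ)
    (hM : (M 0).det = 1)
    (cJ : Continuous fun x : ℝ × ℝ => J x.1 x.2) (cJ' : Continuous fun x : ℝ × ℝ => J' x.1 x.2)
    (dJ : ∀ τ x, HasDerivAt (fun τ => J τ x) (J' τ x) τ) (hκ : Continuous κ) (hφ : Continuous φ) :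
    ∃ S : ℝ → ℝ → ℝ → Mat2, (∀ l τ, S l τ 0 = 1) ∧ (∀ l τ r, (S l τ r).det = 1) ∧
      (∀ l τ r, HasDerivAt (S l τ)
        (radialConn κ (fun x => hComp (J τ x)) (fun x => wComp (J τ x)) l r * S l τ r) r) ∧
      (∀ l τ, Continuous (radialConn κ (fun x => hComp (J τ x)) (fun x => wComp (J τ x)) l)) ∧
      HasDerivAt (fun τ => ∫ l in (0 : ℝ)..R,
          (φ l * (M 0 * S l 0 (Real.sqrt l)).adjugate * (M τ * S l τ (Real.sqrt l))).trace)
        (∫ l in (0 : ℝ)..R, ((adjointSection (fun l r => S l 0 r) φ l (Real.sqrt l) *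
            ((M 0).adjugate * M' 0)).trace +
          ∫ r in (0 : ℝ)..Real.sqrt l, (adjointSection (fun l r => S l 0 r) φ l r *
            radialVar κ (J' 0) l r).trace)) 0 := by
  have hz : Continuous fun x : ℝ × ℝ × ℝ => (x.2.1, x.1 - x.2.2 ^ 2) := by fun_prop
  have cl1 : Continuous fun x : ℝ × ℝ × ℝ => 2 * κ x.1 :=
    continuous_const.mul (hκ.comp continuous_fst)
  have cr1 : Continuous fun x : ℝ × ℝ × ℝ => 2 * x.2.2 := by fun_prop
  have cJz : Continuous fun x : ℝ × ℝ × ℝ => J x.2.1 (x.1 - x.2.2 ^ 2) := cJ.comp hz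
  have cJz' : Continuous fun x : ℝ × ℝ × ℝ => J' x.2.1 (x.1 - x.2.2 ^ 2) := cJ'.comp hz
  have cA : Continuous fun x : ℝ × ℝ × ℝ => radialConn κ (fun y => hComp (J x.2.1 y))
      (fun y => wComp (J x.2.1 y)) x.1 x.2.2 :=
    ((cr1.mul (continuous_hComp cJz)).smul continuous_const).add
      (cl1.smul (continuous_kMat (continuous_wComp cJz)))
  have cA' : Continuous fun x : ℝ × ℝ × ℝ => radialVar κ (J' x.2.1) x.1 x.2.2 :=
    ((cr1.mul (continuous_hComp cJz')).smul continuous_const).add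
      (cl1.smul (continuous_kMat (continuous_wComp cJz')))
  have dA : ∀ l τ r, HasDerivAt (fun τ => radialConn κ (fun y => hComp (J τ y))
      (fun y => wComp (J τ y)) l r) (radialVar κ (J' τ) l r) τ := by
    intro l τ r
    have k := dJ τ (l - r ^ 2)
    exact (((hasDerivAt_hComp k).const_mul (2 * r)).smul_const hMat).add
      ((hasDerivAt_kMat (hasDerivAt_wComp k)).const_smul (2 * κ l))
  obtain ⟨S, S', cS, cS', hS0, hSdet, hSr, hSp, hSf⟩ := exists_param_ode
    (A := fun l τ r => radialConn κ (fun y => hComp (J τ y)) (fun y => wComp (J τ y)) l r)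
    (A' := fun l τ r => radialVar κ (J' τ) l r) cA cA' dA (fun l τ r => trace_radialConn l r)
  refine ⟨S, hS0, hSdet, hSr, fun l τ =>
    cA.comp (by fun_prop : Continuous fun r : ℝ => (l, τ, r)), ?_⟩
  have hm3 : Continuous fun x : ℝ × ℝ => (x.2, x.1, Real.sqrt x.2) := by fun_prop
  have cS3 : Continuous fun x : ℝ × ℝ => S x.2 x.1 (Real.sqrt x.2) := cS.comp hm3
  have cS3' : Continuous fun x : ℝ × ℝ => S' x.2 x.1 (Real.sqrt x.2) := cS'.comp hm3
  have cN : Continuous fun x : ℝ × ℝ => φ x.2 * (M 0 * S x.2 0 (Real.sqrt x.2)).adjugate := by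
    have k : Continuous fun x : ℝ × ℝ => S x.2 0 (Real.sqrt x.2) :=
      cS.comp (by fun_prop : Continuous fun x : ℝ × ℝ => (x.2, (0 : ℝ), Real.sqrt x.2))
    exact (hφ.comp continuous_snd).mul (continuous_adjugate (continuous_const.mul k))
  have cM1 : Continuous fun x : ℝ × ℝ => M x.1 := cM.comp continuous_fst
  have cM1' : Continuous fun x : ℝ × ℝ => M' x.1 := cM'.comp continuous_fst
  have key := hasDerivAt_integral_param
    (f := fun τ l => (φ l * (M 0 * S l 0 (Real.sqrt l)).adjugate *
      (M τ * S l τ (Real.sqrt l))).trace)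
    (f' := fun τ l => (φ l * (M 0 * S l 0 (Real.sqrt l)).adjugate *
      (M' τ * S l τ (Real.sqrt l) + M τ * S' l τ (Real.sqrt l))).trace)
    (continuous_trace (cN.mul (cM1.mul cS3)))
    (continuous_trace (cN.mul ((cM1'.mul cS3).add (cM1.mul cS3'))))
    (fun τ l => hasDerivAt_trace (((dM τ).mul (hSp l τ (Real.sqrt l))).const_mul _)) 0 R 0
  refine key.congr_deriv (intervalIntegral.integral_congr fun l _ => ?_)
  set s := Real.sqrt l
  have hadj : (M 0 * S l 0 s).adjugate = (S l 0 s).adjugate * (M 0).adjugate :=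
    Matrix.adjugate_mul_distrib _ _
  have cSl : Continuous fun r => S l 0 r :=
    cS.comp (by fun_prop : Continuous fun r : ℝ => (l, (0 : ℝ), r))
  have cRl : Continuous fun r => radialVar κ (J' 0) l r :=
    cA'.comp (by fun_prop : Continuous fun r : ℝ => (l, (0 : ℝ), r))
  have e1 : φ l * (M 0 * S l 0 s).adjugate * (M 0 * S' l 0 s) =
      φ l * ∫ r in (0 : ℝ)..s, (S l 0 r).adjugate * radialVar κ (J' 0) l r * S l 0 r := by
    have k1 := adjugate_mul_of_det hM
    have k2 := adjugate_mul_of_det (hSdet l 0 s)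
    rw [hadj, hSf]
    have k3 : ∀ I : Mat2, φ l * ((S l 0 s).adjugate * (M 0).adjugate) * (M 0 * (S l 0 s * I)) =
        φ l * ((S l 0 s).adjugate * ((M 0).adjugate * M 0) * S l 0 s) * I := fun I => by
      simp only [mul_assoc]
    rw [k3, k1, mul_one, k2, mul_one]
  have e2 : φ l * (M 0 * S l 0 s).adjugate * (M' 0 * S l 0 s) =
      φ l * ((S l 0 s).adjugate * ((M 0).adjugate * M' 0) * S l 0 s) := by
    rw [hadj]
    simp only [mul_assoc]
  have e3 : (φ l * ∫ r in (0 : ℝ)..s, (S l 0 r).adjugate * radialVar κ (J' 0) l r * S l 0 r).trace =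
      ∫ r in (0 : ℝ)..s, (adjointSection (fun l r => S l 0 r) φ l r *
        radialVar κ (J' 0) l r).trace := by
    have ci : Continuous fun r => (S l 0 r).adjugate * radialVar κ (J' 0) l r * S l 0 r :=
      ((continuous_adjugate cSl).mul cRl).mul cSl
    rw [← traceMulCLM_apply,
      ← (traceMulCLM (φ l)).intervalIntegral_comp_comm (ci.intervalIntegrable _ _)]
    refine intervalIntegral.integral_congr fun r _ => ?_
    simp only [traceMulCLM_apply, trace_mul_rotate, adjointSection]
  rw [mul_add, Matrix.trace_add, e1, e2, trace_mul_rotate, e3]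
  rfl

lemma sin_mem_strip (hδ : 0 < δ) (τ : ℝ) : δ / 2 * Real.sin τ ∈ Ioo (-δ) δ := by
  have h1 := Real.neg_one_le_sin τ
  have h2 := Real.sin_le_one τ
  constructor <;> nlinarith

/-- A strip family, reparametrized by `t = (δ / 2) sin τ` and frozen outside `[0, R]`, gives fields
that are defined for all values of the parameters. -/
lemma IsStripFamily.exists_reparam (h : IsStripFamily δ R V Vt Vx Vxt Vxx) (hδ : 0 < δ)
    (hR : 0 < R) : ∃ (M M' : ℝ → Mat2) (J J' : ℝ → ℝ → Mat2), Continuous M ∧ Continuous M' ∧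
      (∀ τ, HasDerivAt M (M' τ) τ) ∧ (Continuous fun x : ℝ × ℝ => J x.1 x.2) ∧
      (Continuous fun x : ℝ × ℝ => J' x.1 x.2) ∧
      (∀ τ x, HasDerivAt (fun τ => J τ x) (J' τ x) τ) ∧
      (∀ τ, M τ = V (δ / 2 * Real.sin τ) 0) ∧ M' 0 = (δ / 2) • Vt 0 0 ∧
      (∀ τ, ∀ x ∈ Icc 0 R, J τ x =
        (V (δ / 2 * Real.sin τ) x).adjugate * Vx (δ / 2 * Real.sin τ) x) ∧
      ∀ x ∈ Icc 0 R, J' 0 x = (δ / 2) • connVar V Vt Vx Vxt 0 x := by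
  have h0 : (0 : ℝ) ∈ Icc 0 R := ⟨le_rfl, hR.le⟩
  set tp : ℝ → ℝ := fun τ => δ / 2 * Real.sin τ with htp
  have htp0 : tp 0 = 0 := by simp [htp]
  have dtp : ∀ τ, HasDerivAt tp (δ / 2 * Real.cos τ) τ := fun τ =>
    (Real.hasDerivAt_sin τ).const_mul _
  have mtp : ∀ τ, tp τ ∈ Ioo (-δ) δ := sin_mem_strip hδ
  set cl : ℝ → ℝ := fun x => (projIcc 0 R hR.le x : ℝ) with hcl
  have mcl : ∀ x, cl x ∈ Icc 0 R := fun x => (projIcc 0 R hR.le x).2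
  have ecl : ∀ x ∈ Icc 0 R, cl x = x := fun x hx => by
    simp only [hcl, projIcc_of_mem hR.le hx]
  have ctp : Continuous tp := by fun_prop
  have ccl : Continuous cl := continuous_subtype_val.comp continuous_projIcc
  have cc : Continuous fun τ : ℝ => δ / 2 * Real.cos τ := by fun_prop
  have cX : Continuous fun y : ℝ × ℝ => (tp y.1, cl y.2) :=
    (ctp.comp continuous_fst).prodMk (ccl.comp continuous_snd)
  have mX : ∀ y : ℝ × ℝ, (tp y.1, cl y.2) ∈ Ioo (-δ) δ ×ˢ Icc 0 R :=
    fun y => mk_mem_prod (mtp y.1) (mcl y.2)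
  have cX0 : Continuous fun τ : ℝ => (tp τ, (0 : ℝ)) := ctp.prodMk continuous_const
  have mX0 : ∀ τ : ℝ, (tp τ, (0 : ℝ)) ∈ Ioo (-δ) δ ×ˢ Icc 0 R := fun τ => mk_mem_prod (mtp τ) h0
  have c0 := h.cont.comp_continuous cX mX
  have c1 := h.cont_x.comp_continuous cX mX
  have c2 := h.cont_t.comp_continuous cX mX
  have c3 := h.cont_xt.comp_continuous cX mX
  refine ⟨fun τ => V (tp τ) 0, fun τ => (δ / 2 * Real.cos τ) • Vt (tp τ) 0,
    fun τ x => (V (tp τ) (cl x)).adjugate * Vx (tp τ) (cl x),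
    fun τ x => (δ / 2 * Real.cos τ) • connVar V Vt Vx Vxt (tp τ) (cl x),
    h.cont.comp_continuous cX0 mX0, cc.smul (h.cont_t.comp_continuous cX0 mX0),
    fun τ => (h.deriv_t _ (mtp τ) 0 h0).scomp τ (dtp τ),
    (continuous_adjugate c0).mul c1,
    (cc.comp continuous_fst).smul (((continuous_adjugate c2).mul c1).add
      ((continuous_adjugate c0).mul c3)),
    fun τ x => ?_, fun τ => rfl, by simp [htp0], fun τ x hx => by simp only [ecl x hx, htp],
    fun x hx => by simp [htp0, ecl x hx]⟩
  exact ((hasDerivAt_adjugate (h.deriv_t _ (mtp τ) _ (mcl x))).mul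
    (h.deriv_xt _ (mtp τ) _ (mcl x))).scomp τ (dtp τ)

lemma radialVar_of_smul {dJ dJ' : ℝ → Mat2} {c l r : ℝ}
    (h : dJ' (l - r ^ 2) = c • dJ (l - r ^ 2)) :
    radialVar κ dJ' l r = c • radialVar κ dJ l r := by
  have e1 : hComp (c • dJ (l - r ^ 2)) = c * hComp (dJ (l - r ^ 2)) := by
    simp only [hComp, Matrix.smul_apply, smul_eq_mul]; ring
  have e2 : kMat (wComp (c • dJ (l - r ^ 2))) = c • kMat (wComp (dJ (l - r ^ 2))) := by
    ext i j
    fin_cases i <;> fin_cases j <;> simp [kMat, wComp] <;> ring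
  simp only [radialVar, h, e1, e2]
  module

/-- The integral of a function that vanishes off `[a, b] ⊆ (0, R]` only sees its values there. -/
lemma integral_congr_of_eq_on {f g : ℝ → ℝ} (h : ∀ l ∈ Icc a b, l ∈ Icc 0 R → f l = g l)
    (hf : ∀ l ∉ Icc a b, f l = 0) (hg : ∀ l ∉ Icc a b, g l = 0) (hR : 0 ≤ R) :
    ∫ l in (0 : ℝ)..R, f l = ∫ l in (0 : ℝ)..R, g l := by
  refine intervalIntegral.integral_congr fun l hl => ?_
  rw [uIcc_of_le hR] at hl
  by_cases hl' : l ∈ Icc a b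
  · exact h l hl' hl
  · simp only [hf l hl', hg l hl']

/-- The derivative of a smeared holonomy along a strip family. -/
lemma IsStripFamily.exists_hasDerivAt_smeared (h : IsStripFamily δ R V Vt Vx Vxt Vxx) (hδ : 0 < δ)
    (hR : 0 < R) (ha : 0 < a) (hκ : Continuous κ) (hκs : ∀ l ∈ Icc a b, κ l = Real.sqrt l)
    (hφ : Continuous φ) (hφs : ∀ l ∉ Icc a b, φ l = 0) :
    ∃ S : ℝ → ℝ → Mat2, (∀ l ∈ Icc a b, l ≤ R → ∀ r, 0 ≤ r → r ≤ Real.sqrt l →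
        holonomy R (V 0) l (l - r ^ 2) l = S l r) ∧
      HasDerivAt (fun t => ∫ l in (0 : ℝ)..R, (φ l * (U R (V 0) l)⁻¹ * U R (V t) l).trace)
        (∫ l in (0 : ℝ)..R,
          ((adjointSection S φ l (Real.sqrt l) * ((V 0 0).adjugate * Vt 0 0)).trace +
          ∫ r in (0 : ℝ)..Real.sqrt l, (adjointSection S φ l r *
            radialVar κ (connVar V Vt Vx Vxt 0) l r).trace)) 0 := by
  have h0 : (0 : ℝ) ∈ Ioo (-δ) δ := ⟨by linarith, hδ⟩
  have hz : (0 : ℝ) ∈ Icc 0 R := ⟨le_rfl, hR.le⟩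
  have hs0 : δ / 2 * Real.sin 0 = 0 := by simp
  obtain ⟨M, M', J, J', cM, cM', dM, cJ, cJ', dJ, eM, eM', eJ, eJ'⟩ := h.exists_reparam hδ hR
  have eM0 : M 0 = V 0 0 := by rw [eM, hs0]
  have hdet0 : (V 0 0).det = 1 := h.det 0 h0 0 hz
  obtain ⟨S, S0, Sdet, Sr, cA, key⟩ := exists_hasDerivAt_smeared_aux (R := R) cM cM' dM
    (by rw [eM0]; exact hdet0) cJ cJ' dJ hκ hφ
  have hol : ∀ τ, ∀ l ∈ Icc a b, l ≤ R → ∀ r, 0 ≤ r → r ≤ Real.sqrt l →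
      holonomy R (V (δ / 2 * Real.sin τ)) l (l - r ^ 2) l = S l τ r := by
    intro τ l hl hlR r hr hr'
    refine (holonomy_eq (ha.trans_le hl.1) hlR (fun x hx => ?_) (fun x hx => ?_) (hκs l hl)
      (cA l τ) (S0 l τ) (Sr l τ) hr hr').1
    · rw [h.connQ_eq hR (sin_mem_strip hδ τ) hx, eJ τ x hx]
    · rw [h.connP_eq hR (sin_mem_strip hδ τ) hx, eJ τ x hx]
  have hU : ∀ τ, ∀ l ∈ Icc a b, l ≤ R →
      U R (V (δ / 2 * Real.sin τ)) l = M τ * S l τ (Real.sqrt l) := by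
    intro τ l hl hlR
    have k := hol τ l hl hlR _ (Real.sqrt_nonneg l) le_rfl
    rw [Real.sq_sqrt (ha.le.trans hl.1), sub_self] at k
    rw [U, Vhat, k, eM]
  refine ⟨fun l r => S l 0 r, fun l hl hlR r hr hr' => by
    have k := hol 0 l hl hlR r hr hr'; rwa [hs0] at k, hasDerivAt_of_comp_sin hδ ?_⟩
  refine (key.congr_of_eventuallyEq (Eventually.of_forall fun τ => ?_)).congr_deriv ?_
  · refine integral_congr_of_eq_on (a := a) (b := b) (fun l hl hlR => ?_) (fun l hl => ?_)
      (fun l hl => ?_) hR.le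
    · have k0 := hU 0 l hl hlR.2
      rw [hs0] at k0
      rw [hU τ l hl hlR.2, k0, inv_eq_adjugate_of_det]
      exact mul_det_eq_one (by rw [eM0]; exact hdet0) (Sdet l 0 _)
    · simp [hφs l hl]
    · simp [hφs l hl]
  · rw [← intervalIntegral.integral_const_mul]
    refine integral_congr_of_eq_on (a := a) (b := b) (fun l hl hlR => ?_) (fun l hl => ?_)
      (fun l hl => ?_) hR.le
    · rw [mul_add, ← intervalIntegral.integral_const_mul, eM0, eM']
      congr 1
      · simp
      · refine intervalIntegral.integral_congr fun r hr => ?_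
        rw [uIcc_of_le (Real.sqrt_nonneg l)] at hr
        have hr2 : r ^ 2 ≤ l := by
          have := pow_le_pow_left₀ hr.1 hr.2 2
          rwa [Real.sq_sqrt (ha.le.trans hl.1)] at this
        have hx : l - r ^ 2 ∈ Icc 0 R := ⟨by linarith, by nlinarith [hlR.2]⟩
        simp [radialVar_of_smul (κ := κ) (eJ' _ hx)]
    · simp [adjointSection, hφs l hl]
    · simp [adjointSection, hφs l hl]

end Variation

/-- The variation of a smeared holonomy as a linear functional of `v`: exchanging the order of
integration produces the Abel transform of the profile, and an integration by parts removes the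
derivative of `v`. -/
lemma IsProfile.integral_pairing {a b R : ℝ} {F Fl Fr : ℝ → ℝ → ℂ} (h : IsProfile a b F Fl Fr)
    {v v' : ℝ → ℂ} (hv : ∀ z, HasDerivAt v (v' z) z) (hv' : Continuous v') (hR : 0 ≤ R)
    (hbR : b ≤ R) :
    ∫ l in (0 : ℝ)..R, ∫ r in (0 : ℝ)..Real.sqrt l, 4 * (conj (F l r) *
        (((l - r ^ 2 : ℝ) : ℂ) * v' (l - r ^ 2) + 1 / 2 * v (l - r ^ 2))).re =
      ∫ z in (0 : ℝ)..R, -(2 * (conj (z * abelCut Fl 0 (Real.sqrt R) z +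
        1 / 2 * abelCut F 0 (Real.sqrt R) z) * v z).re) := by
  have cv : Continuous v := continuous_of_hasDerivAt hv
  have cz : Continuous fun x : ℝ × ℝ => x.1 - x.2 ^ 2 := by fun_prop
  have cG : Continuous fun x : ℝ × ℝ => ((x.1 - x.2 ^ 2 : ℝ) : ℂ) * v' (x.1 - x.2 ^ 2) +
      1 / 2 * v (x.1 - x.2 ^ 2) :=
    ((Complex.continuous_ofReal.comp cz).mul (hv'.comp cz)).add
      (continuous_const.mul (cv.comp cz))
  rw [integral_triangle (a := a) (b := b) (H := fun l r => 4 * (conj (F l r) *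
    (((l - r ^ 2 : ℝ) : ℂ) * v' (l - r ^ 2) + 1 / 2 * v (l - r ^ 2))).re)
    (continuous_const.mul (Complex.continuous_re.comp
      ((Complex.continuous_conj.comp h.continuous).mul cG))) hR hbR
    (fun l hl r => by simp [h.eq_zero l hl r])]
  set W := abelCut F 0 (Real.sqrt R) with hW
  set W' := abelCut Fl 0 (Real.sqrt R) with hW'
  have dW : ∀ z, HasDerivAt W (W' z) z := fun z => h.hasDerivAt_abelCut _ _ z
  have cW : Continuous W := continuous_of_hasDerivAt dW
  have cW' : Continuous W' := by
    have := intervalIntegral.continuous_parametric_intervalIntegral_of_continuous'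
      (μ := volume) (f := fun z r => Fl (z + r ^ 2) r) h.continuous_integrand_l 0 (Real.sqrt R)
    exact continuous_const.mul this
  have inner : ∀ z, ∫ r in (0 : ℝ)..Real.sqrt R, 4 * (conj (F (z + r ^ 2) r) *
      (((z + r ^ 2 - r ^ 2 : ℝ) : ℂ) * v' (z + r ^ 2 - r ^ 2) +
        1 / 2 * v (z + r ^ 2 - r ^ 2))).re = 2 * (conj (W z) * (z * v' z + 1 / 2 * v z)).re := by
    intro z
    have ci : Continuous fun r => F (z + r ^ 2) r :=
      h.continuous_integrand.comp (by fun_prop : Continuous fun r : ℝ => (z, r))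
    have hs := Real.sqrt_nonneg R
    have key := re_conj_integral_mul (μ := volume.restrict (Ioc 0 (Real.sqrt R)))
      (f := fun r => 2 * F (z + r ^ 2) r)
      (((continuous_const.mul ci).integrableOn_Icc).mono_set Ioc_subset_Icc_self)
      (z * v' z + 1 / 2 * v z)
    have e : W z = ∫ r in Ioc 0 (Real.sqrt R), 2 * F (z + r ^ 2) r := by
      rw [hW, abelCut, intervalIntegral.integral_of_le hs, integral_const_mul]
    rw [e, key, intervalIntegral.integral_of_le hs]
    refine integral_congr_ae (Eventually.of_forall fun r => ?_)
    simp only [add_sub_cancel_right, map_mul, Complex.conj_ofNat, mul_assoc]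
    rw [show (2 : ℂ) * (conj (F (z + r ^ 2) r) * (z * v' z + 1 / 2 * v z)) =
      ((2 : ℝ) : ℂ) * (conj (F (z + r ^ 2) r) * (z * v' z + 1 / 2 * v z)) by push_cast; rfl,
      Complex.re_ofReal_mul]
    ring
  simp only [inner]
  have dT : ∀ z : ℝ, HasDerivAt (fun z : ℝ => 2 * (conj (W z) * (z * v z)).re)
      (2 * (conj (W' z) * (z * v z) + conj (W z) * (v z + z * v' z)).re) z := by
    intro z
    have k1 : HasDerivAt (fun z => conj (W z)) (conj (W' z)) z := (dW z).star
    have k2 : HasDerivAt (fun z : ℝ => (z : ℂ) * v z) (1 * v z + z * v' z) z :=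
      ((hasDerivAt_id z).ofReal_comp).mul (hv z)
    have k3 := Complex.reCLM.hasFDerivAt.comp_hasDerivAt z (k1.mul k2)
    refine (k3.const_mul 2).congr_deriv ?_
    simp
  have hint : ∀ f : ℝ → ℝ, Continuous f → IntervalIntegrable f volume 0 R :=
    fun f hf => hf.intervalIntegrable _ _
  have cc : ∀ f : ℝ → ℂ, Continuous f → Continuous fun z => conj (f z) :=
    fun f hf => Complex.continuous_conj.comp hf
  have co : Continuous fun z : ℝ => (z : ℂ) := Complex.continuous_ofReal
  have cT : Continuous fun z : ℝ =>
      2 * (conj (W' z) * (z * v z) + conj (W z) * (v z + z * v' z)).re :=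
    continuous_const.mul (Complex.continuous_re.comp
      (((cc _ cW').mul (co.mul cv)).add ((cc _ cW).mul (cv.add (co.mul hv')))))
  have ftc := intervalIntegral.integral_eq_sub_of_hasDerivAt (fun z _ => dT z) (hint _ cT)
  have hWR : W R = 0 := h.abelCut_eq_zero hbR
  rw [hWR] at ftc
  have c1 : Continuous fun z : ℝ => 2 * (conj (W z) * (z * v' z + 1 / 2 * v z)).re :=
    continuous_const.mul (Complex.continuous_re.comp
      ((cc _ cW).mul ((co.mul hv').add (continuous_const.mul cv))))
  have key : ∫ z in (0 : ℝ)..R, (2 * (conj (W z) * (z * v' z + 1 / 2 * v z)).re -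
      2 * (conj (W' z) * (z * v z) + conj (W z) * (v z + z * v' z)).re) =
      ∫ z in (0 : ℝ)..R, -(2 * (conj (z * W' z + 1 / 2 * W z) * v z).re) := by
    refine intervalIntegral.integral_congr fun z _ => ?_
    simp only [map_add, map_mul, Complex.conj_ofReal, map_div₀, map_one, Complex.conj_ofNat]
    rw [← mul_sub, ← mul_neg, ← Complex.sub_re, ← Complex.neg_re]
    congr 2
    ring
  rw [← key, intervalIntegral.integral_sub (hint _ c1) (hint _ cT), ftc]
  simp

section Strip

variable {δ R a b : ℝ} {V Vt Vx Vxt Vxx : ℝ → ℝ → Mat2} {κ q q' θ : ℝ → ℝ} {p p' : ℝ → ℂ}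
  {W : ℝ → Mat2}

namespace IsStripFamily

lemma deriv_eq_background (h : IsStripFamily δ R V Vt Vx Vxt Vxx) (hδ : 0 < δ) (hR : 0 < R)
    (hB : IsBackground R (V 0) W q q' p p' θ) {x : ℝ} (hx : x ∈ Icc 0 R) : Vx 0 x = W x :=
  (uniqueDiffOn_Icc hR x hx).eq_deriv _ (h.deriv_x 0 ⟨by linarith, hδ⟩ x hx) (hB.deriv_x x hx)

/-- The components `h` and `v` of `V⁻¹ δV` with respect to the rotating frame, as continuously
differentiable functions on the line, and the variation of the connection in terms of them. -/
lemma exists_components (h : IsStripFamily δ R V Vt Vx Vxt Vxx) (hδ : 0 < δ) (hR : 0 < R)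
    (hB : IsBackground R (V 0) W q q' p p' θ) :
    ∃ (v v' : ℝ → ℂ) (k k' : ℝ → ℝ), (∀ z, HasDerivAt v (v' z) z) ∧ Continuous v' ∧
      (∀ z, HasDerivAt k (k' z) z) ∧ Continuous k' ∧
      (∀ x ∈ Icc 0 R, v x = gaugePhase θ x * wComp ((V 0 x).adjugate * Vt 0 x)) ∧
      (∀ x ∈ Icc 0 R, k x = hComp ((V 0 x).adjugate * Vt 0 x)) ∧
      (∀ x ∈ Icc 0 R, hComp (connVar V Vt Vx Vxt 0 x) =
        k' x + 2 * (conj (gaugePhase θ x * p x) * v x).im) ∧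
      ∀ x ∈ Icc 0 R, gaugePhase θ x * wComp (connVar V Vt Vx Vxt 0 x) =
        v' x + 2 * Complex.I * k x * (gaugePhase θ x * p x) := by
  have h0 : (0 : ℝ) ∈ Ioo (-δ) δ := ⟨by linarith, hδ⟩
  have hm : MapsTo (fun x : ℝ => ((0 : ℝ), x)) (Icc 0 R) (Ioo (-δ) δ ×ˢ Icc 0 R) :=
    fun x hx => mk_mem_prod h0 hx
  have hc : Continuous fun x : ℝ => ((0 : ℝ), x) := by fun_prop
  have k0 : ContinuousOn (V 0) (Icc 0 R) := h.cont.comp hc.continuousOn hm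
  have k1 : ContinuousOn (Vx 0) (Icc 0 R) := h.cont_x.comp hc.continuousOn hm
  have k2 : ContinuousOn (Vt 0) (Icc 0 R) := h.cont_t.comp hc.continuousOn hm
  have k3 : ContinuousOn (Vxt 0) (Icc 0 R) := h.cont_xt.comp hc.continuousOn hm
  set ξ : ℝ → Mat2 := fun x => (V 0 x).adjugate * Vt 0 x with hξ
  set ξ' : ℝ → Mat2 := fun x => (Vx 0 x).adjugate * Vt 0 x + (V 0 x).adjugate * Vxt 0 x with hξ'
  have cξ : ContinuousOn ξ (Icc 0 R) := (continuousOn_adjugate k0).mul k2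
  have cξ' : ContinuousOn ξ' (Icc 0 R) :=
    ((continuousOn_adjugate k1).mul k2).add ((continuousOn_adjugate k0).mul k3)
  have dξ : ∀ x ∈ Icc 0 R, HasDerivWithinAt ξ (ξ' x) (Icc 0 R) x := fun x hx =>
    (hasDerivWithinAt_adjugate (h.deriv_x 0 h0 x hx)).mul (h.deriv_tx 0 h0 x hx)
  have dg : ∀ x, HasDerivAt (gaugePhase θ) (gaugePhase θ x * (-Complex.I * (2 * q x))) x :=
    fun x => hasDerivAt_gaugePhase (hB.deriv_angle x)
  have cg : Continuous (gaugePhase θ) := continuous_of_hasDerivAt dg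
  have cq : Continuous fun x => -Complex.I * (2 * (q x : ℂ)) :=
    continuous_const.mul (continuous_const.mul
      (Complex.continuous_ofReal.comp (continuous_of_hasDerivAt hB.deriv_q)))
  have cw := continuousOn_wComp cξ
  obtain ⟨k, k', ck', dk, ek, ek'⟩ := exists_C1_extension hR.le (continuousOn_hComp cξ')
    fun x hx => hasDerivWithinAt_hComp (dξ x hx)
  obtain ⟨v, v', cv', dv, ev, ev'⟩ := exists_C1_extension hR.le
    (((cg.mul cq).continuousOn.mul cw).add (cg.continuousOn.mul (continuousOn_wComp cξ')))
    fun x hx => (dg x).hasDerivWithinAt.mul (hasDerivWithinAt_wComp (dξ x hx))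
  refine ⟨v, v', k, k', dv, cv', dk, ck', ev, ek, fun x hx => ?_, fun x hx => ?_⟩
  · have hb := h.deriv_eq_background hδ hR hB hx
    rw [h.hComp_connVar hR h0 hx, ek' hx, ev hx, hb, ← hB.p_eq x hx, ← hb]
    congr 2
    rw [Pi.mul_apply, map_mul]
    rw [show conj (gaugePhase θ x) * conj (p x) * (gaugePhase θ x * wComp (ξ x)) =
      conj (gaugePhase θ x) * gaugePhase θ x * (conj (p x) * wComp (ξ x)) by ring,
      conj_gaugePhase_mul, one_mul]
  · have hb := h.deriv_eq_background hδ hR hB hx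
    rw [h.wComp_connVar hR h0 hx, ek hx, ev' hx, hb, ← hB.p_eq x hx, ← hB.q_eq x hx, ← hb]
    simp only [Pi.mul_apply, Pi.add_apply, hξ, hξ']
    ring

end IsStripFamily

/-- The pairing of a section with the variation of the deformed connection. -/
lemma trace_mul_radialVar {X : Mat2} {dJ : ℝ → Mat2} {l r d : ℝ} {g e : ℂ}
    (hg : conj g * g = 1) (hd : hComp (dJ (l - r ^ 2)) = d) (he : g * wComp (dJ (l - r ^ 2)) = e) :
    (X * radialVar κ dJ l r).trace =
      2 * (conj (g * wComp X) * (2 * κ l * e)).re - 2 * hComp X * (2 * r * d) := by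
  rw [trace_mul_eq, radialVar, hComp_comb, wComp_comb, trace_comb, hd, ← he]
  congr 1
  rw [show conj (g * wComp X) * (2 * κ l * (g * wComp (dJ (l - r ^ 2)))) =
    conj g * g * (conj (wComp X) * (2 * κ l * wComp (dJ (l - r ^ 2)))) by rw [map_mul]; ring,
    hg, one_mul]
  push_cast
  ring

end Strip

/-! ### The functional derivatives -/

/-- The off-diagonal component of the section `S φ S⁻¹` in the rotating frame. -/
def sectionRot (θ : ℝ → ℝ) (S : ℝ → ℝ → Mat2) (φ : ℝ → Mat2) (l r : ℝ) : ℂ :=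
  gaugePhase θ (l - r ^ 2) * wComp (adjointSection S φ l r)

/-- The derivative of `sectionRot` with respect to `l`. -/
def sectionRotDeriv (θ q : ℝ → ℝ) (S S' : ℝ → ℝ → Mat2) (φ φ' : ℝ → Mat2) (l r : ℝ) : ℂ :=
  gaugePhase θ (l - r ^ 2) * (-Complex.I * (2 * q (l - r ^ 2))) * wComp (adjointSection S φ l r) +
    gaugePhase θ (l - r ^ 2) * wComp (adjointSectionDeriv S S' φ φ' l r)

/-- The Beltrami field varies in the direction `ζ`; in the rotating frame the symmetric part of
`V⁻¹ δV` is `gaugeFactor * ζ`, whatever the gauge. -/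
lemma gaugePhase_mul_wComp_variation {R δ : ℝ} (hδ : 0 < δ) {𝒱 : (ℝ → ℂ) → ℝ → Mat2}
    (h𝒱 : IsZweibein R 𝒱) {μ ζ : ℝ → ℂ} {Vt Vx Vxt Vxx : ℝ → ℝ → Mat2} (θ : ℝ → ℝ)
    (hμ : ∀ t ∈ Ioo (-δ) δ, IsBeltrami R fun y => μ y + t • ζ y)
    (h : IsStripFamily δ R (fun t => 𝒱 fun y => μ y + t • ζ y) Vt Vx Vxt Vxx)
    {x : ℝ} (hx : x ∈ Icc 0 R) :
    gaugePhase θ x * wComp ((𝒱 (fun y => μ y + (0 : ℝ) • ζ y) x).adjugate * Vt 0 x) =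
      gaugeFactor θ (𝒱 fun y => μ y + (0 : ℝ) • ζ y) x * ζ x := by
  have h0 : (0 : ℝ) ∈ Ioo (-δ) δ := ⟨by linarith, hδ⟩
  have hw : ∀ t ∈ Ioo (-δ) δ, wComp (𝒱 (fun y => μ y + t • ζ y) x) =
      (μ x + t • ζ x) * conj (rotComp (𝒱 (fun y => μ y + t • ζ y) x)) := fun t ht =>
    (normSq_rotComp_of_zweibein ((hμ t ht).norm_lt_one x hx) (h𝒱.metric _ (hμ t ht) x hx)
      (h𝒱.det_eq_one _ (hμ t ht) x hx)).2
  have dV := h.deriv_t 0 h0 x hx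
  have d1 := hasDerivAt_wComp dV
  have d2 : HasDerivAt (fun t : ℝ => μ x + t • ζ x) (ζ x) 0 := by
    simpa using ((hasDerivAt_id (0 : ℝ)).smul_const (ζ x)).const_add (μ x)
  have d3 : HasDerivAt (fun t : ℝ => conj (rotComp (𝒱 (fun y => μ y + t • ζ y) x)))
      (conj (rotComp (Vt 0 x))) 0 := by
    have := hasDerivWithinAt_conj (hasDerivWithinAt_rotComp (hasDerivWithinAt_univ.mpr dV))
    exact hasDerivWithinAt_univ.mp this
  have e := (d1.congr_of_eventuallyEq (f₁ := fun t : ℝ => (μ x + t • ζ x) *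
    conj (rotComp (𝒱 (fun y => μ y + t • ζ y) x))) (by
      filter_upwards [isOpen_Ioo.mem_nhds h0] with t ht using (hw t ht).symm)).unique (d2.mul d3)
  rw [wComp_adjugate_mul, e, hw 0 h0, gaugeFactor]
  simp only [zero_smul, add_zero]
  ring

section Derivative

variable {R a b : ℝ} {𝒱 : (ℝ → ℂ) → ℝ → Mat2} {μ : ℝ → ℂ} {κ κ₁ κ₁' q q' θ : ℝ → ℝ}
  {p p' : ℝ → ℂ} {W : ℝ → Mat2} {S S' : ℝ → ℝ → Mat2} {φ φ' : ℝ → Mat2}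

/-- The functional derivative of a smeared holonomy, in the rotating frame and up to conjugation:
with `F` the Abel transform of the section, it is `-(x F' + F / 2)`. -/
def axisKernel (R : ℝ) (κ₁ κ₁' : ℝ → ℝ) (w wl : ℝ → ℝ → ℂ) (x : ℝ) : ℂ :=
  x * abelCut (fun l r => κ₁' l * w l r + κ₁ l * wl l r) 0 (Real.sqrt R) x +
    1 / 2 * abelCut (fun l r => κ₁ l * w l r) 0 (Real.sqrt R) x

lemma IsProfile.continuous_abelCut {F Fl Fr : ℝ → ℝ → ℂ} (h : IsProfile a b F Fl Fr) (σ M : ℝ) :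
    Continuous (abelCut F σ M) :=
  continuous_of_hasDerivAt fun z => h.hasDerivAt_abelCut σ M z

lemma IsProfile.continuous_abelCut_l {F Fl Fr : ℝ → ℝ → ℂ} (h : IsProfile a b F Fl Fr) (σ M : ℝ) :
    Continuous (abelCut Fl σ M) :=
  continuous_const.mul (intervalIntegral.continuous_parametric_intervalIntegral_of_continuous'
    (μ := volume) (f := fun z r => Fl (z + r ^ 2) r) h.continuous_integrand_l σ M)

/-- The integrand of the variation of a smeared holonomy at one value of the deformation
parameter. -/
lemma IsStripFamily.variation_at {δ l : ℝ} {V Vt Vx Vxt Vxx : ℝ → ℝ → Mat2}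
    (h : IsStripFamily δ R V Vt Vx Vxt Vxx) (hδ : 0 < δ) (hR : 0 < R)
    (hB : IsBackground R (V 0) W q q' p p' θ) (hS : IsRadialSolution κ q p S S')
    (hφ : ∀ l, HasDerivAt φ (φ' l) l) (hφ' : Continuous φ') (hsupp : ∀ l ∉ Icc a b, φ l = 0)
    (hsymm : ∀ l, (φ l)ᵀ = φ l) {v v' : ℝ → ℂ} {k k' : ℝ → ℝ}
    (hv : ∀ z, HasDerivAt v (v' z) z) (hv' : Continuous v') (hk : ∀ z, HasDerivAt k (k' z) z)
    (hk' : Continuous k')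
    (ev : ∀ x ∈ Icc 0 R, v x = gaugePhase θ x * wComp ((V 0 x).adjugate * Vt 0 x))
    (ek : ∀ x ∈ Icc 0 R, k x = hComp ((V 0 x).adjugate * Vt 0 x))
    (eh : ∀ x ∈ Icc 0 R, hComp (connVar V Vt Vx Vxt 0 x) =
        k' x + 2 * (conj (gaugePhase θ x * p x) * v x).im)
    (ew : ∀ x ∈ Icc 0 R, gaugePhase θ x * wComp (connVar V Vt Vx Vxt 0 x) =
        v' x + 2 * Complex.I * k x * (gaugePhase θ x * p x))
    (hl : 0 < l) (hlR : l ≤ R) (hκ : κ l = Real.sqrt l) :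
    (adjointSection S φ l (Real.sqrt l) * ((V 0 0).adjugate * Vt 0 0)).trace +
      ∫ r in (0 : ℝ)..Real.sqrt l, (adjointSection S φ l r *
        radialVar κ (connVar V Vt Vx Vxt 0) l r).trace =
    ∫ r in (0 : ℝ)..Real.sqrt l, 4 / Real.sqrt l * (conj (sectionRot θ S φ l r) *
        (((l - r ^ 2 : ℝ) : ℂ) * v' (l - r ^ 2) + 1 / 2 * v (l - r ^ 2))).re := by
  have h0 : (0 : ℝ) ∈ Ioo (-δ) δ := ⟨by linarith, hδ⟩
  have hz : (0 : ℝ) ∈ Icc 0 R := ⟨le_rfl, hR.le⟩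
  have cq := continuous_of_hasDerivAt hB.deriv_q
  have cp := continuous_of_hasDerivAt hB.deriv_p
  have cg : Continuous (gaugePhase θ) :=
    continuous_of_hasDerivAt fun x => hasDerivAt_gaugePhase (hB.deriv_angle x)
  have pair := isRadialPair_adjointSection hS cq hB.deriv_angle hφ hφ' hsupp hsymm
  have key := integral_variation (cg.mul cp) pair hv hv' hk hk' hl hκ
  refine Eq.trans ?_ key
  have hs2 : Real.sqrt l ^ 2 = l := Real.sq_sqrt hl.le
  congr 1
  · rw [trace_mul_eq, h.trace_adjugate_mul_t h0 hz, hs2, sub_self, ev 0 hz, ek 0 hz, map_mul]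
    rw [show conj (gaugePhase θ 0) * conj (wComp (adjointSection S φ l (Real.sqrt l))) *
      (gaugePhase θ 0 * wComp ((V 0 0).adjugate * Vt 0 0)) =
      conj (gaugePhase θ 0) * gaugePhase θ 0 *
        (conj (wComp (adjointSection S φ l (Real.sqrt l))) *
          wComp ((V 0 0).adjugate * Vt 0 0)) by ring, conj_gaugePhase_mul]
    ring_nf
  · refine intervalIntegral.integral_congr fun r hr => ?_
    rw [uIcc_of_le (Real.sqrt_nonneg l)] at hr
    have hr2 : r ^ 2 ≤ l := by
      have := pow_le_pow_left₀ hr.1 hr.2 2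
      rwa [hs2] at this
    have hx : l - r ^ 2 ∈ Icc 0 R := ⟨by linarith, by nlinarith⟩
    have := trace_mul_radialVar (κ := κ) (X := adjointSection S φ l r)
      (conj_gaugePhase_mul θ (l - r ^ 2)) (eh _ hx) (ew _ hx)
    simp only [this, hκ, Pi.mul_apply]

lemma IsBackground.hasDerivAt_smeared {ζ : ℝ → ℂ} (h𝒱 : IsZweibein R 𝒱) (hR : 0 < R)
    (hμ : IsBeltrami R μ) (hζ : ContDiffOn ℝ ∞ ζ (Icc 0 R))
    (hB : IsBackground R (𝒱 μ) W q q' p p' θ) (hS : IsRadialSolution κ q p S S')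
    (ha : 0 < a) (hbR : b ≤ R) (hκ : Continuous κ) (hκs : ∀ l ∈ Icc a b, κ l = Real.sqrt l)
    (hκ₁ : ∀ l, HasDerivAt κ₁ (κ₁' l) l) (hκ₁' : Continuous κ₁')
    (hκ₁s : ∀ l ∈ Icc a b, κ₁ l = (Real.sqrt l)⁻¹)
    (hφ : ∀ l, HasDerivAt φ (φ' l) l) (hφ' : Continuous φ') (hsupp : ∀ l ∉ Icc a b, φ l = 0)
    (hsymm : ∀ l, (φ l)ᵀ = φ l) :
    HasDerivAt (fun t : ℝ => ∫ l in (0 : ℝ)..R,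
        (φ l * (U R (𝒱 μ) l)⁻¹ * U R (𝒱 fun y => μ y + t • ζ y) l).trace)
      (∫ x in (0 : ℝ)..R, -(2 * (conj (axisKernel R κ₁ κ₁' (sectionRot θ S φ)
        (sectionRotDeriv θ q S S' φ φ') x) * (gaugeFactor θ (𝒱 μ) x * ζ x)).re)) 0 := by
  obtain ⟨δ, hδ, hBel, Vt, Vx, Vxt, Vxx, h⟩ := h𝒱.exists_stripFamily hR hμ hζ
  have e0 : (fun y => μ y + (0 : ℝ) • ζ y) = μ := by simp
  have hB' : IsBackground R ((fun t : ℝ => 𝒱 fun y => μ y + t • ζ y) 0) W q q' p p' θ := by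
    simpa only [e0] using hB
  have cφ := continuous_of_hasDerivAt hφ
  have cq := continuous_of_hasDerivAt hB.deriv_q
  have cp := continuous_of_hasDerivAt hB.deriv_p
  have cg : Continuous (gaugePhase θ) :=
    continuous_of_hasDerivAt fun x => hasDerivAt_gaugePhase (hB.deriv_angle x)
  obtain ⟨T, hT, key⟩ := h.exists_hasDerivAt_smeared hδ hR ha hκ hκs cφ hsupp
  obtain ⟨v, v', k, k', dv, cv', dk, ck', ev, ek, eh, ew⟩ := h.exists_components hδ hR hB'
  have pair := isRadialPair_adjointSection hS cq hB.deriv_angle hφ hφ' hsupp hsymm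
  have prof := pair.isProfile hκ (cg.mul cp) hκ₁ hκ₁'
  have hpair := prof.integral_pairing dv cv' hR.le hbR
  simp only [e0] at key
  refine key.congr_deriv (Eq.trans ?_ (hpair.trans ?_))
  · refine integral_congr_of_eq_on (a := a) (b := b) (fun l hl hlR => ?_) (fun l hl => ?_)
      (fun l hl => ?_) hR.le
    · have hl0 : 0 < l := ha.trans_le hl.1
      have hTS : ∀ r ∈ Icc 0 (Real.sqrt l), adjointSection T φ l r = adjointSection S φ l r := by
        intro r hr
        have e1 := hT l hl hlR.2 r hr.1 hr.2
        have e2 := (holonomy_eq hl0 hlR.2 hB'.connQ_eq hB'.connP_eq (hκs l hl)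
          ((continuous_radialConn hκ cq cp).comp (Continuous.prodMk_right l))
          (hS.zero l) (hS.deriv_r l) hr.1 hr.2).1
        rw [adjointSection, adjointSection, ← e1, e2]
      have e3 := h.variation_at hδ hR hB' hS hφ hφ' hsupp hsymm dv cv' dk ck' ev ek eh ew hl0 hlR.2
        (hκs l hl)
      simp only [e0] at e3
      rw [hTS _ ⟨Real.sqrt_nonneg l, le_rfl⟩]
      refine Eq.trans ?_ (e3.trans ?_)
      · congr 1
        refine intervalIntegral.integral_congr fun r hr => ?_
        rw [uIcc_of_le (Real.sqrt_nonneg l)] at hr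
        simp only [hTS r hr]
      · refine intervalIntegral.integral_congr fun r hr => ?_
        simp only [hκ₁s l hl, map_mul, Complex.conj_ofReal, mul_assoc, Complex.re_ofReal_mul,
          sectionRot]
        ring
    · simp [adjointSection, hsupp l hl]
    · simp [adjointSection, hsupp l hl]
  · refine intervalIntegral.integral_congr fun x hx => ?_
    rw [uIcc_of_le hR.le] at hx
    have e4 := gaugePhase_mul_wComp_variation hδ h𝒱 θ hBel h hx
    simp only [e0] at e4
    simp only [ev x hx, e4, e0]
    rfl

/-- The functional derivatives of a smeared holonomy. -/
lemma IsBackground.hasFunctionalDeriv (h𝒱 : IsZweibein R 𝒱) (hR : 0 < R)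
    (hμ : IsBeltrami R μ) (hB : IsBackground R (𝒱 μ) W q q' p p' θ)
    (hS : IsRadialSolution κ q p S S')
    (ha : 0 < a) (hbR : b ≤ R) (hκ : Continuous κ) (hκs : ∀ l ∈ Icc a b, κ l = Real.sqrt l)
    (hκ₁ : ∀ l, HasDerivAt κ₁ (κ₁' l) l) (hκ₁' : Continuous κ₁')
    (hκ₁s : ∀ l ∈ Icc a b, κ₁ l = (Real.sqrt l)⁻¹)
    (hφ : ∀ l, HasDerivAt φ (φ' l) l) (hφ' : Continuous φ') (hsupp : ∀ l ∉ Icc a b, φ l = 0)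
    (hsymm : ∀ l, (φ l)ᵀ = φ l) :
    HasFunctionalDeriv R (smearedU R 𝒱 μ φ) μ
      (fun x => -conj (axisKernel R κ₁ κ₁' (sectionRot θ S φ)
        (sectionRotDeriv θ q S S' φ φ') x) * gaugeFactor θ (𝒱 μ) x)
      (fun x => -axisKernel R κ₁ κ₁' (sectionRot θ S φ)
        (sectionRotDeriv θ q S S' φ φ') x * conj (gaugeFactor θ (𝒱 μ) x)) := by
  have cq := continuous_of_hasDerivAt hB.deriv_q
  have cp := continuous_of_hasDerivAt hB.deriv_p
  have cg : Continuous (gaugePhase θ) :=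
    continuous_of_hasDerivAt fun x => hasDerivAt_gaugePhase (hB.deriv_angle x)
  have pair := isRadialPair_adjointSection hS cq hB.deriv_angle hφ hφ' hsupp hsymm
  have prof := pair.isProfile hκ (cg.mul cp) hκ₁ hκ₁'
  have cA : Continuous (axisKernel R κ₁ κ₁' (sectionRot θ S φ)
      (sectionRotDeriv θ q S S' φ φ')) :=
    (Complex.continuous_ofReal.mul (prof.continuous_abelCut_l _ _)).add
      (continuous_const.mul (prof.continuous_abelCut _ _))
  have cGF : ContinuousOn (gaugeFactor θ (𝒱 μ)) (Icc 0 R) := by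
    have k : ContinuousOn (fun x => conj (rotComp (𝒱 μ x))) (Icc 0 R) := fun x hx =>
      (hasDerivWithinAt_conj (hasDerivWithinAt_rotComp (hB.deriv_x x hx))).continuousWithinAt
    exact cg.continuousOn.mul (k.pow 2)
  refine ⟨(Complex.continuous_conj.comp cA).neg.continuousOn.mul cGF,
    cA.neg.continuousOn.mul (Complex.continuous_conj.comp_continuousOn cGF), fun ζ hζ => ?_⟩
  have key := (hB.hasDerivAt_smeared h𝒱 hR hμ hζ hS ha hbR hκ hκs hκ₁ hκ₁' hκ₁s hφ hφ' hsupp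
    hsymm).ofReal_comp
  refine key.congr_deriv ?_
  rw [← intervalIntegral.integral_ofReal]
  refine intervalIntegral.integral_congr fun x _ => ?_
  have e : ∀ A g z : ℂ, ((-(2 * (conj A * (g * z)).re) : ℝ) : ℂ) =
      -conj A * g * z + -A * conj g * conj z := by
    intro A g z
    apply Complex.ext <;> simp <;> ring
  exact e _ _ _

end Derivative

/-! ### The Poisson bracket in terms of Abel transforms -/

section Ordered

variable {R : ℝ} {u₁ u₂ B : ℝ → ℂ}

lemma integrableOn_ordered (hu₁ : IntegrableOn u₁ (Icc 0 R)) (hu₂ : IntegrableOn u₂ (Icc 0 R)) :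
    IntegrableOn (fun p : ℝ × ℝ => conj (u₁ p.1) * u₂ p.2 * (if p.2 ≤ p.1 then 1 else 0) -
      u₁ p.1 * conj (u₂ p.2) * (if p.1 ≤ p.2 then 1 else 0)) (Icc 0 R ×ˢ Icc 0 R) := by
  have hc : ∀ u : ℝ → ℂ, IntegrableOn u (Icc 0 R) → IntegrableOn (fun x => conj (u x)) (Icc 0 R) :=
    fun u hu => ⟨Complex.continuous_conj.comp_aestronglyMeasurable hu.1,
      hu.2.mono (Eventually.of_forall fun x => by simp)⟩
  have m1 : Measurable fun p : ℝ × ℝ => (if p.2 ≤ p.1 then 1 else 0 : ℂ) :=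
    Measurable.ite (measurableSet_le measurable_snd measurable_fst) measurable_const
      measurable_const
  have m2 : Measurable fun p : ℝ × ℝ => (if p.1 ≤ p.2 then 1 else 0 : ℂ) :=
    Measurable.ite (measurableSet_le measurable_fst measurable_snd) measurable_const
      measurable_const
  rw [IntegrableOn, Measure.volume_eq_prod, ← Measure.prod_restrict]
  have h1 := (hc u₁ hu₁).mul_prod hu₂
  have h2 := Integrable.mul_prod hu₁ (hc u₂ hu₂)
  refine (h1.mul_bdd (c := 1) m1.aestronglyMeasurable (Eventually.of_forall fun p => ?_)).sub
    (h2.mul_bdd (c := 1) m2.aestronglyMeasurable (Eventually.of_forall fun p => ?_)) <;>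
  split_ifs <;> simp

lemma setIntegral_ite_ge (u : ℝ → ℂ) {y : ℝ} (hy : y ∈ Icc 0 R) :
    ∫ x in Icc 0 R, u x * (if y ≤ x then 1 else 0) = ∫ x in y..R, u x := by
  rw [intervalIntegral.integral_of_le hy.2, ← integral_Icc_eq_integral_Ioc]
  have : (fun x => u x * (if y ≤ x then 1 else 0)) = (Ici y).indicator u := by
    funext x
    by_cases h : y ≤ x
    · rw [indicator_of_mem (show x ∈ Ici y from h), if_pos h, mul_one]
    · rw [indicator_of_notMem (show x ∉ Ici y from h), if_neg h, mul_zero]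
  rw [this, setIntegral_indicator measurableSet_Ici]
  congr 2
  ext x
  simp only [mem_inter_iff, mem_Icc, mem_Ici]
  exact ⟨fun h => ⟨h.2, h.1.2⟩, fun h => ⟨⟨hy.1.trans h.1, h.2⟩, h.1⟩⟩

lemma setIntegral_ite_le (u : ℝ → ℂ) {y : ℝ} (hy : y ∈ Icc 0 R) :
    ∫ x in Icc 0 R, u x * (if x ≤ y then 1 else 0) = ∫ x in (0 : ℝ)..y, u x := by
  rw [intervalIntegral.integral_of_le hy.1, ← integral_Icc_eq_integral_Ioc]
  have : (fun x => u x * (if x ≤ y then 1 else 0)) = (Iic y).indicator u := by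
    funext x
    by_cases h : x ≤ y
    · rw [indicator_of_mem (show x ∈ Iic y from h), if_pos h, mul_one]
    · rw [indicator_of_notMem (show x ∉ Iic y from h), if_neg h, mul_zero]
  rw [this, setIntegral_indicator measurableSet_Iic]
  congr 2
  ext x
  simp only [mem_inter_iff, mem_Icc, mem_Iic]
  exact ⟨fun h => ⟨h.1.1, h.2⟩, fun h => ⟨⟨h.1, h.2.trans hy.2⟩, h.2⟩⟩

/-- A bracket with kernel a step function integrates to a single integral when one of the two
factors is the derivative of a function `B` vanishing at both ends. -/
lemma integral_ordered (hR : 0 ≤ R) (hu₁ : IntegrableOn u₁ (Icc 0 R))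
    (hu₂ : IntegrableOn u₂ (Icc 0 R)) (hB : ∀ y ∈ Icc 0 R, ∫ x in (0 : ℝ)..y, u₁ x = B y)
    (hBR : B R = 0) :
    ∫ p in Icc (0 : ℝ) R ×ˢ Icc (0 : ℝ) R,
      (conj (u₁ p.1) * u₂ p.2 * (if p.2 ≤ p.1 then 1 else 0) -
        u₁ p.1 * conj (u₂ p.2) * (if p.1 ≤ p.2 then 1 else 0)) =
      ((-∫ y in (0 : ℝ)..R, 2 * (conj (B y) * u₂ y).re : ℝ) : ℂ) := by
  have hi := integrableOn_ordered hu₁ hu₂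
  have hI : ∀ c ∈ Icc 0 R, ∀ d ∈ Icc 0 R, IntervalIntegrable u₁ volume c d := fun c hc d hd =>
    (hu₁.mono_set (uIcc_subset_Icc hc hd)).intervalIntegrable
  have hB' : ∀ y ∈ Icc 0 R, ∫ x in y..R, u₁ x = -B y := by
    intro y hy
    have h0 : (0 : ℝ) ∈ Icc 0 R := ⟨le_rfl, hR⟩
    have hRm : R ∈ Icc 0 R := ⟨hR, le_rfl⟩
    have := intervalIntegral.integral_add_adjacent_intervals (hI 0 h0 y hy) (hI y hy R hRm)
    rw [hB y hy, hB R hRm, hBR] at this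
    linear_combination this
  rw [IntegrableOn, Measure.volume_eq_prod, ← Measure.prod_restrict] at hi
  rw [Measure.volume_eq_prod, ← Measure.prod_restrict, integral_prod_symm _ hi,
    ← intervalIntegral.integral_neg, intervalIntegral.integral_of_le hR,
    ← integral_Icc_eq_integral_Ioc, ← integral_complex_ofReal]
  refine setIntegral_congr_fun measurableSet_Icc fun y hy => ?_
  have m1 : Measurable fun x : ℝ => (if y ≤ x then 1 else 0 : ℂ) :=
    Measurable.ite (measurableSet_le measurable_const measurable_id) measurable_const
      measurable_const
  have m2 : Measurable fun x : ℝ => (if x ≤ y then 1 else 0 : ℂ) :=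
    Measurable.ite (measurableSet_le measurable_id measurable_const) measurable_const
      measurable_const
  have hcu : IntegrableOn (fun x => conj (u₁ x)) (Icc 0 R) :=
    ⟨Complex.continuous_conj.comp_aestronglyMeasurable hu₁.1,
      hu₁.2.mono (Eventually.of_forall fun x => by simp)⟩
  have j1 : Integrable (fun x => conj (u₁ x) * (if y ≤ x then 1 else 0))
      (volume.restrict (Icc 0 R)) :=
    hcu.mul_bdd (c := 1) m1.aestronglyMeasurable
      (Eventually.of_forall fun p => by split_ifs <;> simp)
  have j2 : Integrable (fun x => u₁ x * (if x ≤ y then 1 else 0))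
      (volume.restrict (Icc 0 R)) :=
    hu₁.mul_bdd (c := 1) m2.aestronglyMeasurable
      (Eventually.of_forall fun p => by split_ifs <;> simp)
  have e : ∀ x, conj (u₁ x) * u₂ y * (if y ≤ x then 1 else 0) -
      u₁ x * conj (u₂ y) * (if x ≤ y then 1 else 0) =
      conj (u₁ x) * (if y ≤ x then 1 else 0) * u₂ y -
        u₁ x * (if x ≤ y then 1 else 0) * conj (u₂ y) := fun x => by ring
  have ec : ∫ x in y..R, conj (u₁ x) = conj (∫ x in y..R, u₁ x) := by
    rw [intervalIntegral.integral_of_le hy.2, intervalIntegral.integral_of_le hy.2, integral_conj]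
  simp only [e]
  rw [integral_sub (j1.mul_const _) (j2.mul_const _), integral_mul_const, integral_mul_const,
    setIntegral_ite_ge _ hy, setIntegral_ite_le _ hy, hB y hy, ec, hB' y hy]
  apply Complex.ext <;> simp <;> ring

end Ordered

lemma integrableOn_inv_sqrt {R : ℝ} (hR : 0 ≤ R) :
    IntegrableOn (fun x : ℝ => ((Real.sqrt x)⁻¹ : ℂ)) (Icc 0 R) := by
  have h := (intervalIntegral.intervalIntegrable_rpow' (a := 0) (b := R) (r := -(1 / 2))
    (by norm_num)).1
  rw [← uIoc_of_le hR, uIoc_of_le hR, ← integrableOn_Icc_iff_integrableOn_Ioc] at h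
  refine IntegrableOn.congr_fun (h.ofReal (𝕜 := ℂ)) (fun x hx => ?_) measurableSet_Icc
  simp only [Real.rpow_neg hx.1, ← Real.sqrt_eq_rpow]
  push_cast
  rfl

section Bracket

variable {R a b : ℝ} {κ₁ κ₁' : ℝ → ℝ} {w wl Fr : ℝ → ℝ → ℂ}

lemma integrableOn_axisKernel_div (hR : 0 ≤ R)
    (h : IsProfile a b (fun l r => κ₁ l * w l r) (fun l r => κ₁' l * w l r + κ₁ l * wl l r) Fr) :
    IntegrableOn (fun x => axisKernel R κ₁ κ₁' w wl x / Real.sqrt x) (Icc 0 R) := by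
  have cA : Continuous (axisKernel R κ₁ κ₁' w wl) :=
    (Complex.continuous_ofReal.mul (h.continuous_abelCut_l _ _)).add
      (continuous_const.mul (h.continuous_abelCut _ _))
  simp only [div_eq_mul_inv]
  exact (integrableOn_inv_sqrt hR).continuousOn_mul cA.continuousOn isCompact_Icc

/-- The function `√x F(x)`, with `F` the Abel transform, is an antiderivative of
`axisKernel / √x`. -/
lemma integral_axisKernel_div (hR : 0 ≤ R)
    (h : IsProfile a b (fun l r => κ₁ l * w l r) (fun l r => κ₁' l * w l r + κ₁ l * wl l r) Fr)
    {y : ℝ} (hy : y ∈ Icc 0 R) :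
    ∫ x in (0 : ℝ)..y, axisKernel R κ₁ κ₁' w wl x / Real.sqrt x =
      Real.sqrt y * abelCut (fun l r => κ₁ l * w l r) 0 (Real.sqrt R) y := by
  have cs : Continuous fun x : ℝ => (Real.sqrt x : ℂ) :=
    Complex.continuous_ofReal.comp Real.continuous_sqrt
  have key := intervalIntegral.integral_eq_sub_of_hasDerivAt_of_le hy.1
    (f := fun x => (Real.sqrt x : ℂ) * abelCut (fun l r => κ₁ l * w l r) 0 (Real.sqrt R) x)
    (f' := fun x => axisKernel R κ₁ κ₁' w wl x / Real.sqrt x)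
    (cs.mul (h.continuous_abelCut _ _)).continuousOn (fun x hx => ?_)
    (((integrableOn_axisKernel_div hR h).mono_set
      (Icc_subset_Icc le_rfl hy.2 |> (uIcc_of_le hy.1).subset.trans)).intervalIntegrable)
  · rw [key]; simp
  · have hs : (Real.sqrt x : ℂ) ≠ 0 := by
      exact_mod_cast (Real.sqrt_pos.mpr hx.1).ne'
    have hs2 : (Real.sqrt x : ℂ) ^ 2 = x := by exact_mod_cast Real.sq_sqrt hx.1.le
    have d1 := (Real.hasDerivAt_sqrt hx.1.ne').ofReal_comp
    refine (d1.mul (h.hasDerivAt_abelCut 0 (Real.sqrt R) x)).congr_deriv ?_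
    rw [axisKernel, ← hs2]
    push_cast
    field_simp
    ring

end Bracket

section Poisson

variable {R a b : ℝ} {𝒱 : (ℝ → ℂ) → ℝ → Mat2} {μ : ℝ → ℂ} {κ κ₁ κ₁' q q' θ : ℝ → ℝ}
  {p p' : ℝ → ℂ} {W : ℝ → Mat2} {S S' : ℝ → ℝ → Mat2} {φ₁ φ₁' φ₂ φ₂' : ℝ → Mat2}

/-- The bracket of two smeared holonomies as a single integral over the null segment. -/
lemma IsBackground.hasPoissonBracket (G₂ : ℝ) (h𝒱 : IsZweibein R 𝒱) (hR : 0 < R)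
    (hμ : IsBeltrami R μ) (hB : IsBackground R (𝒱 μ) W q q' p p' θ)
    (hS : IsRadialSolution κ q p S S')
    (ha : 0 < a) (hbR : b ≤ R) (hκ : Continuous κ) (hκs : ∀ l ∈ Icc a b, κ l = Real.sqrt l)
    (hκ₁ : ∀ l, HasDerivAt κ₁ (κ₁' l) l) (hκ₁' : Continuous κ₁')
    (hκ₁s : ∀ l ∈ Icc a b, κ₁ l = (Real.sqrt l)⁻¹)
    (hφ₁ : ∀ l, HasDerivAt φ₁ (φ₁' l) l) (hφ₁' : Continuous φ₁')
    (hsupp₁ : ∀ l ∉ Icc a b, φ₁ l = 0) (hsymm₁ : ∀ l, (φ₁ l)ᵀ = φ₁ l)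
    (hφ₂ : ∀ l, HasDerivAt φ₂ (φ₂' l) l) (hφ₂' : Continuous φ₂')
    (hsupp₂ : ∀ l ∉ Icc a b, φ₂ l = 0) (hsymm₂ : ∀ l, (φ₂ l)ᵀ = φ₂ l) :
    HasPoissonBracket R G₂ (smearedU R 𝒱 μ φ₁) (smearedU R 𝒱 μ φ₂) μ
      ((4 * Real.pi * G₂ * -∫ z in (0 : ℝ)..R, 2 *
        (conj (abelCut (fun l r => κ₁ l * sectionRot θ S φ₁ l r) 0 (Real.sqrt R) z) *
          axisKernel R κ₁ κ₁' (sectionRot θ S φ₂) (sectionRotDeriv θ q S S' φ₂ φ₂') z).re : ℝ) :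
        ℂ) := by
  have cq := continuous_of_hasDerivAt hB.deriv_q
  have cp := continuous_of_hasDerivAt hB.deriv_p
  have cg : Continuous (gaugePhase θ) :=
    continuous_of_hasDerivAt fun x => hasDerivAt_gaugePhase (hB.deriv_angle x)
  have prof₁ := (isRadialPair_adjointSection hS cq hB.deriv_angle hφ₁ hφ₁' hsupp₁
    hsymm₁).isProfile hκ (cg.mul cp) hκ₁ hκ₁'
  have prof₂ := (isRadialPair_adjointSection hS cq hB.deriv_angle hφ₂ hφ₂' hsupp₂
    hsymm₂).isProfile hκ (cg.mul cp) hκ₁ hκ₁'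
  have d₁ := hB.hasFunctionalDeriv h𝒱 hR hμ hS ha hbR hκ hκs hκ₁ hκ₁' hκ₁s hφ₁ hφ₁' hsupp₁ hsymm₁
  have d₂ := hB.hasFunctionalDeriv h𝒱 hR hμ hS ha hbR hκ hκs hκ₁ hκ₁' hκ₁s hφ₂ hφ₂' hsupp₂ hsymm₂
  set A₁ := axisKernel R κ₁ κ₁' (sectionRot θ S φ₁) (sectionRotDeriv θ q S S' φ₁ φ₁') with hA₁
  set A₂ := axisKernel R κ₁ κ₁' (sectionRot θ S φ₂) (sectionRotDeriv θ q S S' φ₂ φ₂') with hA₂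
  have i₁ : IntegrableOn (fun x => A₁ x / Real.sqrt x) (Icc 0 R) :=
    integrableOn_axisKernel_div hR.le prof₁
  have i₂ : IntegrableOn (fun x => A₂ x / Real.sqrt x) (Icc 0 R) :=
    integrableOn_axisKernel_div hR.le prof₂
  have hnorm : ∀ x ∈ Icc 0 R,
      conj (rotComp (𝒱 μ x)) * rotComp (𝒱 μ x) * (1 - μ x * conj (μ x)) = 1 ∧
      wComp (𝒱 μ x) = μ x * conj (rotComp (𝒱 μ x)) := fun x hx =>
    normSq_rotComp_of_zweibein (hμ.norm_lt_one x hx) (h𝒱.metric μ hμ x hx)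
      (h𝒱.det_eq_one μ hμ x hx)
  have hmB : ∀ x ∈ Icc 0 R, ∀ y ∈ Icc 0 R, gaugeFactor θ (𝒱 μ) x * muBracket R G₂ μ x y *
      conj (gaugeFactor θ (𝒱 μ) y) =
      4 * Real.pi * G₂ * (if y ≤ x then 1 else 0) / (Real.sqrt x * Real.sqrt y) :=
    fun x hx y hy => gaugeFactor_mul_muBracket hR hμ hB.deriv_x (fun x hx => (hnorm x hx).1)
      (fun x hx => (hnorm x hx).2) hB.q_eq hB.deriv_angle G₂ hx hy
  have eqOn : EqOn (fun p : ℝ × ℝ => (4 * Real.pi * G₂ : ℂ) *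
      (conj (A₁ p.1 / Real.sqrt p.1) * (A₂ p.2 / Real.sqrt p.2) * (if p.2 ≤ p.1 then 1 else 0) -
        A₁ p.1 / Real.sqrt p.1 * conj (A₂ p.2 / Real.sqrt p.2) * (if p.1 ≤ p.2 then 1 else 0)))
      (fun p : ℝ × ℝ => -conj (A₁ p.1) * gaugeFactor θ (𝒱 μ) p.1 * muBracket R G₂ μ p.1 p.2 *
          (-A₂ p.2 * conj (gaugeFactor θ (𝒱 μ) p.2)) -
        -A₁ p.1 * conj (gaugeFactor θ (𝒱 μ) p.1) * muBracket R G₂ μ p.2 p.1 *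
          (-conj (A₂ p.2) * gaugeFactor θ (𝒱 μ) p.2)) (Icc 0 R ×ˢ Icc 0 R) := by
    rintro ⟨x, y⟩ ⟨hx, hy⟩
    have e1 := hmB x hx y hy
    have e2 := hmB y hy x hx
    simp only [map_div₀, Complex.conj_ofReal]
    linear_combination (-conj (A₁ x) * A₂ y) * e1 + (A₁ x * conj (A₂ y)) * e2
  have hBox : MeasurableSet (Icc (0 : ℝ) R ×ˢ Icc (0 : ℝ) R) :=
    measurableSet_Icc.prod measurableSet_Icc
  refine ⟨_, _, _, _, d₁, d₂, ?_, ?_⟩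
  · exact IntegrableOn.congr_fun ((integrableOn_ordered i₁ i₂).const_mul _) eqOn hBox
  · rw [← setIntegral_congr_fun hBox eqOn, integral_const_mul,
      integral_ordered hR.le i₁ i₂ (fun y hy => integral_axisKernel_div hR.le prof₁ hy)
        (by rw [prof₁.abelCut_eq_zero hbR, mul_zero])]
    push_cast
    congr 2
    rw [← intervalIntegral.integral_ofReal, ← intervalIntegral.integral_ofReal,
      intervalIntegral.integral_of_le hR.le, intervalIntegral.integral_of_le hR.le]
    refine setIntegral_congr_fun measurableSet_Ioc fun y hy => ?_
    have hs : (Real.sqrt y : ℂ) ≠ 0 := by exact_mod_cast (Real.sqrt_pos.mpr hy.1).ne'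
    have e : ∀ X A : ℂ, conj X * A = conj (Real.sqrt y * X) * (A / Real.sqrt y) := by
      intro X A
      rw [map_mul, Complex.conj_ofReal]
      field_simp
    congr 3
    exact e _ _

end Poisson

/-! ### The right side of the bracket -/

lemma kronecker_Omega_apply (A₁ A₂ B₁ B₂ : Mat2) (p q : Fin 2 × Fin 2) :
    ((A₁ ⊗ₖ (1 : Mat2)) * ((1 : Mat2) ⊗ₖ A₂) * Omega * (B₁ ⊗ₖ (1 : Mat2)) *
      ((1 : Mat2) ⊗ₖ B₂)) p q =
    1 / 4 * ((A₁ * B₂) p.1 q.2 * (A₂ * B₁) p.2 q.1 -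
      1 / 2 * ((A₁ * B₁) p.1 q.1 * (A₂ * B₂) p.2 q.2)) := by
  have e1 : (A₁ ⊗ₖ (1 : Mat2)) * ((1 : Mat2) ⊗ₖ A₂) = A₁ ⊗ₖ A₂ := by
    rw [← Matrix.mul_kronecker_mul, mul_one, one_mul]
  have e2 : (B₁ ⊗ₖ (1 : Mat2)) * ((1 : Mat2) ⊗ₖ B₂) = B₁ ⊗ₖ B₂ := by
    rw [← Matrix.mul_kronecker_mul, mul_one, one_mul]
  rw [mul_assoc (_ * Omega), e2, e1]
  obtain ⟨i, k⟩ := p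
  obtain ⟨j, l⟩ := q
  have e3 : ∀ r : Fin 2 × Fin 2, (A₁ ⊗ₖ A₂ * Omega) (i, k) r =
      1 / 4 * (A₁ i r.2 * A₂ k r.1 - 1 / 2 * (A₁ i r.1 * A₂ k r.2)) := by
    rintro ⟨m, n⟩
    simp only [Matrix.mul_apply, Fintype.sum_prod_type, Fin.sum_univ_two,
      Matrix.kroneckerMap_apply, Omega, Matrix.of_apply]
    fin_cases m <;> fin_cases n <;> simp <;> ring
  rw [Matrix.mul_apply]
  simp only [e3, Fintype.sum_prod_type, Fin.sum_univ_two, Matrix.kroneckerMap_apply,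
    Matrix.mul_apply]
  ring

/-- The right side of the bracket in terms of the two holonomies from the axis. -/
def coreOf (s₁ s₂ : Mat2) : Mat22 :=
  kkPart ((s₁.adjugate ⊗ₖ (1 : Mat2)) * ((1 : Mat2) ⊗ₖ s₂.adjugate) * Omega *
    (s₁ ⊗ₖ (1 : Mat2)) * ((1 : Mat2) ⊗ₖ s₂))

lemma trace_kronecker_kkPart {φ₁ φ₂ : Mat2} (h₁ : φ₁ᵀ = φ₁) (h₂ : φ₂ᵀ = φ₂) (N : Mat22) :
    ((φ₁ ⊗ₖ φ₂) * kkPart N).trace = ((φ₁ ⊗ₖ φ₂) * N).trace := by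
  have e₁ : φ₁ 1 0 = φ₁ 0 1 := by conv_lhs => rw [← h₁, Matrix.transpose_apply]
  have e₂ : φ₂ 1 0 = φ₂ 0 1 := by conv_lhs => rw [← h₂, Matrix.transpose_apply]
  simp only [Matrix.trace, Matrix.diag_apply, Matrix.mul_apply, Fintype.sum_prod_type,
    Fin.sum_univ_two, Matrix.kroneckerMap_apply, kkPart, Matrix.of_apply, e₁, e₂]
  ring

/-- The contraction of the invariant tensor with two sections is a quarter of their trace form. -/
lemma trace_kronecker_coreOf {φ₁ φ₂ s₁ s₂ : Mat2} (h₁ : φ₁ᵀ = φ₁) (h₂ : φ₂ᵀ = φ₂)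
    (hs₁ : s₁.det = 1) (hs₂ : s₂.det = 1) :
    ((φ₁ ⊗ₖ φ₂) * coreOf s₁ s₂).trace = 1 / 4 *
      ((s₁ * φ₁ * s₁.adjugate * (s₂ * φ₂ * s₂.adjugate)).trace -
        1 / 2 * (φ₁.trace * φ₂.trace)) := by
  have e : (s₁ * φ₁ * s₁.adjugate * (s₂ * φ₂ * s₂.adjugate)).trace =
      (φ₁ * (s₁.adjugate * s₂) * (φ₂ * (s₂.adjugate * s₁))).trace := by
    rw [show s₁ * φ₁ * s₁.adjugate * (s₂ * φ₂ * s₂.adjugate) =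
      s₁ * (φ₁ * s₁.adjugate * (s₂ * φ₂ * s₂.adjugate)) by simp only [mul_assoc],
      Matrix.trace_mul_comm]
    simp only [mul_assoc]
  have eN : ∀ r t : Fin 2 × Fin 2, ((s₁.adjugate ⊗ₖ (1 : Mat2)) * ((1 : Mat2) ⊗ₖ s₂.adjugate) *
      Omega * (s₁ ⊗ₖ (1 : Mat2)) * ((1 : Mat2) ⊗ₖ s₂)) r t =
      1 / 4 * ((s₁.adjugate * s₂) r.1 t.2 * (s₂.adjugate * s₁) r.2 t.1 -
        1 / 2 * ((1 : Mat2) r.1 t.1 * (1 : Mat2) r.2 t.2)) := fun r t => by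
    rw [kronecker_Omega_apply, adjugate_mul_of_det hs₁, adjugate_mul_of_det hs₂]
  rw [coreOf, trace_kronecker_kkPart h₁ h₂, e]
  generalize (s₁.adjugate ⊗ₖ (1 : Mat2)) * ((1 : Mat2) ⊗ₖ s₂.adjugate) *
      Omega * (s₁ ⊗ₖ (1 : Mat2)) * ((1 : Mat2) ⊗ₖ s₂) = N at eN
  generalize s₁.adjugate * s₂ = C at eN ⊢
  generalize s₂.adjugate * s₁ = D at eN ⊢
  simp only [Matrix.trace, Matrix.diag_apply, Matrix.mul_apply, Fintype.sum_prod_type,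
    Fin.sum_univ_two, Matrix.kroneckerMap_apply, eN]
  simp only [Matrix.one_apply_eq, Matrix.one_apply_ne zero_ne_one, Matrix.one_apply_ne one_ne_zero]
  ring

section Smooth

variable {E : Type*} [NormedAddCommGroup E] [NormedSpace ℝ E] {f g : E → Mat2}

lemma contDiff_mul_apply (hf : ∀ i j, ContDiff ℝ 1 fun x => f x i j)
    (hg : ∀ i j, ContDiff ℝ 1 fun x => g x i j) (i j : Fin 2) :
    ContDiff ℝ 1 fun x => (f x * g x) i j := by
  simp only [Matrix.mul_apply, Fin.sum_univ_two]
  exact ((hf i 0).mul (hg 0 j)).add ((hf i 1).mul (hg 1 j))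

lemma contDiff_adjugate_apply (hf : ∀ i j, ContDiff ℝ 1 fun x => f x i j) (i j : Fin 2) :
    ContDiff ℝ 1 fun x => (f x).adjugate i j := by
  simp only [Matrix.adjugate_fin_two]
  fin_cases i <;> fin_cases j <;> simp [hf, (hf _ _).neg]

lemma contDiff_coreOf_apply (hf : ∀ i j, ContDiff ℝ 1 fun x => f x i j)
    (hg : ∀ i j, ContDiff ℝ 1 fun x => g x i j) (i j : Fin 2 × Fin 2) :
    ContDiff ℝ 1 fun x => coreOf (f x) (g x) i j := by
  have h : ∀ p q : Fin 2 × Fin 2, ContDiff ℝ 1 fun x =>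
      1 / 4 * (((f x).adjugate * g x) p.1 q.2 * ((g x).adjugate * f x) p.2 q.1 -
        1 / 2 * (((f x).adjugate * f x) p.1 q.1 * ((g x).adjugate * g x) p.2 q.2)) := fun p q =>
    contDiff_const.mul (((contDiff_mul_apply (contDiff_adjugate_apply hf) hg _ _).mul
      (contDiff_mul_apply (contDiff_adjugate_apply hg) hf _ _)).sub (contDiff_const.mul
      ((contDiff_mul_apply (contDiff_adjugate_apply hf) hf _ _).mul
        (contDiff_mul_apply (contDiff_adjugate_apply hg) hg _ _))))
  simp only [coreOf, kkPart, Matrix.of_apply, kronecker_Omega_apply]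
  exact contDiff_const.mul ((((h i j).add (h (j.1, i.2) (i.1, j.2))).add
    (h (i.1, j.2) (j.1, i.2))).add (h j i))

end Smooth

/-- The principal value of a `C¹` function times a test function is bounded by the `C¹` norm of the
latter: the antisymmetric part of the product vanishes on the diagonal. -/
lemma exists_hasPV_bound {m : ℝ × ℝ → ℝ} (hm : ContDiff ℝ 1 m) {a b : ℝ} (hab : a ≤ b) :
    ∃ C : ℝ, ∀ f : ℝ × ℝ → ℝ, ContDiff ℝ 1 f → tsupport f ⊆ Icc a b ×ˢ Icc a b →
      ∃ c : ℝ, HasPV (fun p => f p * m p) c ∧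
        ∀ B : ℝ, (∀ p, |f p| ≤ B ∧ ‖fderiv ℝ f p‖ ≤ B) → |c| ≤ C * B := by
  have hK : IsCompact (Icc a b ×ˢ Icc a b) := isCompact_Icc.prod isCompact_Icc
  have hconv : Convex ℝ (Icc a b ×ˢ Icc a b) := (convex_Icc a b).prod (convex_Icc a b)
  obtain ⟨M₀, hM₀⟩ := hK.exists_bound_of_continuousOn hm.continuous.continuousOn
  obtain ⟨M₁, hM₁⟩ := hK.exists_bound_of_continuousOn
    (hm.continuous_fderiv one_ne_zero).continuousOn
  refine ⟨1 / 2 * ((M₀ + M₁) * (b - a) ^ 2), fun f hf hsupp => ?_⟩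
  have hf0 : ∀ p, p ∉ Icc a b ×ˢ Icc a b → f p = 0 := fun p hp =>
    image_eq_zero_of_notMem_tsupport fun h => hp (hsupp h)
  have hcs : HasCompactSupport f := hK.of_isClosed_subset (isClosed_tsupport f) hsupp
  have hswap : ∀ p : ℝ × ℝ, ‖p - p.swap‖ = |p.1 - p.2| := fun p => by
    rw [Prod.norm_def]
    simp [Real.norm_eq_abs, abs_sub_comm p.2 p.1]
  have hLip : ∀ B : ℝ, (∀ p, |f p| ≤ B ∧ ‖fderiv ℝ f p‖ ≤ B) →
      ∀ p, |f p * m p - f p.swap * m p.swap| ≤ (M₀ + M₁) * B * |p.1 - p.2| := by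
    intro B hB p
    have hab' : (a, a) ∈ Icc a b ×ˢ Icc a b := ⟨⟨le_rfl, hab⟩, ⟨le_rfl, hab⟩⟩
    have hB0 : 0 ≤ B := (abs_nonneg _).trans (hB 0).1
    have hM₀0 : 0 ≤ M₀ := (norm_nonneg _).trans (hM₀ _ hab')
    have hM₁0 : 0 ≤ M₁ := (norm_nonneg _).trans (hM₁ _ hab')
    by_cases hp : p ∈ Icc a b ×ˢ Icc a b
    · have hp' : p.swap ∈ Icc a b ×ˢ Icc a b := ⟨hp.2, hp.1⟩
      have k1 : |m p - m p.swap| ≤ M₁ * |p.1 - p.2| := by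
        have := hconv.norm_image_sub_le_of_norm_fderiv_le
          (fun x _ => hm.differentiable one_ne_zero x) hM₁ hp' hp
        rwa [hswap] at this
      have k2 : |f p - f p.swap| ≤ B * |p.1 - p.2| := by
        have := hconv.norm_image_sub_le_of_norm_fderiv_le
          (fun x _ => hf.differentiable one_ne_zero x) (fun x _ => (hB x).2) hp' hp
        rwa [hswap] at this
      have k3 : |m p.swap| ≤ M₀ := hM₀ _ hp'
      rw [show f p * m p - f p.swap * m p.swap =
        f p * (m p - m p.swap) + (f p - f p.swap) * m p.swap by ring]
      refine (abs_add_le _ _).trans ?_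
      rw [abs_mul, abs_mul]
      have j1 := mul_le_mul (hB p).1 k1 (abs_nonneg _) hB0
      have j2 := mul_le_mul k2 k3 (abs_nonneg _) (by positivity)
      linarith
    · have hp' : p.swap ∉ Icc a b ×ˢ Icc a b := fun h => hp ⟨h.2, h.1⟩
      rw [hf0 p hp, hf0 _ hp']
      simp only [zero_mul, sub_zero, abs_zero]
      positivity
  obtain ⟨B₁, hB₁⟩ := hf.continuous.bounded_above_of_compact_support hcs
  obtain ⟨B₂, hB₂⟩ := (hf.continuous_fderiv one_ne_zero).bounded_above_of_compact_support
    (hcs.fderiv (𝕜 := ℝ))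
  refine ⟨_, hasPV_of_antisymm (g := fun p => f p * m p) (hf.continuous.mul hm.continuous)
    (a := a) (b := b) (fun p hp => by simp only [hf0 p hp, zero_mul])
    (hLip (max B₁ B₂) fun p => ⟨(hB₁ p).trans (le_max_left _ _), (hB₂ p).trans (le_max_right _ _)⟩),
    fun B hB => ?_⟩
  have hB0 : 0 ≤ B := (abs_nonneg _).trans (hB 0).1
  have hvol : volume.real (Icc a b ×ˢ Icc a b) = (b - a) ^ 2 := by
    rw [Measure.volume_eq_prod, measureReal_prod_prod, Real.volume_real_Icc_of_le hab, sq]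
  have := norm_setIntegral_le_of_norm_le_const (μ := volume)
    (f := fun p : ℝ × ℝ => (f p * m p - f p.swap * m p.swap) / (p.1 - p.2))
    (C := (M₀ + M₁) * B) hK.measure_lt_top fun p _ => by
      rw [Real.norm_eq_abs, abs_div]
      have := hLip B hB p
      refine div_le_of_le_mul₀ (abs_nonneg _) ?_ this
      have hab' : (a, a) ∈ Icc a b ×ˢ Icc a b := ⟨⟨le_rfl, hab⟩, ⟨le_rfl, hab⟩⟩
      have hM₀0 : 0 ≤ M₀ := (norm_nonneg _).trans (hM₀ _ hab')
      have hM₁0 : 0 ≤ M₁ := (norm_nonneg _).trans (hM₁ _ hab')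
      positivity
  rw [hvol, Real.norm_eq_abs] at this
  rw [abs_mul, abs_of_pos (by norm_num : (0 : ℝ) < 1 / 2)]
  linarith

lemma exists_Icc_of_compact {R : ℝ} (hR : 0 < R) {K : Set ℝ} (hK : IsCompact K)
    (hKR : K ⊆ Ioo 0 R) : ∃ a b, 0 < a ∧ a ≤ b ∧ b < R ∧ K ⊆ Icc a b := by
  rcases K.eq_empty_or_nonempty with rfl | hne
  · exact ⟨R / 2, R / 2, by linarith, le_rfl, by linarith, empty_subset _⟩
  · obtain ⟨a, ha⟩ := hK.exists_isLeast hne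
    obtain ⟨b, hb⟩ := hK.exists_isGreatest hne
    exact ⟨a, b, (hKR ha.1).1, ha.2 hb.1, (hKR hb.1).2, fun x hx => ⟨ha.2 hx, hb.2 hx⟩⟩

/-- Continuously differentiable functions on the line equal to `√l` and `1 / √l` on `[a, b]`. -/
lemma exists_sqrt_extension {a b : ℝ} (ha : 0 < a) (hab : a ≤ b) :
    ∃ κ κ' κ₁ κ₁' : ℝ → ℝ, (∀ l, HasDerivAt κ (κ' l) l) ∧ Continuous κ' ∧
      (∀ l ∈ Icc a b, κ l = Real.sqrt l) ∧ (∀ l, HasDerivAt κ₁ (κ₁' l) l) ∧ Continuous κ₁' ∧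
      ∀ l ∈ Icc a b, κ₁ l = (Real.sqrt l)⁻¹ := by
  have hs : ∀ x ∈ Icc a b, Real.sqrt x ≠ 0 := fun x hx =>
    (Real.sqrt_pos.mpr (ha.trans_le hx.1)).ne'
  have cs : ContinuousOn (fun x : ℝ => 1 / (2 * Real.sqrt x)) (Icc a b) :=
    continuousOn_const.div (by fun_prop) fun x hx => mul_ne_zero two_ne_zero (hs x hx)
  have ds : ∀ x ∈ Icc a b, HasDerivAt (fun x => Real.sqrt x) (1 / (2 * Real.sqrt x)) x :=
    fun x hx => Real.hasDerivAt_sqrt (ha.trans_le hx.1).ne'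
  obtain ⟨κ, κ', cκ', dκ, eκ, -⟩ := exists_C1_extension hab cs
    fun x hx => (ds x hx).hasDerivWithinAt
  obtain ⟨κ₁, κ₁', cκ₁', dκ₁, eκ₁, -⟩ := exists_C1_extension hab
    (f := fun x => (Real.sqrt x)⁻¹) (f' := fun x => -(1 / (2 * Real.sqrt x)) / Real.sqrt x ^ 2)
    (cs.neg.div (by fun_prop) fun x hx => pow_ne_zero 2 (hs x hx))
    fun x hx => ((ds x hx).inv (hs x hx)).hasDerivWithinAt
  exact ⟨κ, κ', κ₁, κ₁', dκ, cκ', eκ, dκ₁, cκ₁', eκ₁⟩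

lemma IsZweibein.exists_background {R : ℝ} (hR : 0 < R) {𝒱 : (ℝ → ℂ) → ℝ → Mat2}
    (h𝒱 : IsZweibein R 𝒱) {μ : ℝ → ℂ} (hμ : IsBeltrami R μ) :
    ∃ W q q' p p' θ, IsBackground R (𝒱 μ) W q q' p p' θ := by
  obtain ⟨δ, hδ, -, Vt, Vx, Vxt, Vxx, h⟩ :=
    h𝒱.exists_stripFamily hR hμ (ζ := fun _ => 0) contDiffOn_const
  obtain ⟨q, q', p, p', θ, hB⟩ := h.exists_background hδ hR
  exact ⟨Vx 0, q, q', p, p', θ, by simpa using hB⟩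

lemma IsBackground.core_eq {R a b : ℝ} {V W : ℝ → Mat2} {κ q q' θ : ℝ → ℝ} {p p' : ℝ → ℂ}
    {S S' : ℝ → ℝ → Mat2} (hB : IsBackground R V W q q' p p' θ) (hS : IsRadialSolution κ q p S S')
    (ha : 0 < a) (hbR : b ≤ R) (hκ : Continuous κ) (hκs : ∀ l ∈ Icc a b, κ l = Real.sqrt l)
    {l₁ l₂ : ℝ} (h₁ : l₁ ∈ Icc a b) (h₂ : l₂ ∈ Icc a b) :
    core R V l₁ l₂ = coreOf (S l₁ (Real.sqrt l₁)) (S l₂ (Real.sqrt l₂)) := by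
  have hol : ∀ l ∈ Icc a b, holonomy R V l 0 l = S l (Real.sqrt l) ∧
      holonomy R V l l 0 = (S l (Real.sqrt l)).adjugate := by
    intro l hl
    have := holonomy_eq (ha.trans_le hl.1) (hl.2.trans hbR) hB.connQ_eq hB.connP_eq (hκs l hl)
      ((continuous_radialConn hκ (continuous_of_hasDerivAt hB.deriv_q)
        (continuous_of_hasDerivAt hB.deriv_p)).comp (Continuous.prodMk_right l))
      (hS.zero l) (hS.deriv_r l) (Real.sqrt_nonneg l) le_rfl
    rwa [Real.sq_sqrt (ha.le.trans hl.1), sub_self] at this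
  rw [core, (hol _ h₁).1, (hol _ h₁).2, (hol _ h₂).1, (hol _ h₂).2, coreOf]

/-- The right side of the bracket is a distribution of order at most one. -/
theorem exists_hasPV_core {R : ℝ} (hR : 0 < R) {𝒱 : (ℝ → ℂ) → ℝ → Mat2} (h𝒱 : IsZweibein R 𝒱)
    {μ : ℝ → ℂ} (hμ : IsBeltrami R μ) {K : Set (ℝ × ℝ)} (hK : IsCompact K)
    (hKR : K ⊆ Ioo 0 R ×ˢ Ioo 0 R) :
    ∃ C : ℝ, ∀ f : ℝ × ℝ → ℝ, ContDiff ℝ 1 f → tsupport f ⊆ K →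
      ∀ i j : Fin 2 × Fin 2, ∃ c : ℝ, HasPV (fun p => f p * core R (𝒱 μ) p.1 p.2 i j) c ∧
        ∀ B : ℝ, (∀ p, |f p| ≤ B ∧ ‖fderiv ℝ f p‖ ≤ B) → |c| ≤ C * B := by
  obtain ⟨a, b, ha, hab, hbR, hKab⟩ := exists_Icc_of_compact hR
    ((hK.image continuous_fst).union (hK.image continuous_snd)) (by
      rintro x (⟨p, hp, rfl⟩ | ⟨p, hp, rfl⟩)
      · exact (hKR hp).1
      · exact (hKR hp).2)
  have hKbox : K ⊆ Icc a b ×ˢ Icc a b := fun p hp =>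
    ⟨hKab (Or.inl (mem_image_of_mem _ hp)), hKab (Or.inr (mem_image_of_mem _ hp))⟩
  obtain ⟨W, q, q', p, p', θ, hB⟩ := h𝒱.exists_background hR hμ
  obtain ⟨κ, κ', κ₁, κ₁', dκ, cκ', eκ, -, -, -⟩ := exists_sqrt_extension ha hab
  obtain ⟨S, S', hS⟩ := exists_radialSolution dκ cκ' hB.deriv_q hB.cont_q' hB.deriv_p hB.cont_p'
  have cκ := continuous_of_hasDerivAt dκ
  have cq := continuous_of_hasDerivAt hB.deriv_q
  have cp := continuous_of_hasDerivAt hB.deriv_p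
  have cA := continuous_radialConn cκ cq cp
  -- the holonomy from the axis as a function on the line
  have ds : ∀ l, HasDerivAt (fun l => S l (κ l))
      ((1 : ℝ) • S' l (κ l) + κ' l • (radialConn κ q p l (κ l) * S l (κ l))) l := fun l =>
    hasDerivAt_comp_partial (fx := S') (fy := fun l r => radialConn κ q p l r * S l r)
      hS.cont' (cA.mul hS.cont) (fun x y => hS.deriv_l x y) hS.deriv_r (hasDerivAt_id l) (dκ l)
  have cl : Continuous fun l : ℝ => (l, κ l) := continuous_id.prodMk cκ
  have cs' : Continuous fun l =>
      (1 : ℝ) • S' l (κ l) + κ' l • (radialConn κ q p l (κ l) * S l (κ l)) :=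
    ((hS.cont'.comp cl).const_smul (1 : ℝ)).add (cκ'.smul ((cA.comp cl).mul (hS.cont.comp cl)))
  have hs : ∀ i j, ContDiff ℝ 1 fun l => S l (κ l) i j := by
    intro i j
    rw [contDiff_one_iff_deriv]
    have d := fun l => hasDerivAt_mat2_iff.mp (ds l) i j
    exact ⟨fun l => (d l).differentiableAt, by
      rw [show deriv (fun l => S l (κ l) i j) = _ from funext fun l => (d l).deriv]
      exact continuous_mat2_iff.mp cs' i j⟩
  have hm : ∀ i j, ContDiff ℝ 1 fun x : ℝ × ℝ => coreOf (S x.1 (κ x.1)) (S x.2 (κ x.2)) i j :=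
    contDiff_coreOf_apply (fun i j => (hs i j).comp contDiff_fst)
      (fun i j => (hs i j).comp contDiff_snd)
  choose C hC using fun i j => exists_hasPV_bound (hm i j) hab
  refine ⟨∑ i, ∑ j, |C i j|, fun f hf hsupp i j => ?_⟩
  obtain ⟨c, hc, hcB⟩ := hC i j f hf (hsupp.trans hKbox)
  refine ⟨c, ?_, fun B hB' => (hcB B hB').trans ?_⟩
  · convert hc using 2 with x
    by_cases hx : x ∈ Icc a b ×ˢ Icc a b
    · rw [hB.core_eq hS ha hbR.le cκ eκ hx.1 hx.2, eκ _ hx.1, eκ _ hx.2]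
    · rw [image_eq_zero_of_notMem_tsupport fun h => hx (hKbox (hsupp h)), zero_mul, zero_mul]
  · have hB0 : 0 ≤ B := (abs_nonneg _).trans (hB' 0).1
    refine mul_le_mul_of_nonneg_right ((le_abs_self _).trans ?_) hB0
    refine (Finset.single_le_sum (f := fun j => |C i j|) (fun j _ => abs_nonneg _)
      (Finset.mem_univ j)).trans ?_
    exact Finset.single_le_sum (f := fun i => ∑ j, |C i j|)
      (fun i _ => Finset.sum_nonneg fun j _ => abs_nonneg _) (Finset.mem_univ i)

lemma IsTestFunction.exists_hasDerivAt {R : ℝ} {φ : ℝ → Mat2} (h : IsTestFunction R φ) :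
    ∃ φ', (∀ l, HasDerivAt φ (φ' l) l) ∧ Continuous φ' := by
  refine ⟨fun l => Matrix.of fun i j => deriv (fun l => φ l i j) l,
    fun l => hasDerivAt_mat2_iff.mpr fun i j => ?_, continuous_mat2_iff.mpr fun i j => ?_⟩
  · exact ((h.contDiff i j).differentiable one_ne_zero l).hasDerivAt
  · exact (h.contDiff i j).continuous_deriv le_rfl

lemma trace_adjointSection {S : ℝ → ℝ → Mat2} {φ : ℝ → Mat2} {l r : ℝ} (hS : (S l r).det = 1)
    (h : (φ l).trace = 0) : (adjointSection S φ l r).trace = 0 := by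
  rw [adjointSection, mul_assoc, Matrix.trace_mul_comm, mul_assoc, adjugate_mul_of_det hS, mul_one,
    h]

/-- The smeared right side of the bracket. -/
lemma trace_kronecker_core_eq_axisForm {θ : ℝ → ℝ} {S : ℝ → ℝ → Mat2} {φ₁ φ₂ : ℝ → Mat2}
    {l₁ l₂ : ℝ} (hl₁ : 0 ≤ l₁) (hl₂ : 0 ≤ l₂) (hS : ∀ l r, (S l r).det = 1)
    (h₁ : (φ₁ l₁)ᵀ = φ₁ l₁) (h₂ : (φ₂ l₂)ᵀ = φ₂ l₂)
    (ht₁ : (φ₁ l₁).trace = 0) :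
    ((φ₁ l₁ ⊗ₖ φ₂ l₂) * coreOf (S l₁ (Real.sqrt l₁)) (S l₂ (Real.sqrt l₂))).trace =
      1 / 4 * axisForm (fun l r => hComp (adjointSection S φ₁ l r))
        (fun l r => hComp (adjointSection S φ₂ l r)) (sectionRot θ S φ₁) (sectionRot θ S φ₂)
        (l₁, l₂) := by
  have key := trace_mul_eq (adjointSection S φ₁ l₁ (Real.sqrt l₁))
    (adjointSection S φ₂ l₂ (Real.sqrt l₂))
  rw [trace_adjointSection (hS _ _) ht₁] at key
  rw [trace_kronecker_coreOf h₁ h₂ (hS _ _) (hS _ _), ht₁]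
  change 1 / 4 * ((adjointSection S φ₁ l₁ (Real.sqrt l₁) *
    adjointSection S φ₂ l₂ (Real.sqrt l₂)).trace - _) = _
  rw [key]
  simp only [axisForm, sectionRot, Real.sq_sqrt hl₁, Real.sq_sqrt hl₂, sub_self, map_mul]
  rw [show conj (gaugePhase θ 0) * conj (wComp (adjointSection S φ₁ l₁ (Real.sqrt l₁))) *
    (gaugePhase θ 0 * wComp (adjointSection S φ₂ l₂ (Real.sqrt l₂))) =
    conj (gaugePhase θ 0) * gaugePhase θ 0 *
      (conj (wComp (adjointSection S φ₁ l₁ (Real.sqrt l₁))) *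
        wComp (adjointSection S φ₂ l₂ (Real.sqrt l₂))) by ring, conj_gaugePhase_mul]
  ring_nf

/-- The smeared logarithmic bracket is the principal value of the right side. -/
theorem exists_hasPoissonBracket {R : ℝ} (hR : 0 < R) (G₂ : ℝ) {𝒱 : (ℝ → ℂ) → ℝ → Mat2}
    (h𝒱 : IsZweibein R 𝒱) {μ : ℝ → ℂ} (hμ : IsBeltrami R μ) {φ₁ φ₂ : ℝ → Mat2}
    (h₁ : IsTestFunction R φ₁) (h₂ : IsTestFunction R φ₂) :
    ∃ c : ℝ, HasPV (fun p => ((φ₁ p.1 ⊗ₖ φ₂ p.2) * core R (𝒱 μ) p.1 p.2).trace) c ∧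
      HasPoissonBracket R G₂ (smearedU R 𝒱 μ φ₁) (smearedU R 𝒱 μ φ₂) μ
        ((16 * Real.pi * G₂ * c : ℝ) : ℂ) := by
  obtain ⟨a, b, ha, hab, hbR, hK⟩ := exists_Icc_of_compact hR
    (IsCompact.union h₁.hasCompactSupport h₂.hasCompactSupport)
    (union_subset h₁.tsupport_subset h₂.tsupport_subset)
  have s₁ : ∀ l ∉ Icc a b, φ₁ l = 0 := fun l hl =>
    image_eq_zero_of_notMem_tsupport fun h => hl (hK (Or.inl h))
  have s₂ : ∀ l ∉ Icc a b, φ₂ l = 0 := fun l hl =>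
    image_eq_zero_of_notMem_tsupport fun h => hl (hK (Or.inr h))
  obtain ⟨φ₁', d₁, c₁⟩ := h₁.exists_hasDerivAt
  obtain ⟨φ₂', d₂, c₂⟩ := h₂.exists_hasDerivAt
  obtain ⟨W, q, q', p, p', θ, hB⟩ := h𝒱.exists_background hR hμ
  obtain ⟨κ, κ', κ₁, κ₁', dκ, cκ', eκ, dκ₁, cκ₁', eκ₁⟩ := exists_sqrt_extension ha hab
  obtain ⟨S, S', hS⟩ := exists_radialSolution dκ cκ' hB.deriv_q hB.cont_q' hB.deriv_p hB.cont_p'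
  have cκ := continuous_of_hasDerivAt dκ
  have cq := continuous_of_hasDerivAt hB.deriv_q
  have cp := continuous_of_hasDerivAt hB.deriv_p
  have cg : Continuous (gaugePhase θ) :=
    continuous_of_hasDerivAt fun x => hasDerivAt_gaugePhase (hB.deriv_angle x)
  have pair₁ := isRadialPair_adjointSection hS cq hB.deriv_angle d₁ c₁ s₁ h₁.symmetric
  have pair₂ := isRadialPair_adjointSection hS cq hB.deriv_angle d₂ c₂ s₂ h₂.symmetric
  have bracket := hB.hasPoissonBracket G₂ h𝒱 hR hμ hS ha hbR.le cκ eκ dκ₁ cκ₁' eκ₁ d₁ c₁ s₁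
    h₁.symmetric d₂ c₂ s₂ h₂.symmetric
  have abel := neg_integral_abel_bracket ha hab cκ (cg.mul cp) dκ₁ cκ₁' eκ eκ₁ pair₁ pair₂ hbR.le
  obtain ⟨L, hL⟩ := exists_axisForm_sub_swap_le ha cκ (cg.mul cp) pair₁ pair₂
  set N : ℝ × ℝ → ℝ := axisForm (fun l r => hComp (adjointSection S φ₁ l r))
    (fun l r => hComp (adjointSection S φ₂ l r)) (sectionRot θ S φ₁) (sectionRot θ S φ₂) with hN
  have eN : (fun p : ℝ × ℝ => ((φ₁ p.1 ⊗ₖ φ₂ p.2) * core R (𝒱 μ) p.1 p.2).trace) =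
      fun p => 1 / 4 * N p := by
    funext x
    by_cases hx : x.1 ∈ Icc a b
    · by_cases hx' : x.2 ∈ Icc a b
      · rw [hB.core_eq hS ha hbR.le cκ eκ hx hx']
        exact trace_kronecker_core_eq_axisForm (ha.le.trans hx.1) (ha.le.trans hx'.1) hS.det
          (h₁.symmetric _) (h₂.symmetric _) (h₁.trace_eq_zero _)
      · simp [hN, axisForm, sectionRot, adjointSection, s₂ _ hx', hComp, wComp]
    · simp [hN, axisForm, sectionRot, adjointSection, s₁ _ hx, hComp, wComp]
  have m1 : Continuous fun x : ℝ × ℝ => (x.1, Real.sqrt x.1) := by fun_prop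
  have m2 : Continuous fun x : ℝ × ℝ => (x.2, Real.sqrt x.2) := by fun_prop
  have cN : Continuous N :=
    (((continuous_const.mul (pair₁.cont_eta.comp m1))).mul (pair₂.cont_eta.comp m2)).add
      (continuous_const.mul (Complex.continuous_re.comp
        ((Complex.continuous_conj.comp (pair₁.cont_omega.comp m1)).mul
          (pair₂.cont_omega.comp m2))))
  have sN : ∀ x, x ∉ Icc a b ×ˢ Icc a b → N x = 0 := by
    intro x hx
    rw [mem_prod, not_and_or] at hx
    rcases hx with hx | hx
    · simp [hN, axisForm, sectionRot, adjointSection, s₁ _ hx, hComp, wComp]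
    · simp [hN, axisForm, sectionRot, adjointSection, s₂ _ hx, hComp, wComp]
  have pv := hasPV_of_antisymm (g := fun x => 1 / 4 * N x) (L := 1 / 4 * L)
    (continuous_const.mul cN) (a := a) (b := b) (fun x hx => by rw [sN x hx, mul_zero]) fun x => by
      have := hL x
      rw [← mul_sub, abs_mul, abs_of_pos (by norm_num : (0 : ℝ) < 1 / 4), mul_assoc]
      exact mul_le_mul_of_nonneg_left this (by norm_num)
  rw [eN]
  refine ⟨_, pv, ?_⟩
  have e : ∫ x in Icc a b ×ˢ Icc a b, (1 / 4 * N x - 1 / 4 * N x.swap) / (x.1 - x.2) =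
      1 / 4 * ∫ x in Icc a b ×ˢ Icc a b, (N x - N x.swap) / (x.1 - x.2) := by
    rw [← integral_const_mul]
    refine integral_congr_ae (Eventually.of_forall fun x => ?_)
    ring
  rw [e]
  refine (congrArg (HasPoissonBracket R G₂ (smearedU R 𝒱 μ φ₁) (smearedU R 𝒱 μ φ₂) μ)
    (congrArg Complex.ofReal ?_)).mp bracket
  refine (congrArg (fun I => 4 * Real.pi * G₂ * I) abel).trans ?_
  change 4 * Real.pi * G₂ * (1 / 2 * ∫ x in Icc a b ×ˢ Icc a b, (N x - N x.swap) / (x.1 - x.2)) = _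
  ring

end CylGrav

end

theorem mainTheorem2 (R : ℝ) (hR : 0 < R) (G₂ : ℝ)
    (𝒱 : (ℝ → ℂ) → ℝ → CylGrav.Mat2) (h𝒱 : CylGrav.IsZweibein R 𝒱)
    (μ : ℝ → ℂ) (hμ : CylGrav.IsBeltrami R μ) :
    -- the right side is a distribution of order one on `(0, R)²`, including the diagonal
    (∀ K : Set (ℝ × ℝ), IsCompact K → K ⊆ Ioo 0 R ×ˢ Ioo 0 R →
      ∃ C : ℝ, ∀ f : ℝ × ℝ → ℝ, ContDiff ℝ 1 f → tsupport f ⊆ K →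
        ∀ i j : Fin 2 × Fin 2,
          ∃ c : ℝ, CylGrav.HasPV (fun p => f p * CylGrav.core R (𝒱 μ) p.1 p.2 i j) c ∧
            ∀ B : ℝ, (∀ p, |f p| ≤ B ∧ ‖fderiv ℝ f p‖ ≤ B) → |c| ≤ C * B) ∧
    -- and the `𝔨 ⊗ 𝔨` component of the logarithmic bracket is equal to it
    (∀ φ₁ φ₂ : ℝ → CylGrav.Mat2,
      CylGrav.IsTestFunction R φ₁ → CylGrav.IsTestFunction R φ₂ →
        ∃ c : ℝ,
          CylGrav.HasPV
            (fun p => ((φ₁ p.1 ⊗ₖ φ₂ p.2) * CylGrav.core R (𝒱 μ) p.1 p.2).trace) c ∧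
          CylGrav.HasPoissonBracket R G₂
            (CylGrav.smearedU R 𝒱 μ φ₁) (CylGrav.smearedU R 𝒱 μ φ₂) μ
            ((16 * Real.pi * G₂ * c : ℝ) : ℂ)) :=
  ⟨fun _ hK hKR => CylGrav.exists_hasPV_core hR h𝒱 hμ hK hKR,
    fun _ _ h₁ h₂ => CylGrav.exists_hasPoissonBracket hR G₂ h𝒱 hμ h₁ h₂⟩
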